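/- Let $\mathbb D$ be the open unit disc, $\mathbb S^1=\partial\mathbb D$, and let $\Gamma\subset\mathrm{Aut}(\mathbb D)$ be a Fuchsian group (a discrete subgroup) of finite covolume. Let $A:\mathbb S^1\to\mathbb S^1$ be a piecewise Fuchsian Markov map with pieces in $\Gamma$. That is, there are points $x_1,\dots,x_k\in\mathbb S^1$ in counter-clockwise order, cutting $\mathbb S^1$ into the closed arcs $I_j=[x_j,x_{j+1}]$ (indices mod $k$), and elements $g_1,\dots,g_k\in\Gamma$ with $A|_{I_j}=g_j|_{I_j}$, generating a Fuchsian group $\Gamma_A$; the map $A$ is a covering of $\mathbb S^1$ of degree at least two; $A$ is expansive, i.e. there is $\delta>0$ such that for all $a\ne b$ in $\mathbb S^1$ one has $d(A^{\circ n}(a),A^{\circ n}(b))>\delta$ for some $n\ge 0$; and $\{I_j\}$ is a Markov partition for $A$, i.e. each $A(I_j)$ is a union of some of the arcs $I_l$. Suppose that $A$ is minimal: there are no $i$ and $h\in\Gamma_A$ such that $A=h$ on $I_{i-1}\cup I_i$. The fundamental domain of $A$ is $R=\mathbb D\setminus\bigcup_j R_j$, where $R_j$ is the closed region bounded by $I_j$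 and the hyperbolic geodesic with endpoints $x_j,x_{j+1}$; the edges of $R$ are these geodesics, identified with the pairs $\{x_j,x_{j+1}\}$. A pre-image of an unordered pair $\{p,q\}$ is a pair $\{h(p),h(q)\}$, where $h\in\Gamma$ is a branch of $A^{-1}$ (i.e. $A\circ h=\mathrm{id}$) on a closed arc of $\mathbb S^1$ containing $p$ and $q$. The backward orbit $BO_A(\alpha)$ of an edge $\alpha$ consists of $\alpha$ and all its iterated pre-images. Suppose that $A$ is backward edge-orbit equivalent to $\Gamma$: $BO_A(\alpha)=\Gamma\cdot\alpha$ for every edge $\alpha$ of $R$. Then $A$ is the Bowen–Series map of $\Gamma$ associated with the fundamental domain $R$. In particular, $R$ is a fundamental domain of $\Gamma$, and $\mathbb D/\Gamma$ is a sphere with a finite, non-zero number of punctures and with at most two orbifold points, each of order two. Here $A$ is called the Bowen–Series map of $\Gamma$ associated with $R$ if: $R$ is a fundamental domain of $\Gamma$ and an open convex hyperbolic polygon (possibly with ideal vertices) with sides $s_1,\dots,s_n$ in counter-clockwise order; each $s_i$ is mapped by a non-trivial element $h(s_i)\in\Gamma$ onto a side $s_j$ with $h(s_j)=h(s_i)^{-1}$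 ($j=i$ allowed), and these elements generate $\Gamma$; the bi-infinite geodesic $C(s_i)$ containing $s_i$ lies in the union of all $\Gamma$-translates of sides of $R$; and, if $P_i,Q_{i+1}$ are the endpoints of $C(s_i)$, labelled so that $P_1,Q_1,P_2,Q_2,\dots,P_n,Q_n$ occur in this (weak) counter-clockwise order, then $A=h(s_i)$ on the half-open arc $[P_i,P_{i+1})$ for every $i$. -/

import Mathlib

noncomputable section

namespace FuchsianMarkov

open scoped Real ComplexConjugate ENNReal
open Complex

/-! ### Conformal automorphisms of the unit disc -/

/-- `SU(1,1)`: the matrices with rows `(a, b)`, `(conj b, conj a)` and determinant `1`. -/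
def SU11 : Subgroup (Matrix.SpecialLinearGroup (Fin 2) ℂ) where
  carrier := {M | M 1 0 = conj (M 0 1) ∧ M 1 1 = conj (M 0 0)}
  one_mem' := by simp
  mul_mem' := by
    rintro M N ⟨h1, h2⟩ ⟨h3, h4⟩
    constructor <;>
    · simp only [Matrix.SpecialLinearGroup.coe_mul, Matrix.mul_apply,
        Fin.sum_univ_two, h1, h2, h3, h4, map_add, map_mul, Complex.conj_conj]
      ring
  inv_mem' := by
    rintro M ⟨h1, h2⟩
    have e := Matrix.SpecialLinearGroup.SL2_inv_expl M
    rw [e]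
    constructor
    · simp [h1]
    · simp [h2]

/-- The denominator `c z + d` of the Möbius map of `M`. -/
def den (M : SU11) (z : ℂ) : ℂ := M.1 1 0 * z + M.1 1 1

/-- The Möbius map `z ↦ (a z + b) / (c z + d)` of `M`. -/
def mobius (M : SU11) (z : ℂ) : ℂ := (M.1 0 0 * z + M.1 0 1) / den M z

lemma det_eq (M : SU11) :
    normSq (M.1 0 0) - normSq (M.1 0 1) = 1 := by
  have h := M.1.det_coe
  rw [Matrix.det_fin_two, M.2.1, M.2.2, Complex.mul_conj, Complex.mul_conj] at h
  exact_mod_cast h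

lemma normSq_num (M : SU11) (z : ℂ) :
    normSq (M.1 0 0 * z + M.1 0 1) - normSq (den M z) = normSq z - 1 := by
  have h := det_eq M
  have e : normSq (M.1 0 0 * z + M.1 0 1) - normSq (den M z) =
      (normSq (M.1 0 0) - normSq (M.1 0 1)) * (normSq z - 1) := by
    simp only [den, M.2.1, M.2.2, normSq_apply, add_re, add_im, mul_re, mul_im, conj_re,
      conj_im]
    ring
  rw [e, h, one_mul]

lemma den_ne_zero (M : SU11) {z : ℂ} (hz : ‖z‖ ≤ 1) : den M z ≠ 0 := by
  intro h0
  have h := normSq_num M z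
  have hd := det_eq M
  have hz' : normSq z ≤ 1 := by
    rw [normSq_eq_norm_sq]; nlinarith [norm_nonneg z]
  have hn := normSq_nonneg (M.1 0 0 * z + M.1 0 1)
  rw [h0, map_zero] at h
  have hb : normSq (M.1 0 1) * normSq z = normSq (M.1 0 0) := by
    have : M.1 1 0 * z = - M.1 1 1 := by
      rw [den] at h0; linear_combination h0
    have := congrArg normSq this
    rwa [normSq_mul, normSq_neg, M.2.1, M.2.2, normSq_conj, normSq_conj] at this
  nlinarith [normSq_nonneg (M.1 0 1)]

lemma normSq_mobius (M : SU11) {z : ℂ} (hz : ‖z‖ ≤ 1) :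
    1 - ‖mobius M z‖ ^ 2 = (1 - ‖z‖ ^ 2) / normSq (den M z) := by
  have h := normSq_num M z
  have hd : normSq (den M z) ≠ 0 := by simpa using den_ne_zero M hz
  rw [← normSq_eq_norm_sq, ← normSq_eq_norm_sq, mobius, normSq_div]
  field_simp
  linarith

lemma norm_mobius_le (M : SU11) {z : ℂ} (hz : ‖z‖ ≤ 1) : ‖mobius M z‖ ≤ 1 := by
  have h := normSq_mobius M hz
  have : 0 ≤ (1 - ‖z‖ ^ 2) / normSq (den M z) :=
    div_nonneg (by nlinarith [norm_nonneg z]) (normSq_nonneg _)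
  nlinarith [norm_nonneg (mobius M z)]

lemma norm_mobius_lt (M : SU11) {z : ℂ} (hz : ‖z‖ < 1) : ‖mobius M z‖ < 1 := by
  have h := normSq_mobius M hz.le
  have : 0 < (1 - ‖z‖ ^ 2) / normSq (den M z) :=
    div_pos (by nlinarith [norm_nonneg z]) (normSq_pos.2 (den_ne_zero M hz.le))
  nlinarith [norm_nonneg (mobius M z)]

lemma norm_mobius_eq (M : SU11) {z : ℂ} (hz : ‖z‖ = 1) : ‖mobius M z‖ = 1 := by
  have h := normSq_mobius M hz.le
  rw [hz] at h
  have h2 : ‖mobius M z‖ ^ 2 = 1 := by simp at h; linarith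
  nlinarith [norm_nonneg (mobius M z)]

lemma mobius_one (z : ℂ) : mobius (1 : SU11) z = z := by
  simp [mobius, den]

lemma mobius_mul (M N : SU11) {z : ℂ} (hz : ‖z‖ ≤ 1) :
    mobius (M * N) z = mobius M (mobius N z) := by
  have h1 := den_ne_zero N hz
  have h2 := den_ne_zero M (norm_mobius_le N hz)
  have hn : mobius N z * den N z = N.1 0 0 * z + N.1 0 1 := div_mul_cancel₀ _ h1
  have e : den (M * N) z = den M (mobius N z) * den N z := by
    have : den M (mobius N z) * den N z =
        M.1 1 0 * (mobius N z * den N z) + M.1 1 1 * den N z := by rw [den]; ring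
    rw [this, hn]
    simp only [den, Subgroup.coe_mul, Matrix.SpecialLinearGroup.coe_mul, Matrix.mul_apply,
      Fin.sum_univ_two]
    ring
  have e2 : (M * N).1 0 0 * z + (M * N).1 0 1 =
      (M.1 0 0 * mobius N z + M.1 0 1) * den N z := by
    have : (M.1 0 0 * mobius N z + M.1 0 1) * den N z =
        M.1 0 0 * (mobius N z * den N z) + M.1 0 1 * den N z := by ring
    rw [this, hn]
    simp only [den, Subgroup.coe_mul, Matrix.SpecialLinearGroup.coe_mul, Matrix.mul_apply,
      Fin.sum_univ_two]
    ring
  rw [mobius, e, e2, mul_div_mul_right _ _ h1]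
  rfl

/-- `SU(1,1)` acts on the closed unit disc by Möbius maps. -/
instance SU11.instMulActionClosedDisc : MulAction SU11 UnitClosedDisc where
  smul M z := UnitClosedDisc.mk (mobius M z) (norm_mobius_le M z.norm_le_one)
  one_smul _ := UnitClosedDisc.coe_injective (mobius_one _)
  mul_smul M N _ := UnitClosedDisc.coe_injective (mobius_mul M N (UnitClosedDisc.norm_le_one _))

/-- The group `Aut(𝔻)` of conformal automorphisms of the unit disc: `SU(1,1)` modulo the
matrices that act trivially (that is, modulo `±1`), with the quotient topology. -/
abbrev DiscAut : Type := SU11 ⧸ (MulAction.toPermHom SU11 UnitClosedDisc).ker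

instance DiscAut.instMulActionClosedDisc : MulAction DiscAut UnitClosedDisc :=
  MulAction.compHom UnitClosedDisc (QuotientGroup.kerLift (MulAction.toPermHom SU11 UnitClosedDisc))

lemma mk_smul_closedDisc (M : SU11) (z : UnitClosedDisc) :
    (((QuotientGroup.mk M : DiscAut) • z : UnitClosedDisc) : ℂ) = mobius M z := rfl

lemma norm_smul_lt (g : DiscAut) (z : UnitClosedDisc) (hz : ‖(z : ℂ)‖ < 1) :
    ‖((g • z : UnitClosedDisc) : ℂ)‖ < 1 := by
  induction g using QuotientGroup.induction_on with
  | H M => rw [mk_smul_closedDisc]; exact norm_mobius_lt M hz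

lemma norm_smul_eq (g : DiscAut) (z : UnitClosedDisc) (hz : ‖(z : ℂ)‖ = 1) :
    ‖((g • z : UnitClosedDisc) : ℂ)‖ = 1 := by
  induction g using QuotientGroup.induction_on with
  | H M => rw [mk_smul_closedDisc]; exact norm_mobius_eq M hz

/-- A point of the open disc as a point of the closed disc. -/
def ofDisc (z : UnitDisc) : UnitClosedDisc := UnitClosedDisc.mk z z.norm_lt_one.le

/-- A point of the unit circle as a point of the closed disc. -/
def ofCircle (z : Circle) : UnitClosedDisc := UnitClosedDisc.mk z z.norm_coe.le

/-- `Aut(𝔻)` acts on the open unit disc. -/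
instance DiscAut.instMulActionDisc : MulAction DiscAut UnitDisc where
  smul g z := UnitDisc.mk (g • ofDisc z : UnitClosedDisc) (norm_smul_lt g (ofDisc z) z.norm_lt_one)
  one_smul z := UnitDisc.coe_injective
    (congrArg UnitClosedDisc.coe (one_smul DiscAut (ofDisc z)))
  mul_smul g h z := UnitDisc.coe_injective
    (congrArg UnitClosedDisc.coe (mul_smul g h (ofDisc z)))

/-- `Aut(𝔻)` acts on the unit circle. -/
instance DiscAut.instMulActionCircle : MulAction DiscAut Circle where
  smul g z := ⟨(g • ofCircle z : UnitClosedDisc),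
    mem_sphere_zero_iff_norm.2 (norm_smul_eq g (ofCircle z) z.norm_coe)⟩
  one_smul z := Circle.ext (congrArg UnitClosedDisc.coe (one_smul DiscAut (ofCircle z)))
  mul_smul g h z := Circle.ext (congrArg UnitClosedDisc.coe (mul_smul g h (ofCircle z)))

lemma mk_smul_disc (M : SU11) (z : UnitDisc) :
    (((QuotientGroup.mk M : DiscAut) • z : UnitDisc) : ℂ) = mobius M z := rfl

lemma mk_smul_circle (M : SU11) (z : Circle) :
    (((QuotientGroup.mk M : DiscAut) • z : Circle) : ℂ) = mobius M z := rfl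

/-! ### Fuchsian groups -/

/-- A Fuchsian group is a discrete subgroup of `Aut(𝔻)`. -/
def IsFuchsian (Γ : Subgroup DiscAut) : Prop := DiscreteTopology Γ

/-- The hyperbolic area of a subset of the disc, with area element `4 dA / (1 - |z|²)²`. -/
def hyperbolicArea (F : Set UnitDisc) : ℝ≥0∞ :=
  ∫⁻ z in UnitDisc.coe '' F, ENNReal.ofReal (4 / (1 - ‖z‖ ^ 2) ^ 2)

/-- `Γ` has finite covolume: some measurable set of finite hyperbolic area meets every
`Γ`-orbit in the disc. -/
def HasFiniteCovolume (Γ : Subgroup DiscAut) : Prop :=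
  ∃ F : Set UnitDisc, MeasurableSet (UnitDisc.coe '' F) ∧
    (∀ z : UnitDisc, ∃ γ ∈ Γ, γ • z ∈ F) ∧ hyperbolicArea F < ∞

/-- `R` is a fundamental domain for the action of `Γ` on the disc. -/
structure IsFundamentalDomain (Γ : Subgroup DiscAut) (R : Set UnitDisc) : Prop where
  isOpen : IsOpen R
  isConnected : IsConnected R
  disjoint : ∀ γ ∈ Γ, γ ≠ 1 → Disjoint ((fun z => γ • z) '' R) R
  covers : ∀ z : UnitDisc, ∃ γ ∈ Γ, γ • z ∈ closure R

/-- `𝔻/Γ` is a sphere with finitely many (at least one) punctures and with at most two orbifold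
points, all of order two: the orbit space is homeomorphic to the sphere minus a finite non-empty
set, at most two orbits consist of points with non-trivial stabilizer, and these stabilizers have
order two. -/
structure IsPuncturedSphereWithOrderTwoPoints (Γ : Subgroup DiscAut) : Prop where
  punctured_sphere : ∃ P : Set (OnePoint ℂ), P.Finite ∧ P.Nonempty ∧
    Nonempty (MulAction.orbitRel.Quotient Γ UnitDisc ≃ₜ (Pᶜ : Set (OnePoint ℂ)))
  at_most_two : {c : MulAction.orbitRel.Quotient Γ UnitDisc |
    ∃ z : UnitDisc, c = Quotient.mk _ z ∧ MulAction.stabilizer Γ z ≠ ⊥}.encard ≤ 2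
  order_two : ∀ z : UnitDisc, MulAction.stabilizer Γ z ≠ ⊥ →
    Nat.card (MulAction.stabilizer Γ z) = 2

/-! ### Hyperbolic geometry of the disc

For `a < b < a + 2π`, the Euclidean circle (or line) through `exp (i a)` and `exp (i b)` that is
orthogonal to the unit circle has the equation
`cos ((b - a) / 2) * (1 + |z|²) = 2 Re (z exp (-i (a + b) / 2))`: if `cos ((b - a) / 2) ≠ 0`, it is
the circle with centre `c = exp (i (a + b) / 2) / cos ((b - a) / 2)` and radius `√(|c|² - 1)`.
A point `exp (i t)` of the unit circle satisfies the inequality `≤` in place of `=` iff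
`cos ((b - a) / 2) ≤ cos (t - (a + b) / 2)`, that is, iff it lies on the counter-clockwise arc from
`exp (i a)` to `exp (i b)`. -/

/-- The closed arc of the unit circle from `exp (i a)` counter-clockwise to `exp (i b)`. -/
def circleArc (a b : ℝ) : Set Circle := Circle.exp '' Set.Icc a b

/-- The bi-infinite hyperbolic geodesic with ideal endpoints `exp (i a)` and `exp (i b)`. -/
def geodesic (a b : ℝ) : Set UnitDisc :=
  {z | Real.cos ((b - a) / 2) * (1 + ‖(z : ℂ)‖ ^ 2) =
    2 * ((z : ℂ) * (Circle.exp (-((a + b) / 2)) : ℂ)).re}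

/-- The closed hyperbolic half-plane bounded by `geodesic a b` and `circleArc a b` (without its
ideal points). -/
def halfPlane (a b : ℝ) : Set UnitDisc :=
  {z | Real.cos ((b - a) / 2) * (1 + ‖(z : ℂ)‖ ^ 2) ≤
    2 * ((z : ℂ) * (Circle.exp (-((a + b) / 2)) : ℂ)).re}

/-! ### Bowen-Series maps -/

/-- `A` is the Bowen-Series map of `Γ` associated with the fundamental domain `R`.

`R` is an open convex polygon with finitely many sides `s i`, possibly with vertices at infinity.
The index `i` runs through the integers modulo `n`, counter-clockwise. The side `s i` lies on the
geodesic `C i` from `P i = exp (i p i)` to `Q (i + 1) = exp (i q (i + 1))`, and the points occur in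
the (weak) order `P 1, Q 1, P 2, Q 2, …` along the circle. The non-trivial element `h i` of `Γ`
maps `s i` onto a side `s j`, with `h j` the inverse of `h i` (`j = i` is allowed), and these
elements generate `Γ`. Each `C i` lies in the net of all translates of sides (even corners).
Finally `A = h i` on the half-open arc from `P i` to `P (i + 1)`. -/
def IsBowenSeriesMap (Γ : Subgroup DiscAut) (R : Set UnitDisc) (A : Circle → Circle) : Prop :=
  IsFundamentalDomain Γ R ∧
  ∃ (n : ℕ) (p q : ℤ → ℝ) (h : ℤ → DiscAut) (C s : ℤ → Set UnitDisc),
    (∀ i, p (i + n) = p i + 2 * π ∧ q (i + n) = q i + 2 * π ∧ h (i + n) = h i) ∧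
    (∀ i, p i < p (i + 1) ∧ p i ≤ q i ∧ q i ≤ p (i + 1)) ∧
    (∀ i, C i = geodesic (p i) (q (i + 1))) ∧
    R = (⋃ i, halfPlane (p i) (q (i + 1)))ᶜ ∧
    (∀ i, s i = C i ∩ closure R ∧ (s i).Nontrivial) ∧
    (∀ i, h i ∈ Γ ∧ h i ≠ 1 ∧ ∃ j, (fun z => h i • z) '' s i = s j ∧ h j = (h i)⁻¹) ∧
    Subgroup.closure (Set.range h) = Γ ∧
    (∀ i, C i ⊆ ⋃ γ ∈ Γ, ⋃ j, (fun z => γ • z) '' s j) ∧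
    (∀ i, ∀ t ∈ Set.Ico (p i) (p (i + 1)), A (Circle.exp t) = h i • Circle.exp t)

/-! ### Piecewise Möbius maps -/

/-- A piecewise Möbius map of the circle, with its decomposition into pieces. The break-points
are `exp (i angle j)` in counter-clockwise order, the index `j` being an integer modulo the number
of pieces. -/
structure PiecewiseMobiusMap where
  toFun : Circle → Circle
  numPieces : ℕ
  angle : ℤ → ℝ
  angle_strictMono : StrictMono angle
  angle_add : ∀ j, angle (j + numPieces) = angle j + 2 * π
  piece : ℤ → DiscAut
  piece_add : ∀ j, piece (j + numPieces) = piece j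
  toFun_eq : ∀ j, ∀ z ∈ circleArc (angle j) (angle (j + 1)), toFun z = piece j • z

namespace PiecewiseMobiusMap

variable (A : PiecewiseMobiusMap)

/-- The `j`-th break-point. -/
def breakPoint (j : ℤ) : Circle := Circle.exp (A.angle j)

/-- The `j`-th interval of definition. -/
def arc (j : ℤ) : Set Circle := circleArc (A.angle j) (A.angle (j + 1))

/-- The group generated by the pieces. -/
def pieceGroup : Subgroup DiscAut := Subgroup.closure (Set.range A.piece)

/-- `A` is piecewise Fuchsian: its pieces generate a Fuchsian group. -/
def IsPiecewiseFuchsian : Prop := IsFuchsian A.pieceGroup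

/-- There are no superfluous break-points. -/
def IsMinimal : Prop :=
  ¬ ∃ i : ℤ, ∃ h ∈ A.pieceGroup,
    (∀ z ∈ A.arc i, A.toFun z = h • z) ∧ (∀ z ∈ A.arc (i - 1), A.toFun z = h • z)

/-- `A` is expansive. -/
def IsExpansive : Prop :=
  ∃ δ > 0, ∀ a b : Circle, a ≠ b → ∃ n : ℕ, δ < dist (A.toFun^[n] a) (A.toFun^[n] b)

/-- `A` is a covering map of the circle of degree `d`. -/
def IsCoveringOfDegree (d : ℕ) : Prop :=
  IsCoveringMap A.toFun ∧ ∀ y : Circle, (A.toFun ⁻¹' {y}).ncard = d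

/-- The intervals of definition form a Markov partition for `A`: the image of each of them is a
union of such intervals (they cover the circle, have disjoint interiors, and `A` is injective on
each of them, by construction). -/
def IsMarkov : Prop :=
  ∀ j : ℤ, ∃ J : Set ℤ, A.toFun '' A.arc j = ⋃ l ∈ J, A.arc l

/-- `A` is a piecewise Fuchsian Markov map. -/
structure IsPiecewiseFuchsianMarkov : Prop where
  piecewiseFuchsian : A.IsPiecewiseFuchsian
  expansive : A.IsExpansive
  covering : ∃ d : ℕ, 2 ≤ d ∧ A.IsCoveringOfDegree d
  markov : A.IsMarkov

/-- The fundamental domain of `A`: what remains of the disc after removing, for each interval of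
definition, the closed region between that interval and the geodesic with the same endpoints. -/
def fundamentalDomain : Set UnitDisc :=
  (⋃ j : ℤ, halfPlane (A.angle j) (A.angle (j + 1)))ᶜ

/-- The `j`-th edge of the fundamental domain, as the unordered pair of its ideal endpoints. -/
def edge (j : ℤ) : Sym2 Circle := s(A.breakPoint j, A.breakPoint (j + 1))

/-- The backward orbit of a pair `e` of points of the circle, as a predicate on pairs: it contains
`e`, and with `{p, q}` also `{h p, h q}`, whenever `h ∈ Γ` is a branch of the inverse of `A` on an
arc that contains `p` and `q`. -/
inductive InBackwardOrbit (Γ : Subgroup DiscAut) (e : Sym2 Circle) : Sym2 Circle → Prop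
  | self : InBackwardOrbit Γ e e
  | preimage (p q : Circle) (h : DiscAut) (a b : ℝ) :
      InBackwardOrbit Γ e s(p, q) → h ∈ Γ →
      (∀ z ∈ circleArc a b, A.toFun (h • z) = z) →
      p ∈ circleArc a b → q ∈ circleArc a b →
      InBackwardOrbit Γ e s(h • p, h • q)

/-- The backward orbit of a pair of points of the circle. -/
def backwardOrbit (Γ : Subgroup DiscAut) (e : Sym2 Circle) : Set (Sym2 Circle) :=
  {e' | A.InBackwardOrbit Γ e e'}

/-- `A` is backward edge-orbit equivalent to `Γ`: the backward orbit of each edge of the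
fundamental domain is its `Γ`-orbit. -/
def IsBackwardEdgeOrbitEquivalent (Γ : Subgroup DiscAut) : Prop :=
  ∀ j : ℤ, A.backwardOrbit Γ (A.edge j) =
    {e' | ∃ γ ∈ Γ, e' = (A.edge j).map (fun z => γ • z)}

end PiecewiseMobiusMap

end FuchsianMarkov

end

/-! Since g_j lies in Γ, edge-orbit equivalence puts A(edge j) = g_j(edge j) in the backward orbit
of edge j, so some iterate of A brings it back. Every edge is thus periodic under A, and distinct
edges have distinct images (`edge_periodic`, `edge_eq_of_map_eq`). Minimality confines an inverse
branch of A on an arc shorter than a full turn to one arc of the partition, so the endpoints of any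
Γ-translate of an edge lie in one arc, and no translate crosses R (`exists_arc_smul_edge`). With the
Markov property, A therefore sends edges to edges. Along the break-points it moves by steps of ±1
that cannot turn back, so it acts as a rotation or as a reflection. A rotation would make A
injective, which the degree forbids. Hence A sends break-point i to break-point c - i for some c,
and g_i pairs edge i with edge c - 1 - i (`exists_reflection`). These facts are collected in
`IsFoldedPolygon`.

What follows is Poincaré's polygon argument. If γ in Γ moves a point of R into R, then γ maps
vertices to vertices and edges to edges. The edges equivalent to edge i are only i and c - 1 - i,
and this forces γ to fix three consecutive vertices (`eq_one_of_mem`). The return map g_{c-i} g_i at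
vertex i has derivative one there, because expansiveness excludes attraction on either side
(`scale_vertexMap`). Parabolic return maps move points very little deep in the cusps of R, whereas
over a compact part of the disc all fixed-point free elements of Γ move points by a definite amount.
So only finitely many translates of R reach a given compact set (`finite_setOf_closure_mem`), the
union of the closed translates is open and closed, and R is a fundamental domain whose side pairings
generate Γ. Its sides are complete geodesics, so A is the Bowen–Series map with P_i = Q_i.

For the topology, 𝔻/Γ is the closed polygon without its ideal vertices, with edge i glued to edge c
- 1 - i. Parabolicity supplies vertex weights for which one boundary parameter x, modulo k, is
carried by all gluings to c - x. The gluing is then that of a closed disc under complex conjugation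
of its boundary. The Joukowski map realises it as a sphere, and the vertices become the punctures
(`joukowski_eq_iff_exists_smul`). Non-trivial stabilizers occur only over the two fixed points of x
↦ c - x, namely c/2 and (c + k)/2. -/

noncomputable section

namespace FuchsianMarkov

open scoped Real ComplexConjugate ENNReal Topology
open Complex Set Filter

/-! ### Möbius maps of the closed disc -/

/-- A matrix that represents an automorphism of the disc. -/
def rep (g : DiscAut) : SU11 := Quotient.out g

lemma mk_rep (g : DiscAut) : (QuotientGroup.mk (rep g) : DiscAut) = g := Quotient.out_eq g

/-- The action of an automorphism of the disc on complex numbers. -/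
def act (g : DiscAut) (z : ℂ) : ℂ := mobius (rep g) z

/-- The modulus of the denominator of an automorphism of the disc. -/
def scale (g : DiscAut) (z : ℂ) : ℝ := ‖den (rep g) z‖

lemma coe_smul_closedDisc (g : DiscAut) (z : UnitClosedDisc) :
    ((g • z : UnitClosedDisc) : ℂ) = act g z := by
  conv_lhs => rw [← mk_rep g]
  exact mk_smul_closedDisc _ _

lemma coe_smul_disc (g : DiscAut) (z : UnitDisc) : ((g • z : UnitDisc) : ℂ) = act g z := by
  conv_lhs => rw [← mk_rep g]
  exact mk_smul_disc _ _

lemma coe_smul_circle (g : DiscAut) (z : Circle) : ((g • z : Circle) : ℂ) = act g z := by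
  conv_lhs => rw [← mk_rep g]
  exact mk_smul_circle _ _

lemma norm_act_le (g : DiscAut) {z : ℂ} (hz : ‖z‖ ≤ 1) : ‖act g z‖ ≤ 1 := norm_mobius_le _ hz

lemma norm_act_lt (g : DiscAut) {z : ℂ} (hz : ‖z‖ < 1) : ‖act g z‖ < 1 := norm_mobius_lt _ hz

lemma act_mul (g h : DiscAut) {z : ℂ} (hz : ‖z‖ ≤ 1) : act (g * h) z = act g (act h z) := by
  have := congrArg UnitClosedDisc.coe (mul_smul g h (UnitClosedDisc.mk z hz))
  rw [coe_smul_closedDisc, coe_smul_closedDisc, coe_smul_closedDisc] at this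
  exact this

lemma act_one {z : ℂ} (hz : ‖z‖ ≤ 1) : act 1 z = z := by
  have := congrArg UnitClosedDisc.coe (one_smul DiscAut (UnitClosedDisc.mk z hz))
  rw [coe_smul_closedDisc] at this
  exact this

lemma act_inv_act (g : DiscAut) {z : ℂ} (hz : ‖z‖ ≤ 1) : act g⁻¹ (act g z) = z := by
  rw [← act_mul _ _ hz, inv_mul_cancel, act_one hz]

lemma act_act_inv (g : DiscAut) {z : ℂ} (hz : ‖z‖ ≤ 1) : act g (act g⁻¹ z) = z := by
  rw [← act_mul _ _ hz, mul_inv_cancel, act_one hz]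

lemma eq_one_of_act (g : DiscAut) (h : ∀ z : ℂ, ‖z‖ ≤ 1 → act g z = z) : g = 1 := by
  apply QuotientGroup.kerLift_injective (MulAction.toPermHom SU11 UnitClosedDisc)
  rw [map_one]
  ext z : 1
  apply UnitClosedDisc.coe_injective
  change ((g • z : UnitClosedDisc) : ℂ) = z
  rw [coe_smul_closedDisc, h _ z.norm_le_one]

lemma mobius_sub (M : SU11) {z w : ℂ} (hz : ‖z‖ ≤ 1) (hw : ‖w‖ ≤ 1) :
    mobius M z - mobius M w = (z - w) / (den M z * den M w) := by
  have h1 := den_ne_zero M hz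
  have h2 := den_ne_zero M hw
  have hd := M.1.det_coe
  rw [Matrix.det_fin_two] at hd
  rw [mobius, mobius, div_sub_div _ _ h1 h2]
  congr 1
  rw [den, den]
  linear_combination (z - w) * hd

lemma scale_pos (g : DiscAut) {z : ℂ} (hz : ‖z‖ ≤ 1) : 0 < scale g z :=
  norm_pos_iff.2 (den_ne_zero _ hz)

lemma norm_act_sub (g : DiscAut) {z w : ℂ} (hz : ‖z‖ ≤ 1) (hw : ‖w‖ ≤ 1) :
    ‖act g z - act g w‖ = ‖z - w‖ / (scale g z * scale g w) := by
  rw [act, act, mobius_sub _ hz hw, norm_div, norm_mul]; rfl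

lemma one_sub_norm_act (g : DiscAut) {z : ℂ} (hz : ‖z‖ ≤ 1) :
    1 - ‖act g z‖ ^ 2 = (1 - ‖z‖ ^ 2) / scale g z ^ 2 := by
  rw [act, normSq_mobius _ hz, scale, normSq_eq_norm_sq]

/-- Representatives multiply only up to a matrix acting trivially, so the chain rule is read off
from `one_sub_norm_act`, which determines the positive number `scale` inside the disc. -/
lemma scale_mul_of_lt (g h : DiscAut) {z : ℂ} (hz : ‖z‖ < 1) :
    scale (g * h) z = scale g (act h z) * scale h z := by
  have h1 := one_sub_norm_act (g * h) hz.le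
  have h2 := one_sub_norm_act g (norm_act_le h hz.le)
  have h3 := one_sub_norm_act h hz.le
  have p1 := scale_pos (g * h) hz.le
  have p2 := scale_pos g (norm_act_le h hz.le)
  have p3 := scale_pos h hz.le
  rw [act_mul _ _ hz.le, h2, h3] at h1
  have hp : 0 < 1 - ‖z‖ ^ 2 := by nlinarith [norm_nonneg z]
  field_simp at h1
  have : scale (g * h) z ^ 2 = (scale g (act h z) * scale h z) ^ 2 := by
    rw [mul_pow]; linarith
  rwa [sq_eq_sq₀ p1.le (by positivity)] at this

lemma scale_mul (g h : DiscAut) {z : ℂ} (hz : ‖z‖ ≤ 1) :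
    scale (g * h) z = scale g (act h z) * scale h z := by
  rcases hz.lt_or_eq with hz' | hz'
  · exact scale_mul_of_lt g h hz'
  -- On the circle 1 - ‖z‖² vanishes and carries no information; the distance from `z` to the origin
  -- is used in its place.
  have h0 : ‖(0 : ℂ)‖ ≤ 1 := by simp
  have h1 := norm_act_sub (g * h) hz h0
  have e0 := scale_mul_of_lt g h (z := 0) (by simp)
  rw [act_mul _ _ hz, act_mul _ _ h0, norm_act_sub g (norm_act_le h hz) (norm_act_le h h0),
    norm_act_sub h hz h0, e0, sub_zero, hz'] at h1
  have p1 := scale_pos (g * h) hz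
  have p2 := scale_pos g (norm_act_le h hz)
  have p3 := scale_pos h hz
  have p4 := scale_pos g (norm_act_le h h0)
  have p5 := scale_pos h h0
  have h2 : scale (g * h) z * (scale g (act h 0) * scale h 0)
      = scale g (act h z) * scale h z * (scale g (act h 0) * scale h 0) := by
    have h3 := congrArg (fun x : ℝ => x⁻¹) h1
    simp only [inv_div, div_one] at h3
    rw [← h3]
    field_simp
  exact mul_right_cancel₀ (by positivity) h2

lemma scale_one {z : ℂ} (hz : ‖z‖ ≤ 1) : scale 1 z = 1 := by
  have h := scale_mul 1 1 hz
  rw [mul_one, act_one hz] at h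
  have := scale_pos 1 hz
  nlinarith

lemma scale_inv_act (g : DiscAut) {z : ℂ} (hz : ‖z‖ ≤ 1) :
    scale g⁻¹ (act g z) = (scale g z)⁻¹ := by
  have h := scale_mul g⁻¹ g hz
  rw [inv_mul_cancel, scale_one hz] at h
  exact eq_inv_of_mul_eq_one_left h.symm

lemma continuous_den (M : SU11) : Continuous (den M) := by unfold den; fun_prop

lemma continuousOn_act (g : DiscAut) : ContinuousOn (act g) (Metric.closedBall 0 1) := by
  unfold act mobius
  refine ContinuousOn.div (by fun_prop) (continuous_den _).continuousOn ?_
  intro z hz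
  exact den_ne_zero _ (by simpa using hz)

lemma continuous_scale (g : DiscAut) : Continuous (scale g) := (continuous_den _).norm

lemma continuous_smul_disc (g : DiscAut) : Continuous (fun z : UnitDisc => g • z) := by
  rw [UnitDisc.isEmbedding_coe.continuous_iff]
  have : (UnitDisc.coe ∘ fun z : UnitDisc => g • z) = fun z : UnitDisc => act g z :=
    funext fun z => coe_smul_disc g z
  rw [this]
  exact (continuousOn_act g).comp_continuous UnitDisc.continuous_coe
    fun z => by simpa using z.norm_lt_one.le

lemma continuous_smul_circle (g : DiscAut) : Continuous (fun z : Circle => g • z) := by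
  have : Continuous fun z : Circle => ((g • z : Circle) : ℂ) := by
    simp only [coe_smul_circle]
    exact (continuousOn_act g).comp_continuous (by fun_prop)
      fun z => mem_closedBall_zero_iff.2 z.norm_coe.le
  exact continuous_induced_rng.2 this

/-- The homeomorphism of the disc given by an automorphism. -/
def smulHomeo (g : DiscAut) : UnitDisc ≃ₜ UnitDisc where
  toEquiv := MulAction.toPerm g
  continuous_toFun := continuous_smul_disc g
  continuous_invFun := continuous_smul_disc g⁻¹

@[simp] lemma smulHomeo_apply (g : DiscAut) (z : UnitDisc) : smulHomeo g z = g • z := rfl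

/-- Fixed points are roots of a quadratic polynomial; three distinct roots annihilate its
coefficients, so the matrix is scalar. -/
lemma eq_one_of_three_fixed {g : DiscAut} {p q r : Circle} (hpq : p ≠ q) (hpr : p ≠ r)
    (hqr : q ≠ r) (hp : g • p = p) (hq : g • q = q) (hr : g • r = r) : g = 1 := by
  obtain ⟨M, rfl⟩ : ∃ M : SU11, (QuotientGroup.mk M : DiscAut) = g := ⟨_, mk_rep g⟩
  have key : ∀ s : Circle, (QuotientGroup.mk M : DiscAut) • s = s →
      M.1 1 0 * (s : ℂ) ^ 2 + (M.1 1 1 - M.1 0 0) * s - M.1 0 1 = 0 := by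
    intro s hs
    have h := congrArg (Subtype.val : Circle → ℂ) hs
    have h' : mobius M s = s := by rw [← mk_smul_circle]; exact h
    have hd : den M s ≠ 0 := den_ne_zero M s.norm_coe.le
    rw [mobius, div_eq_iff hd, den] at h'
    linear_combination -h'
  have e1 := key p hp
  have e2 := key q hq
  have e3 := key r hr
  have n1 : (p : ℂ) - q ≠ 0 := sub_ne_zero.2 (fun h => hpq (Circle.ext h))
  have n2 : (p : ℂ) - r ≠ 0 := sub_ne_zero.2 (fun h => hpr (Circle.ext h))
  have n3 : (q : ℂ) - r ≠ 0 := sub_ne_zero.2 (fun h => hqr (Circle.ext h))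
  have f1 : M.1 1 0 * ((p : ℂ) + q) + (M.1 1 1 - M.1 0 0) = 0 :=
    mul_left_cancel₀ n1 (by linear_combination e1 - e2)
  have f2 : M.1 1 0 * ((p : ℂ) + r) + (M.1 1 1 - M.1 0 0) = 0 :=
    mul_left_cancel₀ n2 (by linear_combination e1 - e3)
  have c0 : M.1 1 0 = 0 := mul_left_cancel₀ n3 (by linear_combination f1 - f2)
  have c1 : M.1 1 1 = M.1 0 0 := by rw [c0] at f1; linear_combination f1
  have c2 : M.1 0 1 = 0 := by rw [c0, c1] at e1; linear_combination -e1
  have hd := M.1.det_coe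
  rw [Matrix.det_fin_two, c0, c1, c2] at hd
  have hne : M.1 0 0 ≠ 0 := by
    intro h; rw [h] at hd; simp at hd
  apply eq_one_of_act
  intro z hz
  have := coe_smul_closedDisc (QuotientGroup.mk M : DiscAut) (UnitClosedDisc.mk z hz)
  rw [mk_smul_closedDisc] at this
  change _ = act _ z at this
  rw [← this]
  change mobius M z = z
  rw [mobius, den, c0, c1, c2, zero_mul, zero_add, add_zero, mul_div_cancel_left₀ _ hne]

lemma smul_circle_injective (g : DiscAut) : Function.Injective (fun p : Circle => g • p) :=
  MulAction.injective g

lemma eq_of_three {g h : DiscAut} {p q r : Circle} (hpq : p ≠ q) (hpr : p ≠ r)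
    (hqr : q ≠ r) (hp : g • p = h • p) (hq : g • q = h • q) (hr : g • r = h • r) : g = h := by
  have : h⁻¹ * g = 1 := eq_one_of_three_fixed hpq hpr hqr (by rw [mul_smul, hp, inv_smul_smul])
    (by rw [mul_smul, hq, inv_smul_smul]) (by rw [mul_smul, hr, inv_smul_smul])
  exact (inv_mul_eq_one.1 this).symm

lemma exp_ne_of_lt {s t : ℝ} (h1 : s < t) (h2 : t < s + 2 * π) :
    Circle.exp s ≠ Circle.exp t := by
  intro h
  have := Circle.exp_injOn_Icc (a := s) (b := t) (by linarith) ⟨le_rfl, h1.le⟩ ⟨h1.le, le_rfl⟩ h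
  linarith

lemma eq_of_eqOn_circleArc {g h : DiscAut} {a b : ℝ} (hab : a < b)
    (H : ∀ z ∈ circleArc a b, g • z = h • z) : g = h := by
  -- Cutting the arc to length at most π makes its two ends and its midpoint three distinct points.
  set c := min b (a + π) with hc
  have h1 : a < c := lt_min hab (by linarith [Real.pi_pos])
  have h2 : c ≤ b := min_le_left _ _
  have h3 : c ≤ a + π := min_le_right _ _
  have hpi := Real.pi_pos
  exact eq_of_three (exp_ne_of_lt (s := a) (t := (a + c) / 2) (by linarith) (by linarith))
    (exp_ne_of_lt (s := a) (t := c) (by linarith) (by linarith))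
    (exp_ne_of_lt (s := (a + c) / 2) (t := c) (by linarith) (by linarith))
    (H _ ⟨_, ⟨le_rfl, hab.le⟩, rfl⟩) (H _ ⟨_, ⟨by linarith, by linarith⟩, rfl⟩)
    (H _ ⟨_, ⟨by linarith, by linarith⟩, rfl⟩)

/-! ### Half-planes and arcs -/

/-- The function whose zero set is the geodesic and whose non-positivity set is the half-plane. -/
def side (a b : ℝ) (z : ℂ) : ℝ :=
  Real.cos ((b - a) / 2) * (1 + ‖z‖ ^ 2) - 2 * (z * (Circle.exp (-((a + b) / 2)) : ℂ)).re

lemma mem_halfPlane {a b : ℝ} {z : UnitDisc} : z ∈ halfPlane a b ↔ side a b z ≤ 0 := by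
  simp [halfPlane, side]

lemma mem_geodesic {a b : ℝ} {z : UnitDisc} : z ∈ geodesic a b ↔ side a b z = 0 := by
  simp [geodesic, side, sub_eq_zero]

lemma continuous_side (a b : ℝ) : Continuous (side a b) := by unfold side; fun_prop

lemma side_exp (a b t : ℝ) :
    side a b (Circle.exp t) = -4 * (Real.sin ((t - a) / 2) * Real.sin ((b - t) / 2)) := by
  have h : ((Circle.exp t : ℂ) * (Circle.exp (-((a + b) / 2)) : ℂ)).re
      = Real.cos (t - (a + b) / 2) := by
    rw [← Circle.coe_mul, ← Circle.exp_add, Circle.coe_exp, Complex.exp_ofReal_mul_I_re]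
    congr 1
  rw [side, h, Circle.norm_coe]
  have : Real.cos ((b - a) / 2) - Real.cos (t - (a + b) / 2) =
      -2 * (Real.sin ((t - a) / 2) * Real.sin ((b - t) / 2)) := by
    rw [Real.cos_sub_cos]
    have e1 : ((b - a) / 2 + (t - (a + b) / 2)) / 2 = (t - a) / 2 := by ring
    have e2 : ((b - a) / 2 - (t - (a + b) / 2)) / 2 = (b - t) / 2 := by ring
    rw [e1, e2]; ring
  linear_combination 2 * this

lemma side_eq_of_add (a b : ℝ) (z : ℂ) : side (a + 2 * π) (b + 2 * π) z = side a b z := by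
  have e1 : (b + 2 * π - (a + 2 * π)) / 2 = (b - a) / 2 := by ring
  have e2 : -((a + 2 * π + (b + 2 * π)) / 2) = -((a + b) / 2) - 2 * π := by ring
  rw [side, e1, e2, Circle.exp_sub_two_pi, side]

/-- The complementary arc has the same geodesic and the opposite half-plane. This is how reversal of
an edge enters later. -/
lemma side_swap (a b : ℝ) (z : ℂ) : side b (a + 2 * π) z = - side a b z := by
  have e1 : (a + 2 * π - b) / 2 = π - (b - a) / 2 := by ring
  have e2 : -((b + (a + 2 * π)) / 2) = -((a + b) / 2) - π := by ring
  have e3 : (Circle.exp (-((a + b) / 2) - π) : ℂ) = - (Circle.exp (-((a + b) / 2)) : ℂ) := by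
    rw [sub_eq_add_neg, Circle.exp_add, Circle.exp_neg π]
    simp [Circle.coe_exp]
  rw [side, e1, e2, e3, Real.cos_pi_sub, side]
  simp only [mul_neg, neg_re]
  ring

lemma exists_exp_eq (a : ℝ) (p : Circle) : ∃ t, a ≤ t ∧ t < a + 2 * π ∧ Circle.exp t = p := by
  obtain ⟨s, rfl⟩ := Circle.exp_surjective p
  refine ⟨toIcoMod Real.two_pi_pos a s, left_le_toIcoMod _ _ _, toIcoMod_lt_right _ _ _, ?_⟩
  rw [Circle.exp_eq_exp]
  refine ⟨-toIcoDiv Real.two_pi_pos a s, ?_⟩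
  have := toIcoMod_add_toIcoDiv_zsmul Real.two_pi_pos a s
  rw [zsmul_eq_mul] at this
  push_cast
  linarith

lemma side_exp_nonpos_iff {a b t : ℝ} (hab : a < b) (hb : b < a + 2 * π) (h1 : a ≤ t)
    (h2 : t < a + 2 * π) : side a b (Circle.exp t) ≤ 0 ↔ t ≤ b := by
  rw [side_exp]
  constructor
  · intro h
    by_contra! hlt
    have s1 : 0 < Real.sin ((t - a) / 2) :=
      Real.sin_pos_of_pos_of_lt_pi (by linarith) (by linarith)
    have s2 : Real.sin ((b - t) / 2) < 0 :=
      Real.sin_neg_of_neg_of_neg_pi_lt (by linarith) (by linarith)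
    nlinarith
  · intro h
    have s1 : 0 ≤ Real.sin ((t - a) / 2) :=
      Real.sin_nonneg_of_nonneg_of_le_pi (by linarith) (by linarith)
    have s2 : 0 ≤ Real.sin ((b - t) / 2) :=
      Real.sin_nonneg_of_nonneg_of_le_pi (by linarith) (by linarith)
    nlinarith [mul_nonneg s1 s2]

lemma mem_circleArc {a b : ℝ} (hab : a < b) (hb : b < a + 2 * π) {p : Circle} :
    p ∈ circleArc a b ↔ side a b p ≤ 0 := by
  constructor
  · rintro ⟨t, ⟨h1, h2⟩, rfl⟩
    exact (side_exp_nonpos_iff hab hb h1 (by linarith)).2 h2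
  · intro h
    obtain ⟨t, h1, h2, rfl⟩ := exists_exp_eq a p
    exact ⟨t, ⟨h1, (side_exp_nonpos_iff hab hb h1 h2).1 h⟩, rfl⟩

lemma side_exp_eq_zero_iff {a b t : ℝ} (hab : a < b) (hb : b < a + 2 * π) (h1 : a ≤ t)
    (h2 : t < a + 2 * π) : side a b (Circle.exp t) = 0 ↔ t = a ∨ t = b := by
  rw [side_exp]
  constructor
  · intro h
    rcases mul_eq_zero.1 h with h | h
    · norm_num at h
    rcases mul_eq_zero.1 h with h | h
    · left
      by_contra hne
      have : 0 < Real.sin ((t - a) / 2) :=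
        Real.sin_pos_of_pos_of_lt_pi (by linarith [lt_of_le_of_ne h1 (Ne.symm hne)])
          (by linarith)
      linarith
    · right
      rcases lt_trichotomy t b with hlt | he | hgt
      · have : 0 < Real.sin ((b - t) / 2) :=
          Real.sin_pos_of_pos_of_lt_pi (by linarith) (by linarith)
        linarith
      · exact he
      · have : Real.sin ((b - t) / 2) < 0 :=
          Real.sin_neg_of_neg_of_neg_pi_lt (by linarith) (by linarith)
        linarith
  · rintro (rfl | rfl) <;> simp

lemma side_left (a b : ℝ) : side a b (Circle.exp a) = 0 := by rw [side_exp]; simp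

lemma side_right (a b : ℝ) : side a b (Circle.exp b) = 0 := by rw [side_exp]; simp

/-- The argument of (z - p) times the conjugate of (z - q) is the angle under which the chord pq is
seen from z. Differences such as z - p transform simply under Möbius maps, so this identity makes
`side` tractable in `side_act`. -/
lemma exp_mul_sub_mul_conj_sub (a b : ℝ) (z : ℂ) :
    (Circle.exp ((b - a) / 2) : ℂ) * ((z - Circle.exp a) * conj (z - Circle.exp b)) =
      side a b z - Real.sin ((b - a) / 2) * (1 - ‖z‖ ^ 2) * I := by
  have hz : z * conj z = (‖z‖ ^ 2 : ℂ) := Complex.mul_conj' z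
  have e1 : (Circle.exp ((b - a) / 2) : ℂ) * conj (Circle.exp b : ℂ)
      = (Circle.exp (-((a + b) / 2)) : ℂ) := by
    rw [← Circle.coe_inv_eq_conj, ← Circle.exp_neg, ← Circle.coe_mul, ← Circle.exp_add]
    congr 2; ring
  have e2 : (Circle.exp ((b - a) / 2) : ℂ) * (Circle.exp a : ℂ)
      = conj (Circle.exp (-((a + b) / 2)) : ℂ) := by
    rw [← Circle.coe_inv_eq_conj, ← Circle.exp_neg, ← Circle.coe_mul, ← Circle.exp_add]
    congr 2; ring
  have e3 : (Circle.exp ((b - a) / 2) : ℂ) * ((Circle.exp a : ℂ) * conj (Circle.exp b : ℂ))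
      = conj (Circle.exp ((b - a) / 2) : ℂ) := by
    rw [← Circle.coe_inv_eq_conj, ← Circle.coe_inv_eq_conj, ← Circle.exp_neg, ← Circle.exp_neg,
      ← Circle.coe_mul, ← Circle.coe_mul, ← Circle.exp_add, ← Circle.exp_add]
    congr 2; ring
  have e4 : (Circle.exp ((b - a) / 2) : ℂ) = Real.cos ((b - a) / 2) + Real.sin ((b - a) / 2) * I := by
    rw [Circle.coe_exp, Complex.exp_mul_I]; push_cast; rfl
  have e5 : conj (Circle.exp ((b - a) / 2) : ℂ)
      = Real.cos ((b - a) / 2) - Real.sin ((b - a) / 2) * I := by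
    rw [e4]; simp only [map_add, map_mul, conj_ofReal, conj_I]; ring
  have e6 : z * (Circle.exp (-((a + b) / 2)) : ℂ) + conj z * conj (Circle.exp (-((a + b) / 2)) : ℂ)
      = 2 * ((z * (Circle.exp (-((a + b) / 2)) : ℂ)).re : ℂ) := by
    rw [← map_mul, Complex.add_conj]; push_cast; ring
  rw [map_sub]
  have : (Circle.exp ((b - a) / 2) : ℂ) * ((z - Circle.exp a) * (conj z - conj (Circle.exp b : ℂ)))
      = (Circle.exp ((b - a) / 2) : ℂ) * (z * conj z)
        - (z * ((Circle.exp ((b - a) / 2) : ℂ) * conj (Circle.exp b : ℂ))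
          + conj z * ((Circle.exp ((b - a) / 2) : ℂ) * (Circle.exp a : ℂ)))
        + (Circle.exp ((b - a) / 2) : ℂ) * ((Circle.exp a : ℂ) * conj (Circle.exp b : ℂ)) := by
    ring
  rw [this, e1, e2, e3, e6, e5, e4, hz, side]
  push_cast
  ring

lemma den_sq_mul_act (g : DiscAut) {p : ℂ} (hp : ‖p‖ = 1) :
    den (rep g) p ^ 2 * act g p = (scale g p ^ 2 : ℝ) * p := by
  have h1 := den_ne_zero (rep g) hp.le
  have hpp : conj p * p = 1 := by rw [Complex.conj_mul', hp]; simp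
  have e : (rep g).1 0 0 * p + (rep g).1 0 1 = conj (den (rep g) p) * p := by
    rw [den, (rep g).2.1, (rep g).2.2]
    simp only [map_add, map_mul, conj_conj]
    linear_combination -(rep g).1 0 1 * hpp
  have e2 : act g p * den (rep g) p = conj (den (rep g) p) * p := by
    rw [act, mobius, div_mul_cancel₀ _ h1, e]
  have e3 : conj (den (rep g) p) * den (rep g) p = ((scale g p ^ 2 : ℝ) : ℂ) := by
    rw [Complex.conj_mul', scale]; push_cast; rfl
  rw [← e3]
  linear_combination den (rep g) p * e2

/-- By `mobius_sub`, replacing z by its image multiplies the identity `exp_mul_sub_mul_conj_sub` by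
a factor ρ independent of z. The action on the two endpoints determines ρ² as a positive square, and
the imaginary parts at z = 0, where both sines are positive, determine its sign. -/
lemma side_act {g : DiscAut} {a b a' b' : ℝ} (hab : a < b) (hb : b < a + 2 * π) (hab' : a' < b')
    (hb' : b' < a' + 2 * π) (h1 : g • Circle.exp a = Circle.exp a')
    (h2 : g • Circle.exp b = Circle.exp b') :
    ∃ C > 0, ∀ z : ℂ, ‖z‖ ≤ 1 → side a' b' (act g z) * scale g z ^ 2 = C * side a b z := by
  have hpi := Real.pi_pos
  have g1 : act g (Circle.exp a) = Circle.exp a' := by rw [← coe_smul_circle, h1]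
  have g2 : act g (Circle.exp b) = Circle.exp b' := by rw [← coe_smul_circle, h2]
  set da := den (rep g) (Circle.exp a) with hda
  set db := den (rep g) (Circle.exp b) with hdb
  have nda : da ≠ 0 := den_ne_zero _ (by simp)
  have ndb : db ≠ 0 := den_ne_zero _ (by simp)
  have ncdb : conj db ≠ 0 := by simpa using ndb
  have k1 : da ^ 2 * Circle.exp a' = (‖da‖ ^ 2 : ℝ) * Circle.exp a := by
    rw [← g1]; exact den_sq_mul_act g (by simp)
  have k2 : db ^ 2 * Circle.exp b' = (‖db‖ ^ 2 : ℝ) * Circle.exp b := by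
    rw [← g2]; exact den_sq_mul_act g (by simp)
  have k2' : conj db ^ 2 * (Circle.exp (-b') : ℂ) = (‖db‖ ^ 2 : ℝ) * (Circle.exp (-b) : ℂ) := by
    have := congrArg conj k2
    rw [map_mul, map_mul, map_pow, conj_ofReal, ← Circle.coe_inv_eq_conj,
      ← Circle.coe_inv_eq_conj, ← Circle.exp_neg, ← Circle.exp_neg] at this
    exact this
  set E : ℂ := (Circle.exp ((b - a) / 2) : ℂ) with hE
  set E' : ℂ := (Circle.exp ((b' - a') / 2) : ℂ) with hE'
  have nE : E ≠ 0 := Circle.coe_ne_zero _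
  set ρ : ℂ := E' / (E * (da * conj db)) with hρ
  set r0 : ℝ := 1 / (‖da‖ * ‖db‖) with hr0
  have hr0pos : 0 < r0 := by
    have := norm_pos_iff.2 nda; have := norm_pos_iff.2 ndb; positivity
  have hρ2 : ρ ^ 2 = (r0 : ℂ) ^ 2 := by
    have x1 : E' ^ 2 = (Circle.exp (b' - a') : ℂ) := by
      rw [hE', ← Circle.coe_pow, ← Circle.exp_nsmul]; congr 2; simp; ring
    have x2 : E ^ 2 = (Circle.exp (b - a) : ℂ) := by
      rw [hE, ← Circle.coe_pow, ← Circle.exp_nsmul]; congr 2; simp; ring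
    have x3 : (Circle.exp (b' - a') : ℂ) * ((Circle.exp a' : ℂ) * (Circle.exp (-b') : ℂ)) = 1 := by
      rw [← Circle.coe_mul, ← Circle.coe_mul, ← Circle.exp_add, ← Circle.exp_add,
        show ∀ s t : ℝ, s - t + (t + -s) = 0 by intros; ring, Circle.exp_zero, Circle.coe_one]
    have x4 : (Circle.exp (b - a) : ℂ) * ((Circle.exp a : ℂ) * (Circle.exp (-b) : ℂ)) = 1 := by
      rw [← Circle.coe_mul, ← Circle.coe_mul, ← Circle.exp_add, ← Circle.exp_add,
        show ∀ s t : ℝ, s - t + (t + -s) = 0 by intros; ring, Circle.exp_zero, Circle.coe_one]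
    have na : (‖da‖ : ℂ) ≠ 0 := by simpa using nda
    have nb : (‖db‖ : ℂ) ≠ 0 := by simpa using ndb
    have key : E' ^ 2 * (‖da‖ ^ 2 * ‖db‖ ^ 2 : ℂ) = E ^ 2 * (da ^ 2 * conj db ^ 2) := by
      rw [x1, x2]
      have n1 : ((Circle.exp a' : ℂ) * (Circle.exp (-b') : ℂ)) ≠ 0 :=
        mul_ne_zero (Circle.coe_ne_zero _) (Circle.coe_ne_zero _)
      have n2 : ((Circle.exp a : ℂ) * (Circle.exp (-b) : ℂ)) ≠ 0 :=
        mul_ne_zero (Circle.coe_ne_zero _) (Circle.coe_ne_zero _)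
      have k3 : (da ^ 2 * conj db ^ 2) * ((Circle.exp a' : ℂ) * (Circle.exp (-b') : ℂ))
          = (‖da‖ ^ 2 * ‖db‖ ^ 2 : ℂ) * ((Circle.exp a : ℂ) * (Circle.exp (-b) : ℂ)) := by
        rw [ofReal_pow] at k1 k2'
        linear_combination (conj db ^ 2 * (Circle.exp (-b') : ℂ)) * k1
          + (‖da‖ ^ 2 * (Circle.exp a : ℂ)) * k2'
      apply mul_right_cancel₀ n1
      linear_combination (‖da‖ ^ 2 * ‖db‖ ^ 2 : ℂ) * x3 - (‖da‖ ^ 2 * ‖db‖ ^ 2 : ℂ) * x4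
        - (Circle.exp (b - a) : ℂ) * k3
    rw [hρ, hr0]
    push_cast
    field_simp
    linear_combination key
  have main : ∀ z : ℂ, ‖z‖ ≤ 1 →
      ((side a' b' (act g z) * scale g z ^ 2 : ℝ) : ℂ)
        - (Real.sin ((b' - a') / 2) * (1 - ‖z‖ ^ 2) : ℝ) * I
      = ρ * (side a b z - Real.sin ((b - a) / 2) * (1 - ‖z‖ ^ 2) * I) := by
    intro z hz
    have hd : den (rep g) z ≠ 0 := den_ne_zero _ hz
    have hcd : conj (den (rep g) z) ≠ 0 := by simpa using hd
    have y1 := exp_mul_sub_mul_conj_sub a' b' (act g z)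
    have y2 := exp_mul_sub_mul_conj_sub a b z
    have y3 : act g z - Circle.exp a' = (z - Circle.exp a) / (den (rep g) z * da) := by
      rw [← g1, act, act, mobius_sub _ hz (by simp)]
    have y4 : act g z - Circle.exp b' = (z - Circle.exp b) / (den (rep g) z * db) := by
      rw [← g2, act, act, mobius_sub _ hz (by simp)]
    have y5 := one_sub_norm_act g hz
    have hsc : (scale g z : ℂ) ^ 2 = den (rep g) z * conj (den (rep g) z) := by
      rw [Complex.mul_conj', scale]
    have hsp := (scale_pos g hz).ne'
    have y6 : (1 - ‖act g z‖ ^ 2) * scale g z ^ 2 = 1 - ‖z‖ ^ 2 := by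
      rw [y5]; field_simp
    have y7 := congrArg (fun x : ℝ => (x : ℂ)) y6
    push_cast at y7
    rw [y3, y4, ← hE', map_div₀ (starRingEnd ℂ), map_mul (starRingEnd ℂ)] at y1
    rw [← hE] at y2
    have y8 : E' * ((z - Circle.exp a) / (den (rep g) z * da) *
        (conj (z - Circle.exp b) / (conj (den (rep g) z) * conj db))) * (scale g z : ℂ) ^ 2
        = ρ * (E * ((z - Circle.exp a) * conj (z - Circle.exp b))) := by
      rw [hsc, hρ]
      field_simp
    rw [y1, y2] at y8
    rw [← y8, ofReal_mul, ofReal_mul, ofReal_pow, ofReal_sub, ofReal_one, ofReal_pow]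
    linear_combination (Real.sin ((b' - a') / 2) : ℂ) * I * y7
  have sp : 0 < Real.sin ((b - a) / 2) := Real.sin_pos_of_pos_of_lt_pi (by linarith) (by linarith)
  have sp' : 0 < Real.sin ((b' - a') / 2) :=
    Real.sin_pos_of_pos_of_lt_pi (by linarith) (by linarith)
  have hρr : ρ = (r0 : ℂ) := by
    rcases sq_eq_sq_iff_eq_or_eq_neg.1 hρ2 with h | h
    · exact h
    exfalso
    have := main 0 (by simp)
    rw [h] at this
    have him := congrArg Complex.im this
    simp only [sub_im, ofReal_im, mul_im, neg_re, neg_im, ofReal_re, I_re, I_im, sub_re, mul_re,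
      norm_zero] at him
    norm_num at him
    nlinarith
  refine ⟨r0, hr0pos, fun z hz => ?_⟩
  have := main z hz
  rw [hρr] at this
  have h3 : ((side a b z : ℂ) - Real.sin ((b - a) / 2) * (1 - ‖z‖ ^ 2) * I)
      = (side a b z : ℂ) - (Real.sin ((b - a) / 2) * (1 - ‖z‖ ^ 2) : ℝ) * I := by push_cast; ring
  rw [h3] at this
  have h4 := congrArg Complex.re this
  simp only [sub_re, ofReal_im, mul_re, ofReal_re, I_re, I_im] at h4
  linarith [h4]

/-- `g` maps the arc from `exp (i a)` to `exp (i b)` onto the arc from `exp (i a')` to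
`exp (i b')`. -/
structure MapsArc (g : DiscAut) (a b a' b' : ℝ) : Prop where
  lt : a < b
  lt_two_pi : b < a + 2 * π
  lt' : a' < b'
  lt_two_pi' : b' < a' + 2 * π
  left : g • Circle.exp a = Circle.exp a'
  right : g • Circle.exp b = Circle.exp b'

namespace MapsArc

variable {g : DiscAut} {a b a' b' : ℝ}

lemma inv (h : MapsArc g a b a' b') : MapsArc g⁻¹ a' b' a b :=
  ⟨h.lt', h.lt_two_pi', h.lt, h.lt_two_pi, by rw [← h.left, inv_smul_smul],
    by rw [← h.right, inv_smul_smul]⟩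

lemma side_nonpos_iff (h : MapsArc g a b a' b') {z : ℂ} (hz : ‖z‖ ≤ 1) :
    side a' b' (act g z) ≤ 0 ↔ side a b z ≤ 0 := by
  obtain ⟨C, hC, H⟩ := side_act h.lt h.lt_two_pi h.lt' h.lt_two_pi' h.left h.right
  have h := H z hz
  have hs := pow_pos (scale_pos g hz) 2
  constructor <;> intro h' <;> by_contra! hlt
  · nlinarith [mul_pos hC hlt]
  · nlinarith [mul_pos hlt hs]

lemma side_nonneg_iff (h : MapsArc g a b a' b') {z : ℂ} (hz : ‖z‖ ≤ 1) :
    0 ≤ side a' b' (act g z) ↔ 0 ≤ side a b z := by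
  obtain ⟨C, hC, H⟩ := side_act h.lt h.lt_two_pi h.lt' h.lt_two_pi' h.left h.right
  have h := H z hz
  have hs := pow_pos (scale_pos g hz) 2
  constructor <;> intro h' <;> by_contra! hlt
  · nlinarith [mul_neg_of_pos_of_neg hC hlt]
  · nlinarith [mul_neg_of_neg_of_pos hlt hs]

lemma side_pos_iff (h : MapsArc g a b a' b') {z : ℂ} (hz : ‖z‖ ≤ 1) :
    0 < side a' b' (act g z) ↔ 0 < side a b z := by
  rw [← not_le, h.side_nonpos_iff hz, not_le]

lemma smul_mem_circleArc_iff (h : MapsArc g a b a' b') {p : Circle} :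
    g • p ∈ circleArc a' b' ↔ p ∈ circleArc a b := by
  rw [mem_circleArc h.lt' h.lt_two_pi', mem_circleArc h.lt h.lt_two_pi, coe_smul_circle,
    h.side_nonpos_iff p.norm_coe.le]

end MapsArc

lemma exists_mapsArc (g : DiscAut) {a b : ℝ} (hab : a < b) (hb : b < a + 2 * π) :
    ∃ a' b', MapsArc g a b a' b' := by
  obtain ⟨a', ha'⟩ := Circle.exp_surjective (g • Circle.exp a)
  obtain ⟨b', h1, h2, h3⟩ := exists_exp_eq a' (g • Circle.exp b)
  refine ⟨a', b', hab, hb, lt_of_le_of_ne h1 ?_, h2, ha'.symm, h3.symm⟩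
  rintro rfl
  exact exp_ne_of_lt hab hb (smul_circle_injective g (ha'.symm.trans h3))

/-! ### Discreteness -/

lemma continuous_entry (i j : Fin 2) : Continuous fun M : SU11 => M.1 i j := by
  have h1 : Continuous fun M : SU11 => M.1 := continuous_subtype_val
  have h2 : Continuous fun M : Matrix.SpecialLinearGroup (Fin 2) ℂ => M.1 := continuous_subtype_val
  exact (continuous_apply_apply i j).comp (h2.comp h1)

lemma continuous_mobius_apply {z : ℂ} (hz : ‖z‖ ≤ 1) : Continuous fun M : SU11 => mobius M z := by
  have h00 := continuous_entry 0 0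
  have h01 := continuous_entry 0 1
  have h10 := continuous_entry 1 0
  have h11 := continuous_entry 1 1
  unfold mobius
  refine Continuous.div (by fun_prop) ?_ fun M => den_ne_zero M hz
  unfold den
  fun_prop

/-- A closed kernel makes `DiscAut` Hausdorff, so that a discrete subgroup of it is closed. -/
instance isClosed_ker : IsClosed
    ((MulAction.toPermHom SU11 UnitClosedDisc).ker : Set SU11) := by
  have : ((MulAction.toPermHom SU11 UnitClosedDisc).ker : Set SU11) =
      ⋂ z : UnitClosedDisc, {M | mobius M z = z} := by
    ext M
    simp only [SetLike.mem_coe, MonoidHom.mem_ker, mem_iInter, mem_ofPred_eq]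
    constructor
    · intro h z
      have := congrArg (fun e : Equiv.Perm UnitClosedDisc => ((e z : UnitClosedDisc) : ℂ)) h
      exact this
    · intro h
      ext z : 1
      exact UnitClosedDisc.coe_injective (h z)
  rw [this]
  exact isClosed_iInter fun z =>
    isClosed_eq (continuous_mobius_apply z.norm_le_one) continuous_const

/-- The element of `SU(1,1)` with a given first row. -/
def ofRow (v : {v : ℂ × ℂ | normSq v.1 - normSq v.2 = 1}) : SU11 :=
  ⟨⟨!![v.1.1, v.1.2; conj v.1.2, conj v.1.1], by
    rw [Matrix.det_fin_two_of, Complex.mul_conj, Complex.mul_conj]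
    exact_mod_cast v.2⟩, by constructor <;> simp⟩

lemma continuous_ofRow : Continuous ofRow := by
  refine Continuous.subtype_mk (Continuous.subtype_mk ?_ _) _
  refine continuous_matrix fun i j => ?_
  fin_cases i <;> fin_cases j
  · exact continuous_fst.comp continuous_subtype_val
  · exact continuous_snd.comp continuous_subtype_val
  · exact continuous_conj.comp (continuous_snd.comp continuous_subtype_val)
  · exact continuous_conj.comp (continuous_fst.comp continuous_subtype_val)

lemma isCompact_ofRow (C : ℝ) : IsCompact (ofRow '' {v | ‖v.1.1‖ ≤ C}) := by
  refine IsCompact.image ?_ continuous_ofRow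
  rw [Subtype.isCompact_iff]
  have : Subtype.val '' {v : {v : ℂ × ℂ | normSq v.1 - normSq v.2 = 1} | ‖v.1.1‖ ≤ C} =
      {v : ℂ × ℂ | normSq v.1 - normSq v.2 = 1 ∧ ‖v.1‖ ≤ C} := by
    ext v
    constructor
    · rintro ⟨w, hw, rfl⟩
      exact ⟨w.2, hw⟩
    · rintro ⟨h1, h2⟩
      exact ⟨⟨v, h1⟩, h2, rfl⟩
  rw [this]
  refine Metric.isCompact_of_isClosed_isBounded ?_ ?_
  · refine IsClosed.and (isClosed_eq ?_ continuous_const)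
      (isClosed_le continuous_fst.norm continuous_const)
    exact (continuous_normSq.comp continuous_fst).sub (continuous_normSq.comp continuous_snd)
  · refine (Metric.isBounded_closedBall (x := (0 : ℂ × ℂ)) (r := C)).subset ?_
    rintro v ⟨h1, h2⟩
    rw [mem_closedBall_zero_iff, Prod.norm_def]
    refine max_le h2 (le_trans ?_ h2)
    rw [normSq_eq_norm_sq, normSq_eq_norm_sq] at h1
    exact abs_le_of_sq_le_sq' (by linarith) (norm_nonneg _) |>.2

/-- The formula for 1 - ‖Mz‖² bounds the denominator from above when z and Mz stay away from the
circle, while the denominator is at least (1 - ρ) times the first entry. -/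
lemma norm_entry_le {M : SU11} {ρ : ℝ} (hρ : ρ < 1) {z : ℂ} (h1 : ‖z‖ ≤ ρ)
    (h2 : ‖mobius M z‖ ≤ ρ) : ‖M.1 0 0‖ ≤ 1 / ((1 - ρ) ^ 2) := by
  have hz : ‖z‖ ≤ 1 := by linarith
  have hρ0 : 0 ≤ ρ := (norm_nonneg z).trans h1
  have h := normSq_mobius M hz
  have hd := det_eq M
  have hpos : 0 < normSq (den M z) := normSq_pos.2 (den_ne_zero M hz)
  rw [eq_div_iff hpos.ne'] at h
  rw [normSq_eq_norm_sq] at h hpos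
  rw [normSq_eq_norm_sq, normSq_eq_norm_sq] at hd
  have e1 : ‖M.1 1 0‖ = ‖M.1 0 1‖ := by rw [M.2.1, Complex.norm_conj]
  have e2 : ‖M.1 1 1‖ = ‖M.1 0 0‖ := by rw [M.2.2, Complex.norm_conj]
  have hb : ‖M.1 0 1‖ ≤ ‖M.1 0 0‖ :=
    abs_le_of_sq_le_sq' (by linarith) (norm_nonneg _) |>.2
  have hlow : ‖M.1 0 0‖ * (1 - ρ) ≤ ‖den M z‖ := by
    have t := norm_sub_norm_le (M.1 1 1) (-(M.1 1 0 * z))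
    rw [norm_neg, norm_mul, sub_neg_eq_add, e1, e2, add_comm] at t
    change _ ≤ ‖den M z‖ at t
    have := mul_le_mul hb h1 (norm_nonneg _) (norm_nonneg _)
    linarith
  set A := ‖M.1 0 0‖
  have hA : 0 ≤ A := norm_nonneg _
  have k1 : (1 - ρ) ≤ 1 - ‖mobius M z‖ ^ 2 := by nlinarith [norm_nonneg (mobius M z)]
  have k2 : (A * (1 - ρ)) ^ 2 ≤ ‖den M z‖ ^ 2 :=
    pow_le_pow_left₀ (mul_nonneg hA (by linarith)) hlow 2
  have k3 : (1 - ρ) * (A * (1 - ρ)) ^ 2 ≤ 1 := by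
    calc (1 - ρ) * (A * (1 - ρ)) ^ 2 ≤ (1 - ‖mobius M z‖ ^ 2) * ‖den M z‖ ^ 2 :=
          mul_le_mul k1 k2 (by positivity) (by linarith)
      _ ≤ 1 := by rw [h]; nlinarith [norm_nonneg z]
  have hA1 : 1 ≤ A ^ 2 := by nlinarith [norm_nonneg (M.1 0 1)]
  have hp : 0 < 1 - ρ := by linarith
  rw [le_div_iff₀ (by positivity)]
  have hA1' : 1 ≤ A := by nlinarith
  by_contra! hcon
  have q1 : (1 - ρ) ≤ 1 := by linarith
  have q2 : (A * (1 - ρ) ^ 2) ^ 2 ≤ (1 - ρ) * (A * (1 - ρ)) ^ 2 := by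
    have : (A * (1 - ρ) ^ 2) ^ 2 = (1 - ρ) * ((1 - ρ) * (A * (1 - ρ)) ^ 2) := by ring
    rw [this]
    have : 0 ≤ (1 - ρ) * (A * (1 - ρ)) ^ 2 := by positivity
    nlinarith
  nlinarith

/-- Proper discontinuity: `norm_entry_le` places these elements in the image of a compact set of
matrices, which the closed discrete group meets in a finite set. -/
lemma finite_setOf_act_mem {Γ : Subgroup DiscAut} (hΓ : IsFuchsian Γ) {ρ : ℝ} (hρ : ρ < 1) :
    {γ : DiscAut | γ ∈ Γ ∧ ∃ z : ℂ, ‖z‖ ≤ ρ ∧ ‖act γ z‖ ≤ ρ}.Finite := by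
  have : DiscreteTopology Γ := hΓ
  have hcl : IsClosed (Γ : Set DiscAut) := Subgroup.isClosed_of_discrete
  set K : Set DiscAut := (fun M : SU11 => (QuotientGroup.mk M : DiscAut)) ''
    (ofRow '' {v | ‖v.1.1‖ ≤ 1 / ((1 - ρ) ^ 2)})
  have hK : IsCompact K := (isCompact_ofRow _).image QuotientGroup.continuous_mk
  have hfin : (K ∩ (Γ : Set DiscAut)).Finite := by
    refine (hK.inter_right hcl).finite ?_
    exact IsDiscrete.mono (isDiscrete_iff_discreteTopology.mpr ‹_›) inter_subset_right
  refine hfin.subset ?_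
  rintro γ ⟨h1, z, hz, hz'⟩
  refine ⟨⟨rep γ, ⟨⟨((rep γ).1 0 0, (rep γ).1 0 1), det_eq _⟩, norm_entry_le hρ hz hz', ?_⟩,
    mk_rep γ⟩, h1⟩
  apply Subtype.ext
  apply Subtype.ext
  ext i j
  have e1 := (rep γ).2.1
  have e2 := (rep γ).2.2
  fin_cases i <;> fin_cases j
  · rfl
  · rfl
  · exact e1.symm
  · exact e2.symm

/-! ### Displacement -/

/-- A measure of how far an automorphism moves a point; it is conjugation invariant. -/
def disp (g : DiscAut) (z : ℂ) : ℝ :=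
  ‖act g z - z‖ ^ 2 / ((1 - ‖z‖ ^ 2) * (1 - ‖act g z‖ ^ 2))

lemma one_sub_sq_pos {z : ℂ} (hz : ‖z‖ < 1) : 0 < 1 - ‖z‖ ^ 2 := by nlinarith [norm_nonneg z]

/-- The quantity `disp` is sinh² of half the hyperbolic distance between a point and its image; the
scale factors of the isometry cancel. -/
lemma disp_conj (f g : DiscAut) {z : ℂ} (hz : ‖z‖ < 1) :
    disp (g * f * g⁻¹) (act g z) = disp f z := by
  have hfz := norm_act_lt f hz
  have e : act (g * f * g⁻¹) (act g z) = act g (act f z) := by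
    rw [act_mul _ _ (norm_act_le g hz.le), act_inv_act g hz.le, act_mul _ _ hz.le]
  rw [disp, e, norm_act_sub g hfz.le hz.le, one_sub_norm_act g hz.le, one_sub_norm_act g hfz.le,
    disp]
  have p1 := scale_pos g hz.le
  have p2 := scale_pos g hfz.le
  have p3 := one_sub_sq_pos hz
  have p4 := one_sub_sq_pos hfz
  field_simp

lemma disp_pos {g : DiscAut} {z : ℂ} (hz : ‖z‖ < 1) (h : act g z ≠ z) : 0 < disp g z := by
  have p1 := one_sub_sq_pos hz
  have p2 := one_sub_sq_pos (norm_act_lt g hz)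
  have p3 : 0 < ‖act g z - z‖ := norm_pos_iff.2 (sub_ne_zero.2 h)
  unfold disp
  positivity

lemma continuousOn_disp (g : DiscAut) : ContinuousOn (disp g) (Metric.ball 0 1) := by
  have h := (continuousOn_act g).mono Metric.ball_subset_closedBall
  unfold disp
  refine ContinuousOn.div ((h.sub continuousOn_id).norm.pow 2) (ContinuousOn.mul ?_ ?_) ?_
  · fun_prop
  · exact continuousOn_const.sub (h.norm.pow 2)
  · intro z hz
    rw [mem_ball_zero_iff] at hz
    exact (mul_pos (one_sub_sq_pos hz) (one_sub_sq_pos (norm_act_lt g hz))).ne'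

lemma exists_pos_forall_le {α : Type*} {s : Set α} (hs : s.Finite) (e : α → ℝ)
    (he : ∀ a ∈ s, 0 < e a) : ∃ ε > 0, ∀ a ∈ s, ε ≤ e a := by
  induction s, hs using Set.Finite.induction_on with
  | empty => exact ⟨1, one_pos, by simp⟩
  | @insert a s _ _ ih =>
    obtain ⟨ε, h1, h2⟩ := ih fun a ha => he a (mem_insert_of_mem _ ha)
    refine ⟨min ε (e a), lt_min h1 (he a (mem_insert _ _)), ?_⟩
    rintro b (rfl | hb)
    · exact min_le_right _ _
    · exact (min_le_left _ _).trans (h2 b hb)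

lemma exists_le_disp_of_compact {g : DiscAut} (hg : ∀ z : ℂ, ‖z‖ < 1 → act g z ≠ z) {ρ : ℝ}
    (hρ : ρ < 1) : ∃ ε > 0, ∀ z : ℂ, ‖z‖ ≤ ρ → ε ≤ disp g z := by
  rcases lt_or_ge ρ 0 with h0 | h0
  · exact ⟨1, one_pos, fun z hz => absurd (norm_nonneg z) (by linarith)⟩
  have hsub : Metric.closedBall (0 : ℂ) ρ ⊆ Metric.ball 0 1 := Metric.closedBall_subset_ball hρ
  obtain ⟨z0, hz0, hmin⟩ := (isCompact_closedBall (0 : ℂ) ρ).exists_isMinOn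
    ⟨0, by simpa using h0⟩ ((continuousOn_disp g).mono hsub)
  have hz0' : ‖z0‖ < 1 := by simpa using hsub hz0
  exact ⟨disp g z0, disp_pos hz0' (hg _ hz0'), fun z hz => hmin (by simpa using hz)⟩

/-- Only finitely many elements keep some point of the ρ-ball within radius (1 + ρ)/2, and each
fixed-point free one among them attains a positive minimum on the ball. All other elements move
points by at least (1 - ρ)/2 in the Euclidean metric. -/
lemma exists_le_disp {Γ : Subgroup DiscAut} (hΓ : IsFuchsian Γ) {ρ : ℝ} (hρ : ρ < 1) :
    ∃ ε > 0, ∀ h ∈ Γ, (∀ z : ℂ, ‖z‖ < 1 → act h z ≠ z) → ∀ z : ℂ, ‖z‖ ≤ ρ → ε ≤ disp h z := by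
  have hρ' : (1 + ρ) / 2 < 1 := by linarith
  have hfin := finite_setOf_act_mem hΓ hρ'
  have H : ∀ h : DiscAut, ∃ ε > 0, (∀ z : ℂ, ‖z‖ < 1 → act h z ≠ z) →
      ∀ z : ℂ, ‖z‖ ≤ ρ → ε ≤ disp h z := by
    intro h
    by_cases hg : ∀ z : ℂ, ‖z‖ < 1 → act h z ≠ z
    · obtain ⟨ε, h1, h2⟩ := exists_le_disp_of_compact hg hρ
      exact ⟨ε, h1, fun _ => h2⟩
    · exact ⟨1, one_pos, fun h' => absurd h' hg⟩
  choose e he0 he using H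
  obtain ⟨ε, h1, h2⟩ := exists_pos_forall_le hfin e fun a _ => he0 a
  refine ⟨min ε (((1 - ρ) / 2) ^ 2), lt_min h1 (by have : 0 < 1 - ρ := by linarith
                                                   positivity), ?_⟩
  intro h hh hfix z hz
  by_cases hmem : ‖act h z‖ ≤ (1 + ρ) / 2
  · exact (min_le_left _ _).trans ((h2 h ⟨hh, z, by linarith, hmem⟩).trans (he h hfix z hz))
  · refine (min_le_right _ _).trans ?_
    push Not at hmem
    have hz1 : ‖z‖ < 1 := by linarith
    have p1 := one_sub_sq_pos hz1
    have p2 := one_sub_sq_pos (norm_act_lt h hz1)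
    have q1 : (1 - ρ) / 2 ≤ ‖act h z - z‖ := by
      have := norm_sub_norm_le (act h z) z
      linarith
    have q2 : ((1 - ρ) / 2) ^ 2 ≤ ‖act h z - z‖ ^ 2 :=
      pow_le_pow_left₀ (by linarith) q1 2
    rw [disp, le_div_iff₀ (mul_pos p1 p2)]
    have q3 : (1 - ‖z‖ ^ 2) * (1 - ‖act h z‖ ^ 2) ≤ 1 := by
      nlinarith [sq_nonneg ‖z‖, sq_nonneg ‖act h z‖]
    nlinarith [sq_nonneg ((1 - ρ) / 2)]

/-- Derivative one at the fixed point makes `x` a double root of the fixed-point equation. -/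
lemma act_sub_self_of_parabolic {f : DiscAut} {x : ℂ} (hx : ‖x‖ = 1) (hfix : act f x = x)
    (hs : scale f x = 1) {z : ℂ} (hz : ‖z‖ ≤ 1) :
    act f z - z = -((rep f).1 1 0) * (z - x) ^ 2 / den (rep f) z := by
  set M := rep f
  have hd := den_ne_zero M hz
  have hx0 : x ≠ 0 := by rintro rfl; simp at hx
  have hdx : den M x ≠ 0 := den_ne_zero M hx.le
  have k := den_sq_mul_act f hx
  rw [hfix, hs] at k
  have k2 : den M x ^ 2 = 1 := mul_right_cancel₀ hx0 (by simpa using k)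
  have hnum : M.1 0 0 * x + M.1 0 1 = x * den M x := by
    have : mobius M x = x := hfix
    rw [mobius, div_eq_iff hdx] at this
    exact this
  have hdet := M.1.det_coe
  rw [Matrix.det_fin_two] at hdet
  set a := M.1 0 0
  set b := M.1 0 1
  set c := M.1 1 0
  set d := M.1 1 1
  have hdx' : den M x = c * x + d := rfl
  -- trace condition
  have htr : a - d = 2 * c * x := by
    have h1 : den M x * (a + d) = den M x * (2 * den M x) := by
      have : den M x * (a - c * x) = 1 := by
        apply mul_left_cancel₀ hx0
        rw [hdx'] at hnum ⊢
        linear_combination x * hdet + c * x * hnum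
      rw [hdx'] at this k2 ⊢
      linear_combination this - k2
    have h2 := mul_left_cancel₀ hdx h1
    rw [hdx'] at h2
    linear_combination h2
  rw [act, mobius, eq_div_iff hd, sub_mul, div_mul_cancel₀ _ hd]
  change a * z + b - z * (c * z + d) = _
  rw [hdx'] at hnum
  linear_combination hnum + (z - x) * htr

/-- The level sets of ‖z - x‖²/(1 - ‖z‖²) are the horocycles at `x`, so the displacement is small
exactly deep inside horoballs. -/
lemma exists_disp_eq_of_parabolic {f : DiscAut} {x : ℂ} (hx : ‖x‖ = 1) (hfix : act f x = x)
    (hs : scale f x = 1) (hf : f ≠ 1) :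
    ∃ B > 0, ∀ z : ℂ, ‖z‖ < 1 → disp f z = B * (‖z - x‖ ^ 2 / (1 - ‖z‖ ^ 2)) ^ 2 := by
  refine ⟨‖(rep f).1 1 0‖ ^ 2, ?_, ?_⟩
  · have : (rep f).1 1 0 ≠ 0 := by
      intro h
      apply hf
      apply eq_one_of_act
      intro z hz
      have := act_sub_self_of_parabolic hx hfix hs hz
      rw [h] at this
      simpa [sub_eq_zero] using this
    have := norm_pos_iff.2 this
    positivity
  · intro z hz
    have p1 := one_sub_sq_pos hz
    have p2 := scale_pos f hz.le
    rw [disp, act_sub_self_of_parabolic hx hfix hs hz.le, one_sub_norm_act f hz.le, norm_div,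
      norm_mul, norm_neg, norm_pow]
    change (_ / scale f z) ^ 2 / _ = _
    field_simp

lemma act_ne_self_of_parabolic {f : DiscAut} {x : ℂ} (hx : ‖x‖ = 1) (hfix : act f x = x)
    (hs : scale f x = 1) (hf : f ≠ 1) {z : ℂ} (hz : ‖z‖ < 1) : act f z ≠ z := by
  intro h
  obtain ⟨B, hB, H⟩ := exists_disp_eq_of_parabolic hx hfix hs hf
  have h1 := H z hz
  have h2 : disp f z = 0 := by rw [disp, h]; simp
  have h3 : 0 < ‖z - x‖ := norm_pos_iff.2 (sub_ne_zero.2 (by rintro rfl; linarith))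
  have h4 := one_sub_sq_pos hz
  have : 0 < B * (‖z - x‖ ^ 2 / (1 - ‖z‖ ^ 2)) ^ 2 := by positivity
  linarith

/-! ### Markings of the circle -/

/-- `θ` lists the arguments of `k ≥ 2` points of the circle in counter-clockwise order. -/
structure IsMarking (k : ℕ) (θ : ℤ → ℝ) : Prop where
  strictMono : StrictMono θ
  add : ∀ j, θ (j + k) = θ j + 2 * π
  two_le : 2 ≤ k

/-- The `j`-th point of a marking. -/
def pt (θ : ℤ → ℝ) (j : ℤ) : Circle := Circle.exp (θ j)

/-- The `j`-th arc of a marking. -/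
def markedArc (θ : ℤ → ℝ) (j : ℤ) : Set Circle := circleArc (θ j) (θ (j + 1))

lemma pt_mem_left (θ : ℤ → ℝ) (hθ : StrictMono θ) (j : ℤ) : pt θ j ∈ markedArc θ j :=
  ⟨_, ⟨le_rfl, (hθ (lt_add_one j)).le⟩, rfl⟩

lemma pt_mem_right (θ : ℤ → ℝ) (hθ : StrictMono θ) (j : ℤ) : pt θ (j + 1) ∈ markedArc θ j :=
  ⟨_, ⟨(hθ (lt_add_one j)).le, le_rfl⟩, rfl⟩

namespace IsMarking

variable {k : ℕ} {θ : ℤ → ℝ} (m : IsMarking k θ)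
include m

lemma add_mul (j n : ℤ) : θ (j + k * n) = θ j + n * (2 * π) := by
  induction n using Int.induction_on with
  | zero => simp
  | succ n ih =>
    have : j + (k : ℤ) * (n + 1) = (j + k * n) + k := by ring
    rw [this, m.add, ih]; push_cast; ring
  | pred n ih =>
    have h := m.add (j + k * (-(n : ℤ) - 1))
    have : j + (k : ℤ) * (-(n : ℤ) - 1) + k = j + k * (-(n : ℤ)) := by ring
    rw [this, ih] at h
    push_cast at h ⊢
    linarith

lemma lt_succ (j : ℤ) : θ j < θ (j + 1) := m.strictMono (lt_add_one j)

lemma lt_two_pi {i j : ℤ} (h : i < j + k) : θ i < θ j + 2 * π := by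
  rw [← m.add]; exact m.strictMono h

lemma succ_lt_two_pi (j : ℤ) : θ (j + 1) < θ j + 2 * π :=
  m.lt_two_pi (by have := m.two_le; omega)

lemma pt_eq_iff {i j : ℤ} : pt θ i = pt θ j ↔ (k : ℤ) ∣ i - j := by
  rw [pt, pt, Circle.exp_eq_exp]
  constructor
  · rintro ⟨n, hn⟩
    rw [← m.add_mul] at hn
    exact ⟨n, by have := m.strictMono.injective hn; omega⟩
  · rintro ⟨n, hn⟩
    exact ⟨n, by rw [← m.add_mul]; congr 1; omega⟩

lemma pt_congr {i j : ℤ} (h : pt θ i = pt θ j) {i' j' : ℤ} (h' : i' - j' = i - j) :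
    pt θ i' = pt θ j' := by
  rw [m.pt_eq_iff] at h ⊢
  rwa [h']

lemma pt_congr_neg {i j : ℤ} (h : pt θ i = pt θ j) {i' j' : ℤ} (h' : i' - j' = -(i - j)) :
    pt θ i' = pt θ j' := by
  rw [m.pt_eq_iff] at h ⊢
  rw [h']
  exact (dvd_neg.2 h)

lemma pt_succ_ne (j : ℤ) : pt θ j ≠ pt θ (j + 1) := exp_ne_of_lt (m.lt_succ j) (m.succ_lt_two_pi j)

lemma pt_add_two_ne (hk : 3 ≤ k) (j : ℤ) : pt θ j ≠ pt θ (j + 2) :=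
  exp_ne_of_lt (m.strictMono (by omega)) (m.lt_two_pi (by omega))

lemma eq_of_pt_mem {i l : ℤ} (h : pt θ i ∈ markedArc θ l) : pt θ i = pt θ l ∨ pt θ i = pt θ (l + 1) := by
  obtain ⟨t, ⟨h1, h2⟩, h3⟩ := h
  obtain ⟨n, hn⟩ := Circle.exp_eq_exp.1 h3
  rw [← m.add_mul] at hn
  have h4 : pt θ i = pt θ (i + k * n) := m.pt_eq_iff.2 ⟨-n, by ring⟩
  rw [hn] at h1 h2
  have h5 := m.strictMono.le_iff_le.1 h1
  have h6 := m.strictMono.le_iff_le.1 h2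
  rw [h4]
  rcases (by omega : i + k * n = l ∨ i + k * n = l + 1) with h | h <;> rw [h] <;> simp

lemma exists_mem_Ico (t : ℝ) : ∃ j, θ j ≤ t ∧ t < θ (j + 1) := by
  have hpi := Real.two_pi_pos
  have key : ∀ s : ℝ, ∃ n : ℤ, s < n * (2 * π) := fun s => by
    obtain ⟨n, hn⟩ := exists_int_gt (s / (2 * π))
    exact ⟨n, (div_lt_iff₀ hpi).1 hn⟩
  obtain ⟨n, hn⟩ := key (t - θ 0)
  obtain ⟨n', hn'⟩ := key (θ 0 - t)
  have hup := m.add_mul 0 n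
  have hlo := m.add_mul 0 (-n')
  push_cast at hlo
  obtain ⟨j, hj, hmax⟩ := Int.exists_greatest_of_bdd (P := fun j => θ j ≤ t)
    ⟨0 + k * n, fun z hz => (m.strictMono.lt_iff_lt.1 (by linarith : θ z < θ (0 + k * n))).le⟩
    ⟨0 + k * (-n'), by linarith⟩
  refine ⟨j, hj, ?_⟩
  by_contra! h
  have := hmax _ h
  omega

lemma eq_of_mem_Ico {t : ℝ} {i j : ℤ} (h1 : θ i ≤ t) (h2 : t < θ (i + 1)) (h3 : θ j ≤ t)
    (h4 : t < θ (j + 1)) : i = j := by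
  have a := m.strictMono.lt_iff_lt.1 (h1.trans_lt h4)
  have b := m.strictMono.lt_iff_lt.1 (h3.trans_lt h2)
  omega

lemma mem_markedArc {j : ℤ} {p : Circle} : p ∈ markedArc θ j ↔ side (θ j) (θ (j + 1)) p ≤ 0 :=
  mem_circleArc (m.lt_succ j) (m.succ_lt_two_pi j)

lemma exists_mapsArc (g : DiscAut) (j : ℤ) : ∃ a b, MapsArc g (θ j) (θ (j + 1)) a b :=
  FuchsianMarkov.exists_mapsArc g (m.lt_succ j) (m.succ_lt_two_pi j)

end IsMarking

/-! ### Combinatorics of the map on the break-points -/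

namespace PiecewiseMobiusMap

variable (A : PiecewiseMobiusMap)

lemma numPieces_pos : 0 < A.numPieces := by
  rcases Nat.eq_zero_or_pos A.numPieces with h | h
  · have := A.angle_add 0
    rw [h] at this
    simp at this
  · exact h

lemma not_injective_of_covering {A : PiecewiseMobiusMap} {d : ℕ} (hd : 2 ≤ d)
    (h : A.IsCoveringOfDegree d) : ¬ Function.Injective A.toFun := by
  intro hinj
  have h1 := h.2 1
  have : (A.toFun ⁻¹' {1}).ncard ≤ 1 := by
    have hf : (A.toFun ⁻¹' {1}).Finite := Set.finite_of_ncard_ne_zero (by rw [h1]; omega)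
    rw [Set.ncard_le_one hf]
    exact fun a ha b hb => hinj (ha.trans hb.symm)
  omega

lemma two_le_numPieces {A : PiecewiseMobiusMap} (h : ¬ Function.Injective A.toFun) :
    2 ≤ A.numPieces := by
  by_contra! hlt
  have h1 : A.numPieces = 1 := by have := A.numPieces_pos; omega
  apply h
  have : ∀ z, A.toFun z = A.piece 0 • z := by
    intro z
    obtain ⟨t, h2, h3, rfl⟩ := exists_exp_eq (A.angle 0) z
    refine A.toFun_eq 0 _ ⟨t, ⟨h2, ?_⟩, rfl⟩
    have h4 := A.angle_add 0
    rw [h1] at h4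
    push_cast at h4
    rw [zero_add]
    linarith
  intro z w hzw
  rw [this, this] at hzw
  exact smul_circle_injective _ hzw

variable {A}

lemma toFun_eq_left (m : IsMarking A.numPieces A.angle) (j : ℤ) :
    A.toFun (pt A.angle j) = A.piece j • pt A.angle j :=
  A.toFun_eq j _ (pt_mem_left _ m.strictMono j)

lemma toFun_eq_right (m : IsMarking A.numPieces A.angle) (j : ℤ) :
    A.toFun (pt A.angle (j + 1)) = A.piece j • pt A.angle (j + 1) :=
  A.toFun_eq j _ (pt_mem_right _ m.strictMono j)

lemma piece_ne (hmin : A.IsMinimal) (j : ℤ) :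
    A.piece j ≠ A.piece (j + 1) := by
  intro h
  refine hmin ⟨j + 1, A.piece (j + 1), Subgroup.subset_closure ⟨_, rfl⟩, A.toFun_eq (j + 1), ?_⟩
  intro z hz
  rw [← h]
  have e : j + 1 - 1 = j := by ring
  rw [arc, e] at hz
  exact A.toFun_eq j z hz

/-- On the image arc A equals the single element h⁻¹. A break-point in its interior would make both
adjacent pieces equal to h⁻¹, since an element is determined on any arc, and this contradicts
minimality. -/
lemma exists_arc_of_inverse_branch (m : IsMarking A.numPieces A.angle) (hmin : A.IsMinimal)
    {h : DiscAut} {a b : ℝ} (hab : a < b) (hb : b < a + 2 * π)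
    (H : ∀ z ∈ circleArc a b, A.toFun (h • z) = z) :
    ∃ i, ∀ z ∈ circleArc a b, h • z ∈ markedArc A.angle i := by
  obtain ⟨a', b', hm⟩ := exists_mapsArc h hab hb
  have H' : ∀ z ∈ circleArc a' b', A.toFun z = h⁻¹ • z := by
    intro z hz
    have h1 := hm.inv.smul_mem_circleArc_iff.2 hz
    have h2 := H _ h1
    rwa [smul_inv_smul] at h2
  obtain ⟨i, h1, h2⟩ := m.exists_mem_Ico a'
  have hsub : b' ≤ A.angle (i + 1) := by
    by_contra! hlt
    apply piece_ne hmin i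
    have e1 : A.piece i = h⁻¹ := by
      refine eq_of_eqOn_circleArc h2 fun z hz => ?_
      obtain ⟨t, ⟨t1, t2⟩, rfl⟩ := hz
      rw [← A.toFun_eq i _ ⟨t, ⟨h1.trans t1, t2⟩, rfl⟩, H' _ ⟨t, ⟨t1, t2.trans hlt.le⟩, rfl⟩]
    have e2 : A.piece (i + 1) = h⁻¹ := by
      -- The image arc may reach beyond the next break-point, so the comparison stops at whichever
      -- end comes first.
      refine eq_of_eqOn_circleArc (a := A.angle (i + 1)) (b := min b' (A.angle (i + 1 + 1)))
        (lt_min hlt (m.lt_succ _)) fun z hz => ?_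
      obtain ⟨t, ⟨t1, t2⟩, rfl⟩ := hz
      rw [← A.toFun_eq (i + 1) _ ⟨t, ⟨t1, t2.trans (min_le_right _ _)⟩, rfl⟩,
        H' _ ⟨t, ⟨h2.le.trans t1, t2.trans (min_le_left _ _)⟩, rfl⟩]
    rw [e1, e2]
  refine ⟨i, fun z hz => ?_⟩
  obtain ⟨t, ⟨t1, t2⟩, ht⟩ := hm.smul_mem_circleArc_iff.2 hz
  exact ⟨t, ⟨h1.trans t1, t2.trans hsub⟩, ht⟩

/-- The arc in a backward-orbit step has arbitrary real parameters and may wrap around the circle;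
this shortens it to less than a full turn while keeping both points. -/
lemma exists_Icc_of_mem_circleArc {a b : ℝ} {p q : Circle} (hp : p ∈ circleArc a b)
    (hq : q ∈ circleArc a b) (hpq : p ≠ q) :
    ∃ s t, s < t ∧ t < s + 2 * π ∧ circleArc s t ⊆ circleArc a b ∧ p ∈ circleArc s t ∧
      q ∈ circleArc s t := by
  have aux : ∀ s t : ℝ, a ≤ s → s < t → t ≤ b → Circle.exp s ≠ Circle.exp t →
      ∃ s' t', s' < t' ∧ t' < s' + 2 * π ∧ circleArc s' t' ⊆ circleArc a b ∧
        Circle.exp s ∈ circleArc s' t' ∧ Circle.exp t ∈ circleArc s' t' := by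
    intro s t h1 h2 h3 h4
    obtain ⟨t', k1, k2, k3⟩ := exists_exp_eq s (Circle.exp t)
    have k4 : s < t' := lt_of_le_of_ne k1 (by rintro rfl; exact h4 k3)
    have k5 : t' ≤ t := by
      obtain ⟨n, hn⟩ := Circle.exp_eq_exp.1 k3
      have hpi := Real.pi_pos
      by_contra! hlt
      have : (0 : ℝ) < n := by
        by_contra! h
        have : (n : ℝ) * (2 * π) ≤ 0 := mul_nonpos_of_nonpos_of_nonneg h (by positivity)
        linarith
      have h0 : (1 : ℝ) ≤ n := by exact_mod_cast (by exact_mod_cast this : (0 : ℤ) < n)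
      nlinarith
    refine ⟨s, t', k4, k2, ?_, ⟨s, ⟨le_rfl, k4.le⟩, rfl⟩, ⟨t', ⟨k4.le, le_rfl⟩, k3⟩⟩
    rintro _ ⟨u, ⟨u1, u2⟩, rfl⟩
    exact ⟨u, ⟨h1.trans u1, (u2.trans k5).trans h3⟩, rfl⟩
  obtain ⟨s, ⟨s1, s2⟩, rfl⟩ := hp
  obtain ⟨t, ⟨t1, t2⟩, rfl⟩ := hq
  rcases lt_trichotomy s t with h | h | h
  · exact aux s t s1 h t2 hpq
  · exact absurd (by rw [h]) hpq
  · obtain ⟨s', t', a1, a2, a3, a4, a5⟩ := aux t s t1 h s2 hpq.symm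
    exact ⟨s', t', a1, a2, a3, a5, a4⟩

/-- By induction, each inverse branch lands in one arc. Distinctness of the two endpoints is carried
along because shortening the arc requires it. -/
lemma exists_arc_of_inBackwardOrbit (m : IsMarking A.numPieces A.angle) (hmin : A.IsMinimal)
    {Γ : Subgroup DiscAut} {j : ℤ} {e : Sym2 Circle} (he : A.InBackwardOrbit Γ (A.edge j) e) :
    ¬ e.IsDiag ∧ ∃ i, ∀ p ∈ e, p ∈ markedArc A.angle i := by
  induction he with
  | self =>
    refine ⟨?_, j, ?_⟩
    · rw [edge, Sym2.mk_isDiag_iff]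
      exact m.pt_succ_ne j
    · intro p hp
      rcases Sym2.mem_iff.1 hp with rfl | rfl
      · exact pt_mem_left _ m.strictMono j
      · exact pt_mem_right _ m.strictMono j
  | preimage p q h a b _ _ hA hp hq ih =>
    have hpq : p ≠ q := by simpa using ih.1
    refine ⟨by simpa using hpq, ?_⟩
    obtain ⟨s, t, h1, h2, h3, h4, h5⟩ := exists_Icc_of_mem_circleArc hp hq hpq
    obtain ⟨i, hi⟩ := exists_arc_of_inverse_branch m hmin h1 h2 fun z hz => hA z (h3 hz)
    refine ⟨i, fun r hr => ?_⟩
    rcases Sym2.mem_iff.1 hr with rfl | rfl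
    · exact hi _ h4
    · exact hi _ h5

lemma exists_iterate_of_inBackwardOrbit {Γ : Subgroup DiscAut} {e e' : Sym2 Circle}
    (he : A.InBackwardOrbit Γ e e') : ∃ r, (Sym2.map A.toFun)^[r] e' = e := by
  induction he with
  | self => exact ⟨0, rfl⟩
  | preimage p q h a b _ _ hA hp hq ih =>
    obtain ⟨r, hr⟩ := ih
    refine ⟨r + 1, ?_⟩
    rw [Function.iterate_succ_apply, Sym2.map_mk]
    simp only [hA p hp, hA q hq, hr]

/-- If the left end of the image of arc `j` were not the left end of a partition arc in that image,
points just before it would also belong to the image. -/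
lemma exists_toFun_pt_eq (m : IsMarking A.numPieces A.angle) (hM : A.IsMarkov) (j : ℤ) :
    ∃ l, A.toFun (pt A.angle j) = pt A.angle l := by
  obtain ⟨J, hJ⟩ := hM j
  obtain ⟨a, b, hm⟩ := m.exists_mapsArc (A.piece j) j
  have hJ' : ∀ z, z ∈ circleArc a b ↔ ∃ l ∈ J, z ∈ markedArc A.angle l := by
    intro z
    have : z ∈ A.toFun '' A.arc j ↔ z ∈ ⋃ l ∈ J, A.arc l := by rw [hJ]
    rw [mem_iUnion₂] at this
    simp only [exists_prop] at this
    change _ ↔ ∃ l ∈ J, z ∈ A.arc l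
    rw [← this]
    constructor
    · intro hz
      have h1 := hm.inv.smul_mem_circleArc_iff.2 hz
      exact ⟨_, h1, by rw [A.toFun_eq j _ h1, smul_inv_smul]⟩
    · rintro ⟨w, hw, rfl⟩
      rw [A.toFun_eq j _ hw]
      exact hm.smul_mem_circleArc_iff.2 hw
  rw [toFun_eq_left m]
  have hleft : A.piece j • pt A.angle j = Circle.exp a := hm.left
  rw [hleft]
  obtain ⟨l, hl, t, ⟨t1, t2⟩, ht⟩ := (hJ' (Circle.exp a)).1 ⟨a, ⟨le_rfl, hm.lt'.le⟩, rfl⟩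
  refine ⟨l, ?_⟩
  rcases t1.eq_or_lt with h | h
  · rw [← ht, ← h]; rfl
  exfalso
  have hlt := hm.lt'
  have hlt2 := hm.lt_two_pi'
  -- Small enough to stay in arc `l`, and, when counted back from `a + 2π`, to stay beyond `b`.
  set ε := min (t - A.angle l) ((a + 2 * π - b) / 2) with hε
  have ε0 : 0 < ε := lt_min (by linarith) (by linarith)
  have ε1 : ε ≤ t - A.angle l := min_le_left _ _
  have ε2 : ε ≤ (a + 2 * π - b) / 2 := min_le_right _ _
  have hmem : Circle.exp (t - ε) ∈ circleArc a b :=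
    (hJ' _).2 ⟨l, hl, t - ε, ⟨by linarith, by linarith⟩, rfl⟩
  have e1 : Circle.exp (t - ε) = Circle.exp (a + 2 * π - ε) := by
    rw [Circle.exp_sub, Circle.exp_sub, ht, Circle.exp_add_two_pi]
  rw [e1, mem_circleArc hlt hlt2, side_exp_nonpos_iff hlt hlt2 (by linarith) (by linarith)] at hmem
  linarith

/-! ### Consequences of backward edge-orbit equivalence -/

section orbitEquivalence

variable {Γ : Subgroup DiscAut}

lemma map_edge (m : IsMarking A.numPieces A.angle) (j : ℤ) :
    (A.edge j).map A.toFun = (A.edge j).map (fun z => A.piece j • z) := by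
  rw [edge, Sym2.map_mk, Sym2.map_mk]
  exact congrArg₂ (fun x y => s(x, y)) (toFun_eq_left m j) (toFun_eq_right m j)

lemma map_edge_eq (j : ℤ) : (A.edge j).map A.toFun =
    s(A.toFun (pt A.angle j), A.toFun (pt A.angle (j + 1))) := rfl

lemma inBackwardOrbit_smul (hedge : A.IsBackwardEdgeOrbitEquivalent Γ) {γ : DiscAut}
    (hγ : γ ∈ Γ) (j : ℤ) :
    A.InBackwardOrbit Γ (A.edge j) ((A.edge j).map (fun z => γ • z)) := by
  have : (A.edge j).map (fun z => γ • z) ∈ A.backwardOrbit Γ (A.edge j) := by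
    rw [hedge j]; exact ⟨γ, hγ, rfl⟩
  exact this

lemma exists_arc_smul_edge (m : IsMarking A.numPieces A.angle) (hmin : A.IsMinimal)
    (hedge : A.IsBackwardEdgeOrbitEquivalent Γ) {γ : DiscAut} (hγ : γ ∈ Γ) (j : ℤ) :
    ∃ i, γ • pt A.angle j ∈ markedArc A.angle i ∧ γ • pt A.angle (j + 1) ∈ markedArc A.angle i := by
  obtain ⟨-, i, hi⟩ := exists_arc_of_inBackwardOrbit m hmin (inBackwardOrbit_smul hedge hγ j)
  exact ⟨i, hi _ (by rw [edge, Sym2.map_mk]; exact Sym2.mem_mk_left _ _),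
    hi _ (by rw [edge, Sym2.map_mk]; exact Sym2.mem_mk_right _ _)⟩

/-- The image of edge `j` under A lies in its Γ-orbit, hence in its backward orbit, so iterating A
leads back to the edge. -/
lemma edge_periodic (m : IsMarking A.numPieces A.angle)
    (hedge : A.IsBackwardEdgeOrbitEquivalent Γ) (hpiece : ∀ j, A.piece j ∈ Γ) (j : ℤ) :
    ∃ r > 0, Function.IsPeriodicPt (Sym2.map A.toFun) r (A.edge j) := by
  have h := inBackwardOrbit_smul hedge (hpiece j) j
  rw [← map_edge m] at h
  obtain ⟨r, hr⟩ := exists_iterate_of_inBackwardOrbit h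
  exact ⟨r + 1, by omega, by rw [Function.IsPeriodicPt, Function.IsFixedPt,
    Function.iterate_succ_apply, hr]⟩

lemma edge_eq_of_map_eq (m : IsMarking A.numPieces A.angle)
    (hedge : A.IsBackwardEdgeOrbitEquivalent Γ) (hpiece : ∀ j, A.piece j ∈ Γ) {i j : ℤ}
    (h : (A.edge i).map A.toFun = (A.edge j).map A.toFun) : A.edge i = A.edge j := by
  obtain ⟨r, hr, h1⟩ := edge_periodic m hedge hpiece i
  obtain ⟨s, hs, h2⟩ := edge_periodic m hedge hpiece j
  exact h1.eq_of_apply_eq h2 hr hs h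

lemma edge_ne_succ (m : IsMarking A.numPieces A.angle) (hk : 3 ≤ A.numPieces) (i : ℤ) :
    A.edge i ≠ A.edge (i + 1) := by
  intro h
  rw [edge, edge, Sym2.eq_iff] at h
  rcases h with h | h
  · exact m.pt_succ_ne i h.1
  · apply m.pt_add_two_ne hk i
    have := h.1
    rw [add_assoc] at this
    exact this

/-- The image of edge `i` has two distinct break-points as ends, and both lie in a single arc; they
must be the two ends of that arc. -/
lemma toFun_pt_succ (m : IsMarking A.numPieces A.angle) (hmin : A.IsMinimal) (hM : A.IsMarkov)
    (hedge : A.IsBackwardEdgeOrbitEquivalent Γ) (hpiece : ∀ j, A.piece j ∈ Γ) {i n : ℤ}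
    (h : A.toFun (pt A.angle i) = pt A.angle n) :
    A.toFun (pt A.angle (i + 1)) = pt A.angle (n + 1) ∨
      A.toFun (pt A.angle (i + 1)) = pt A.angle (n - 1) := by
  obtain ⟨n', hn'⟩ := exists_toFun_pt_eq m hM (i + 1)
  obtain ⟨l, h1, h2⟩ := exists_arc_smul_edge m hmin hedge (hpiece i) i
  have hne : pt A.angle n ≠ pt A.angle n' := by
    rw [← h, ← hn', toFun_eq_left m, toFun_eq_right m]
    exact fun h => m.pt_succ_ne i (smul_circle_injective _ h)
  rw [← toFun_eq_left m, h] at h1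
  rw [← toFun_eq_right m, hn'] at h2
  rw [hn']
  rcases m.eq_of_pt_mem h1 with e1 | e1 <;> rcases m.eq_of_pt_mem h2 with e2 | e2
  · exact absurd (e1.trans e2.symm) hne
  · left; rw [e2]; exact m.pt_congr e1.symm (by ring)
  · right; rw [e2]; exact m.pt_congr e1.symm (by ring)
  · exact absurd (e1.trans e2.symm) hne

/-- Each arc `i` is mapped bijectively onto arc `d + i`, so the arcs are merely permuted. The
half-open range of the parameter `s` recovers the arc from the image point. -/
lemma injective_of_rotation (m : IsMarking A.numPieces A.angle) {d : ℤ}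
    (h : ∀ i, A.toFun (pt A.angle i) = pt A.angle (d + i)) : Function.Injective A.toFun := by
  have key : ∀ z, ∃ i s, z ∈ markedArc A.angle i ∧ A.toFun z = Circle.exp s ∧
      A.angle (d + i) ≤ s ∧ s < A.angle (d + i + 1) := by
    intro z
    obtain ⟨t, rfl⟩ := Circle.exp_surjective z
    obtain ⟨i, h1, h2⟩ := m.exists_mem_Ico t
    have hmem : Circle.exp t ∈ markedArc A.angle i := ⟨t, ⟨h1, h2.le⟩, rfl⟩
    have hm : MapsArc (A.piece i) (A.angle i) (A.angle (i + 1)) (A.angle (d + i))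
        (A.angle (d + i + 1)) := by
      refine ⟨m.lt_succ _, m.succ_lt_two_pi _, m.lt_succ _, m.succ_lt_two_pi _, ?_, ?_⟩
      · exact (toFun_eq_left m i).symm.trans (h i)
      · exact (toFun_eq_right m i).symm.trans ((h (i + 1)).trans (by rw [pt, add_assoc]))
    obtain ⟨s, ⟨s1, s2⟩, hs⟩ := hm.smul_mem_circleArc_iff.2 hmem
    refine ⟨i, s, hmem, by rw [A.toFun_eq i _ hmem, hs], s1, lt_of_le_of_ne s2 ?_⟩
    rintro rfl
    have := smul_circle_injective _ (hs.symm.trans hm.right.symm)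
    have h3 := m.succ_lt_two_pi i
    exact exp_ne_of_lt h2 (by linarith) this
  intro z w hzw
  obtain ⟨i, s, h1, h2, h3, h4⟩ := key z
  obtain ⟨j, t, k1, k2, k3, k4⟩ := key w
  rw [h2, k2] at hzw
  obtain ⟨n, hn⟩ := Circle.exp_eq_exp.1 hzw
  have e1 := m.add_mul (d + j) n
  have e2 := m.add_mul (d + j + 1) n
  have e3 : d + j + 1 + A.numPieces * n = d + j + A.numPieces * n + 1 := by ring
  rw [e3] at e2
  have hij := m.eq_of_mem_Ico h3 h4 (by linarith : A.angle (d + j + A.numPieces * n) ≤ s)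
    (by linarith)
  have hi : i = j + A.numPieces * n := by omega
  have hw : w ∈ markedArc A.angle i := by
    obtain ⟨u, ⟨u1, u2⟩, rfl⟩ := k1
    have e4 := m.add_mul j n
    have e5 := m.add_mul (j + 1) n
    have e6 : j + 1 + A.numPieces * n = j + A.numPieces * n + 1 := by ring
    rw [e6] at e5
    refine ⟨u + n * (2 * π), ⟨by rw [hi]; linarith, by rw [hi]; linarith⟩, ?_⟩
    rw [Circle.exp_eq_exp]
    exact ⟨n, rfl⟩
  apply smul_circle_injective (A.piece i)
  change A.piece i • z = A.piece i • w
  rw [← A.toFun_eq i z h1, ← A.toFun_eq i w hw, h2, k2, hzw]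

lemma toFun_pt_of_nat (m : IsMarking A.numPieces A.angle) {c ε : ℤ}
    (h : ∀ n : ℕ, A.toFun (pt A.angle n) = pt A.angle (c + ε * n)) (i : ℤ) :
    A.toFun (pt A.angle i) = pt A.angle (c + ε * i) := by
  have h2 := m.two_le
  -- Adding |i| full periods makes the index non-negative without moving the break-point.
  obtain ⟨n, hn⟩ := Int.eq_ofNat_of_zero_le (a := i + A.numPieces * |i|)
    (by nlinarith [neg_abs_le i, abs_nonneg i])
  have e1 : pt A.angle i = pt A.angle n := m.pt_eq_iff.2 ⟨-|i|, by rw [← hn]; ring⟩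
  have e2 : pt A.angle (c + ε * n) = pt A.angle (c + ε * i) :=
    m.pt_eq_iff.2 ⟨ε * |i|, by rw [← hn]; ring⟩
  rw [e1, h n, e2]

/-- The map acts on the break-points as a reflection. -/
lemma exists_reflection (hmin : A.IsMinimal) (hM : A.IsMarkov)
    (hinj : ¬ Function.Injective A.toFun)
    (hedge : A.IsBackwardEdgeOrbitEquivalent Γ) (hpiece : ∀ j, A.piece j ∈ Γ) :
    IsMarking A.numPieces A.angle ∧ 3 ≤ A.numPieces ∧
      ∃ c, ∀ i, A.toFun (pt A.angle i) = pt A.angle (c - i) := by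
  have m : IsMarking A.numPieces A.angle :=
    ⟨A.angle_strictMono, A.angle_add, two_le_numPieces hinj⟩
  refine ⟨m, ?_⟩
  have step : ∀ {i n : ℤ}, A.toFun (pt A.angle i) = pt A.angle n →
      A.toFun (pt A.angle (i + 1)) = pt A.angle (n + 1) ∨
      A.toFun (pt A.angle (i + 1)) = pt A.angle (n - 1) :=
    fun h => toFun_pt_succ m hmin hM hedge hpiece h
  obtain ⟨c, hc⟩ := exists_toFun_pt_eq m hM 0
  have h2 := m.two_le
  have norot : ¬ ∀ n : ℕ, A.toFun (pt A.angle n) = pt A.angle (c + 1 * n) := fun h =>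
    hinj (injective_of_rotation m (d := c) fun i => by
      have := toFun_pt_of_nat m h i
      rwa [one_mul] at this)
  -- With only two arcs the steps +1 and -1 reach the same break-point, so the map could be read as
  -- a rotation.
  have hk : 3 ≤ A.numPieces := by
    by_contra! hlt
    have hk2 : A.numPieces = 2 := by omega
    apply norot
    intro n
    induction n with
    | zero => simpa using hc
    | succ n ih =>
      have e : pt A.angle (c + 1 * n - 1) = pt A.angle (c + 1 * (n + 1 : ℕ)) :=
        m.pt_eq_iff.2 ⟨-1, by rw [hk2]; push_cast; ring⟩
      rcases step ih with h | h
      · push_cast; rw [h]; congr 1; ring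
      · rw [← e]; push_cast; rw [h]
  refine ⟨hk, ?_⟩
  have straight : ∀ ε : ℤ, (ε = 1 ∨ ε = -1) → A.toFun (pt A.angle 1) = pt A.angle (c + ε) →
      ∀ n : ℕ, A.toFun (pt A.angle n) = pt A.angle (c + ε * n) := by
    intro ε hε h1
    have : ∀ n : ℕ, A.toFun (pt A.angle n) = pt A.angle (c + ε * n) ∧
        A.toFun (pt A.angle (n + 1)) = pt A.angle (c + ε * n + ε) := by
      intro n
      induction n with
      | zero => exact ⟨by simpa using hc, by simpa using h1⟩
      | succ n ih =>
        have e1 : c + ε * n + ε = c + ε * (n + 1 : ℕ) := by push_cast; ring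
        refine ⟨by rw [← e1]; exact_mod_cast ih.2, ?_⟩
        -- A turn back would give two consecutive edges the same image, although distinct edges have
        -- distinct images.
        have bad : A.toFun (pt A.angle ((n : ℤ) + 1 + 1)) ≠ pt A.angle (c + ε * n) := by
          intro hbad
          apply edge_ne_succ m hk n
          apply edge_eq_of_map_eq m hedge hpiece
          rw [map_edge_eq, map_edge_eq, ih.1, ih.2, hbad, Sym2.eq_swap]
        push_cast
        rcases hε with rfl | rfl <;> rcases step ih.2 with h | h
        · rw [h]; congr 1; ring
        · exact absurd (h.trans (by congr 1; ring)) bad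
        · exact absurd (h.trans (by congr 1; ring)) bad
        · rw [h]; congr 1; ring
    exact fun n => (this n).1
  have h01 := step hc
  rw [zero_add] at h01
  rcases h01 with h | h
  · exact absurd (straight 1 (Or.inl rfl) h) norot
  · refine ⟨c, fun i => ?_⟩
    have := toFun_pt_of_nat m (straight (-1) (Or.inr rfl) h) i
    rw [this]; congr 1; ring

end orbitEquivalence

end PiecewiseMobiusMap

/-! ### The Klein model -/

/-- The map from the Poincaré model to the Klein model. -/
def klein (z : ℂ) : ℂ := ((2 / (1 + ‖z‖ ^ 2) : ℝ) : ℂ) * z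

/-- The map from the Klein model to the Poincaré model. -/
def kleinInv (w : ℂ) : ℂ := ((1 / (1 + √(1 - ‖w‖ ^ 2)) : ℝ) : ℂ) * w

/-- The affine function that defines a half-plane in the Klein model. -/
def kside (a b : ℝ) (w : ℂ) : ℝ :=
  Real.cos ((b - a) / 2) - (w * (Circle.exp (-((a + b) / 2)) : ℂ)).re

lemma side_eq_kside (a b : ℝ) (z : ℂ) : side a b z = (1 + ‖z‖ ^ 2) * kside a b (klein z) := by
  have h : (0 : ℝ) < 1 + ‖z‖ ^ 2 := by positivity
  rw [side, kside, klein, mul_assoc, Complex.re_ofReal_mul]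
  field_simp

lemma side_pos_iff_kside {a b : ℝ} {z : ℂ} : 0 < side a b z ↔ 0 < kside a b (klein z) := by
  have h : (0 : ℝ) < 1 + ‖z‖ ^ 2 := by positivity
  rw [side_eq_kside, mul_pos_iff_of_pos_left h]

lemma side_nonneg_iff_kside {a b : ℝ} {z : ℂ} : 0 ≤ side a b z ↔ 0 ≤ kside a b (klein z) := by
  have h : (0 : ℝ) < 1 + ‖z‖ ^ 2 := by positivity
  rw [side_eq_kside, mul_nonneg_iff_of_pos_left h]

lemma side_eq_zero_iff_kside {a b : ℝ} {z : ℂ} : side a b z = 0 ↔ kside a b (klein z) = 0 := by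
  have h : (1 : ℝ) + ‖z‖ ^ 2 ≠ 0 := by positivity
  rw [side_eq_kside, mul_eq_zero, or_iff_right h]

lemma kside_combo (a b : ℝ) (u v : ℂ) {s t : ℝ} (h : s + t = 1) :
    kside a b (s * u + t * v) = s * kside a b u + t * kside a b v := by
  have hs : s = 1 - t := by linarith
  rw [kside, add_mul, add_re, mul_assoc, mul_assoc, Complex.re_ofReal_mul, Complex.re_ofReal_mul,
    kside, kside, hs]
  ring

lemma continuous_kside (a b : ℝ) : Continuous (kside a b) := by unfold kside; fun_prop

lemma klein_of_norm_eq_one {z : ℂ} (hz : ‖z‖ = 1) : klein z = z := by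
  rw [klein, hz]; norm_num

lemma side_eq_two_mul_kside (a b : ℝ) {z : ℂ} (hz : ‖z‖ = 1) : side a b z = 2 * kside a b z := by
  rw [side_eq_kside, klein_of_norm_eq_one hz, hz]; norm_num

lemma continuous_klein : Continuous klein := by
  unfold klein
  refine Continuous.mul (continuous_ofReal.comp ?_) continuous_id
  exact continuous_const.div (by fun_prop) fun z => by positivity

lemma continuous_kleinInv : Continuous kleinInv := by
  unfold kleinInv
  refine Continuous.mul (continuous_ofReal.comp ?_) continuous_id
  exact continuous_const.div (by fun_prop) fun z => by positivity

lemma one_sub_norm_klein (z : ℂ) :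
    1 - ‖klein z‖ ^ 2 = ((1 - ‖z‖ ^ 2) / (1 + ‖z‖ ^ 2)) ^ 2 := by
  have h : (0 : ℝ) < 1 + ‖z‖ ^ 2 := by positivity
  rw [klein, norm_mul, Complex.norm_real, Real.norm_of_nonneg (by positivity)]
  field_simp
  ring

lemma norm_klein_lt {z : ℂ} (hz : ‖z‖ < 1) : ‖klein z‖ < 1 := by
  have h := one_sub_norm_klein z
  have h1 : 0 < 1 - ‖z‖ ^ 2 := by nlinarith [norm_nonneg z]
  have : 0 < ((1 - ‖z‖ ^ 2) / (1 + ‖z‖ ^ 2)) ^ 2 := by positivity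
  nlinarith [norm_nonneg (klein z)]

lemma norm_kleinInv_sq {w : ℂ} (hw : ‖w‖ ≤ 1) :
    ‖kleinInv w‖ ^ 2 = (1 - √(1 - ‖w‖ ^ 2)) / (1 + √(1 - ‖w‖ ^ 2)) := by
  have h0 : 0 ≤ 1 - ‖w‖ ^ 2 := by nlinarith [norm_nonneg w]
  have hs := Real.sqrt_nonneg (1 - ‖w‖ ^ 2)
  have hsq := Real.sq_sqrt h0
  set s := √(1 - ‖w‖ ^ 2) with hs'
  have hw' : ‖w‖ ^ 2 = 1 - s ^ 2 := by linarith
  rw [kleinInv, norm_mul, Complex.norm_real, ← hs', Real.norm_of_nonneg (by positivity), mul_pow,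
    hw']
  have : 1 + s ≠ 0 := by positivity
  field_simp
  ring

lemma norm_kleinInv_lt {w : ℂ} (hw : ‖w‖ < 1) : ‖kleinInv w‖ < 1 := by
  have h := norm_kleinInv_sq hw.le
  have h0 : 0 < 1 - ‖w‖ ^ 2 := by nlinarith [norm_nonneg w]
  have hs := Real.sqrt_pos.2 h0
  have : (1 - √(1 - ‖w‖ ^ 2)) / (1 + √(1 - ‖w‖ ^ 2)) < 1 := by
    rw [div_lt_one (by positivity)]; linarith
  nlinarith [norm_nonneg (kleinInv w)]

lemma klein_kleinInv {w : ℂ} (hw : ‖w‖ ≤ 1) : klein (kleinInv w) = w := by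
  have hs := Real.sqrt_nonneg (1 - ‖w‖ ^ 2)
  have h : (2 / (1 + ‖kleinInv w‖ ^ 2)) * (1 / (1 + √(1 - ‖w‖ ^ 2))) = 1 := by
    rw [norm_kleinInv_sq hw]
    have : 1 + √(1 - ‖w‖ ^ 2) ≠ 0 := by positivity
    field_simp
    ring
  rw [klein, ← one_mul w]
  nth_rewrite 2 [kleinInv]
  rw [one_mul, ← mul_assoc, ← ofReal_mul, h]
  simp

lemma kleinInv_klein {z : ℂ} (hz : ‖z‖ < 1) : kleinInv (klein z) = z := by
  have h1 : 0 < 1 - ‖z‖ ^ 2 := by nlinarith [norm_nonneg z]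
  have h2 : (0 : ℝ) < 1 + ‖z‖ ^ 2 := by positivity
  rw [kleinInv, one_sub_norm_klein, Real.sqrt_sq (by positivity), klein, ← mul_assoc, ← ofReal_mul]
  have : 1 / (1 + (1 - ‖z‖ ^ 2) / (1 + ‖z‖ ^ 2)) * (2 / (1 + ‖z‖ ^ 2)) = 1 := by
    field_simp
    ring
  rw [this]
  simp

/-- The point of the disc with given Klein coordinate. -/
def ofKlein (w : ℂ) (hw : ‖w‖ < 1) : UnitDisc := UnitDisc.mk (kleinInv w) (norm_kleinInv_lt hw)

lemma klein_ofKlein {w : ℂ} (hw : ‖w‖ < 1) : klein (ofKlein w hw) = w := klein_kleinInv hw.le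

lemma norm_combo_lt {u v : ℂ} (hu : ‖u‖ ≤ 1) (hv : ‖v‖ < 1) {s t : ℝ} (hs : 0 ≤ s) (ht : 0 < t)
    (h : s + t = 1) : ‖(s * u + t * v : ℂ)‖ < 1 := by
  calc ‖(s * u + t * v : ℂ)‖ ≤ ‖(s : ℂ) * u‖ + ‖(t : ℂ) * v‖ := norm_add_le _ _
    _ = s * ‖u‖ + t * ‖v‖ := by
      rw [norm_mul, norm_mul, Complex.norm_real, Complex.norm_real, Real.norm_of_nonneg hs,
        Real.norm_of_nonneg ht.le]
    _ < 1 := by nlinarith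

lemma norm_combo_unit_lt {u v : ℂ} (hu : ‖u‖ = 1) (hv : ‖v‖ = 1) (huv : u ≠ v) {s t : ℝ}
    (hs : 0 < s) (ht : 0 < t) (h : s + t = 1) : ‖(s * u + t * v : ℂ)‖ < 1 := by
  have := (strictConvex_closedBall ℝ (0 : ℂ) 1) (x := u) (by simp [hu]) (y := v) (by simp [hv]) huv
    hs ht h
  rw [interior_closedBall _ one_ne_zero, mem_ball_zero_iff] at this
  simpa using this

/-- Points of a geodesic lie, in the Klein model, on the chord between its endpoints. -/
lemma exists_combo_of_kside_eq_zero {a b : ℝ} (hab : a < b) (hb : b < a + 2 * π) {w : ℂ}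
    (hw : ‖w‖ ≤ 1) (h : kside a b w = 0) :
    ∃ s t : ℝ, 0 ≤ s ∧ 0 ≤ t ∧ s + t = 1 ∧ w = s * Circle.exp a + t * Circle.exp b := by
  -- This rotation makes the chord vertical, with abscissa `c` and half-length `σ`; the position on
  -- it is then given by `v.im`.
  set v := w * (Circle.exp (-((a + b) / 2)) : ℂ) with hv
  set c := Real.cos ((b - a) / 2) with hc
  set σ := Real.sin ((b - a) / 2) with hσ
  have σ0 : 0 < σ := Real.sin_pos_of_pos_of_lt_pi (by linarith) (by linarith)
  have hcs : c ^ 2 + σ ^ 2 = 1 := Real.cos_sq_add_sin_sq _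
  have hre : v.re = c := by rw [kside] at h; linarith
  have hnorm : ‖v‖ ≤ 1 := by rw [hv, norm_mul, Circle.norm_coe, mul_one]; exact hw
  have hn2 : v.re ^ 2 + v.im ^ 2 ≤ 1 := by
    have : ‖v‖ ^ 2 = v.re ^ 2 + v.im ^ 2 := by rw [Complex.sq_norm, normSq_apply]; ring
    nlinarith [norm_nonneg v]
  have him : v.im ^ 2 ≤ σ ^ 2 := by rw [hre] at hn2; linarith
  obtain ⟨h1, h2⟩ := abs_le_of_sq_le_sq' him σ0.le
  have hw2 : w = v * (Circle.exp ((a + b) / 2) : ℂ) := by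
    rw [hv, mul_assoc, ← Circle.coe_mul, ← Circle.exp_add]; simp
  have ea : (Circle.exp a : ℂ) = (c - σ * I) * (Circle.exp ((a + b) / 2) : ℂ) := by
    have : (c - σ * I : ℂ) = (Circle.exp (-((b - a) / 2)) : ℂ) := by
      rw [Circle.coe_exp, Complex.exp_mul_I, ← ofReal_cos, ← ofReal_sin, Real.cos_neg, Real.sin_neg,
        ofReal_neg]
      ring
    rw [this, ← Circle.coe_mul, ← Circle.exp_add]
    congr 2; ring
  have eb : (Circle.exp b : ℂ) = (c + σ * I) * (Circle.exp ((a + b) / 2) : ℂ) := by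
    have : (c + σ * I : ℂ) = (Circle.exp ((b - a) / 2) : ℂ) := by
      rw [Circle.coe_exp, Complex.exp_mul_I, ← ofReal_cos, ← ofReal_sin]
    rw [this, ← Circle.coe_mul, ← Circle.exp_add]
    congr 2; ring
  refine ⟨(σ - v.im) / (2 * σ), (σ + v.im) / (2 * σ), div_nonneg (by linarith) (by linarith),
    div_nonneg (by linarith) (by linarith), by field_simp; ring, ?_⟩
  rw [hw2, ea, eb, ← mul_assoc, ← mul_assoc, ← add_mul]
  congr 1
  have hσc : (σ : ℂ) ≠ 0 := by exact_mod_cast σ0.ne'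
  have hv' : v = c + v.im * I := by
    conv_lhs => rw [← Complex.re_add_im v, hre]
  generalize v.im = y at hv' ⊢
  rw [hv']
  push_cast
  field_simp
  ring

/-! ### Ideal polygons -/

/-- The ideal polygon spanned by a marking. -/
def polygon (θ : ℤ → ℝ) : Set UnitDisc := (⋃ j : ℤ, halfPlane (θ j) (θ (j + 1)))ᶜ

/-- The function that vanishes on the `j`-th edge and is positive in the polygon. -/
def edgeSide (θ : ℤ → ℝ) (j : ℤ) (z : ℂ) : ℝ := side (θ j) (θ (j + 1)) z

/-- The affine function that vanishes on the `j`-th edge in the Klein model. -/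
def edgeKside (θ : ℤ → ℝ) (j : ℤ) (z : ℂ) : ℝ := kside (θ j) (θ (j + 1)) z

lemma mem_polygon {θ : ℤ → ℝ} {z : UnitDisc} : z ∈ polygon θ ↔ ∀ j, 0 < edgeSide θ j z := by
  simp [polygon, mem_halfPlane, edgeSide]

namespace IsMarking

variable {k : ℕ} {θ : ℤ → ℝ} (m : IsMarking k θ)
include m

lemma edgeSide_periodic (z : ℂ) : Function.Periodic (fun j => edgeSide θ j z) (k : ℤ) := by
  intro j
  have e : j + (k : ℤ) + 1 = (j + 1) + k := by ring
  change side _ _ z = side _ _ z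
  rw [e, m.add, m.add, side_eq_of_add]

lemma edgeSide_congr {i j : ℤ} (h : pt θ i = pt θ j) : edgeSide θ i = edgeSide θ j := by
  obtain ⟨n, hn⟩ := m.pt_eq_iff.1 h
  funext z
  have h1 := (m.edgeSide_periodic z).int_mul n j
  change edgeSide θ _ z = edgeSide θ _ z at h1
  rw [← h1]
  congr 1
  rw [Int.cast_id, mul_comm]
  omega

lemma edgeKside_congr {i j : ℤ} (h : pt θ i = pt θ j) {w : ℂ} (hw : ‖w‖ ≤ 1) :
    edgeKside θ i w = edgeKside θ j w := by
  have h1 := congrFun (m.edgeSide_congr h) (kleinInv w)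
  rw [edgeSide, edgeSide, side_eq_kside, side_eq_kside, klein_kleinInv hw] at h1
  exact mul_left_cancel₀ (by positivity) h1

lemma forall_iff {P : ℤ → Prop} (hP : ∀ i j, pt θ i = pt θ j → P i → P j) :
    (∀ j, P j) ↔ ∀ j : Fin k, P j := by
  constructor
  · exact fun h j => h j
  · intro h j
    have hk : (0 : ℤ) < k := by have := m.two_le; omega
    have h1 := Int.emod_nonneg j hk.ne'
    have h2 := Int.emod_lt_of_pos j hk
    have h3 := h ⟨(j % k).toNat, by omega⟩
    refine hP _ _ (m.pt_eq_iff.2 ?_) h3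
    simp only [Int.toNat_of_nonneg h1]
    exact ⟨-(j / k), by have := Int.emod_add_mul_ediv j k; linarith⟩

lemma edgeSide_pt (i j : ℤ) : 0 ≤ edgeSide θ j (pt θ i) ∧
    (edgeSide θ j (pt θ i) = 0 → pt θ i = pt θ j ∨ pt θ i = pt θ (j + 1)) := by
  have hk : (0 : ℤ) < k := by have := m.two_le; omega
  have h1 := Int.emod_nonneg (i - j) hk.ne'
  have h2 := Int.emod_lt_of_pos (i - j) hk
  have h3 := Int.emod_add_mul_ediv (i - j) k
  have e : pt θ i = pt θ (j + (i - j) % k) := m.pt_eq_iff.2 ⟨(i - j) / k, by linarith⟩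
  rw [e]
  generalize (i - j) % k = r at h1 h2
  rcases (by omega : r = 0 ∨ r = 1 ∨ 2 ≤ r) with h | h | h
  · subst h
    rw [add_zero, edgeSide, pt, side_left]
    exact ⟨le_rfl, fun _ => Or.inl rfl⟩
  · subst h
    rw [edgeSide, pt, side_right]
    exact ⟨le_rfl, fun _ => Or.inr rfl⟩
  · have l1 : θ j ≤ θ (j + r) := m.strictMono.monotone (by omega)
    have l2 : θ (j + r) < θ j + 2 * π := m.lt_two_pi (by omega)
    have l3 : θ (j + 1) < θ (j + r) := m.strictMono (by omega)
    have : 0 < edgeSide θ j (pt θ (j + r)) := by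
      rw [edgeSide, pt, ← not_le, side_exp_nonpos_iff (m.lt_succ j) (m.succ_lt_two_pi j) l1 l2]
      linarith
    exact ⟨this.le, fun h => absurd h this.ne'⟩

lemma edgeKside_pt (i j : ℤ) : 0 ≤ edgeKside θ j (pt θ i) ∧
    (edgeKside θ j (pt θ i) = 0 → pt θ i = pt θ j ∨ pt θ i = pt θ (j + 1)) := by
  obtain ⟨h1, h2⟩ := m.edgeSide_pt i j
  rw [edgeSide, side_eq_two_mul_kside _ _ (pt θ i).norm_coe] at h1 h2
  rw [edgeKside]
  exact ⟨by linarith, fun h => h2 (by rw [h, mul_zero])⟩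

/-- A point of the circle other than the vertices lies in the open arc cut off by some edge, so the
closed polygon meets the circle only in its vertices. -/
lemma exists_eq_pt {p : Circle} (h : ∀ j, 0 ≤ edgeSide θ j p) : ∃ i, p = pt θ i := by
  obtain ⟨t, rfl⟩ := Circle.exp_surjective p
  obtain ⟨i, h1, h2⟩ := m.exists_mem_Ico t
  have h3 := m.succ_lt_two_pi i
  have h4 : edgeSide θ i (Circle.exp t) ≤ 0 :=
    (side_exp_nonpos_iff (m.lt_succ i) h3 h1 (by linarith)).2 h2.le
  have h5 := le_antisymm h4 (h i)
  rcases (side_exp_eq_zero_iff (m.lt_succ i) h3 h1 (by linarith)).1 h5 with h | h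
  · exact ⟨i, by rw [h]; rfl⟩
  · linarith

/-- The polygon has a point, in the Klein model. -/
lemma exists_klein_center (hk : 3 ≤ k) : ∃ o : ℂ, ‖o‖ < 1 ∧ ∀ j, 0 < edgeKside θ j o := by
  have n01 : pt θ 0 ≠ pt θ 1 := m.pt_succ_ne 0
  have n12 : pt θ 1 ≠ pt θ 2 := m.pt_succ_ne 1
  have n02 : pt θ 0 ≠ pt θ 2 := m.pt_add_two_ne hk 0
  set u : ℂ := ((1 / 2 : ℝ) : ℂ) * pt θ 0 + ((1 / 2 : ℝ) : ℂ) * pt θ 1 with hu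
  have hu1 : ‖u‖ < 1 := norm_combo_unit_lt (pt θ 0).norm_coe (pt θ 1).norm_coe
    (fun h => n01 (Circle.ext h)) (by norm_num) (by norm_num) (by norm_num)
  refine ⟨((1 / 2 : ℝ) : ℂ) * pt θ 2 + ((1 / 2 : ℝ) : ℂ) * u,
    norm_combo_lt (pt θ 2).norm_coe.le hu1 (by norm_num) (by norm_num) (by norm_num), fun j => ?_⟩
  rw [edgeKside, kside_combo _ _ _ _ (by norm_num), hu, kside_combo _ _ _ _ (by norm_num)]
  obtain ⟨a0, b0⟩ := m.edgeKside_pt 0 j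
  obtain ⟨a1, b1⟩ := m.edgeKside_pt 1 j
  obtain ⟨a2, b2⟩ := m.edgeKside_pt 2 j
  rw [edgeKside] at a0 b0 a1 b1 a2 b2
  -- Each edge function is non-negative at all vertices and vanishes only at the two ends of its
  -- edge, so it cannot vanish at three distinct vertices.
  by_contra! hle
  have c0 := b0 (by linarith)
  have c1 := b1 (by linarith)
  have c2 := b2 (by linarith)
  rcases c0 with c0 | c0 <;> rcases c1 with c1 | c1 <;> rcases c2 with c2 | c2 <;>
    first
      | exact n01 (c0.trans c1.symm)
      | exact n12 (c1.trans c2.symm)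
      | exact n02 (c0.trans c2.symm)

lemma isOpen_polygon : IsOpen (polygon θ) := by
  have : polygon θ = ⋂ j : Fin k, {z : UnitDisc | 0 < edgeSide θ j z} := by
    ext z
    rw [mem_polygon, mem_iInter]
    exact m.forall_iff fun i j h => by rw [m.edgeSide_congr h]; exact id
  rw [this]
  exact isOpen_iInter_of_finite fun j => isOpen_lt continuous_const
    ((continuous_side _ _).comp UnitDisc.continuous_coe)

omit m in
lemma ofKlein_mem_polygon {w : ℂ} (hw : ‖w‖ < 1) :
    ofKlein w hw ∈ polygon θ ↔ ∀ j, 0 < edgeKside θ j w := by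
  rw [mem_polygon]
  refine forall_congr' fun j => ?_
  rw [edgeSide, side_pos_iff_kside, klein_ofKlein, edgeKside]

lemma polygon_nonempty (hk : 3 ≤ k) : (polygon θ).Nonempty := by
  obtain ⟨o, h1, h2⟩ := m.exists_klein_center hk
  exact ⟨ofKlein o h1, (ofKlein_mem_polygon h1).2 h2⟩

omit m in
lemma convex_klein_polygon :
    Convex ℝ {w : ℂ | ‖w‖ < 1 ∧ ∀ j, 0 < edgeKside θ j w} := by
  intro u hu v hv s t hs ht hst
  rw [real_smul, real_smul]
  refine ⟨?_, fun j => ?_⟩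
  · rcases ht.eq_or_lt with h | h
    · rw [← h] at hst ⊢
      have : s = 1 := by linarith
      simpa [this] using hu.1
    · exact norm_combo_lt hu.1.le hv.1 hs h hst
  · have h1 := hu.2 j
    have h2 := hv.2 j
    rw [edgeKside] at h1 h2 ⊢
    rw [kside_combo _ _ _ _ hst]
    rcases ht.eq_or_lt with h | h
    · rw [← h] at hst ⊢
      have : s = 1 := by linarith
      simpa [this] using h1
    · have := mul_nonneg hs h1.le
      have := mul_pos h h2
      linarith

lemma isConnected_polygon (hk : 3 ≤ k) : IsConnected (polygon θ) := by
  refine ⟨m.polygon_nonempty hk, ?_⟩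
  rw [← UnitDisc.isEmbedding_coe.isInducing.isPreconnected_image]
  have : UnitDisc.coe '' polygon θ = kleinInv '' {w : ℂ | ‖w‖ < 1 ∧ ∀ j, 0 < edgeKside θ j w} := by
    ext z
    constructor
    · rintro ⟨z, hz, rfl⟩
      refine ⟨klein z, ⟨norm_klein_lt z.norm_lt_one, fun j => ?_⟩, kleinInv_klein z.norm_lt_one⟩
      exact side_pos_iff_kside.1 (mem_polygon.1 hz j)
    · rintro ⟨w, ⟨h1, h2⟩, rfl⟩
      exact ⟨ofKlein w h1, (ofKlein_mem_polygon h1).2 h2, rfl⟩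
  rw [this]
  exact (convex_klein_polygon.isPreconnected).image _ continuous_kleinInv.continuousOn

lemma mem_closure_polygon (hk : 3 ≤ k) {z : UnitDisc} :
    z ∈ closure (polygon θ) ↔ ∀ j, 0 ≤ edgeSide θ j z := by
  constructor
  · intro hz j
    have hcl : IsClosed {z : UnitDisc | 0 ≤ edgeSide θ j z} :=
      isClosed_le continuous_const ((continuous_side _ _).comp UnitDisc.continuous_coe)
    exact closure_minimal (fun w hw => (mem_polygon.1 hw j).le) hcl hz
  · intro h
    obtain ⟨o, h1, h2⟩ := m.exists_klein_center hk
    rw [UnitDisc.isEmbedding_coe.closure_eq_preimage_closure_image, mem_preimage]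
    -- In the Klein model the segment from a point of the closed polygon to an interior point enters
    -- the polygon at once.
    have hlim : Tendsto (fun t : ℝ => kleinInv (((1 - t : ℝ) : ℂ) * klein z + (t : ℂ) * o))
        (𝓝[>] 0) (𝓝 (z : ℂ)) := by
      have hc : Continuous fun t : ℝ => kleinInv (((1 - t : ℝ) : ℂ) * klein z + (t : ℂ) * o) :=
        continuous_kleinInv.comp (by fun_prop)
      have := hc.tendsto 0
      simp only [sub_zero, ofReal_one, one_mul, ofReal_zero, zero_mul, add_zero] at this
      rw [kleinInv_klein z.norm_lt_one] at this
      exact this.mono_left nhdsWithin_le_nhds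
    refine mem_closure_of_tendsto hlim ?_
    filter_upwards [Ioo_mem_nhdsGT (zero_lt_one' ℝ)] with t ht
    have hn : ‖((1 - t : ℝ) : ℂ) * klein z + (t : ℂ) * o‖ < 1 :=
      norm_combo_lt (norm_klein_lt z.norm_lt_one).le h1 (by linarith [ht.2]) ht.1 (by ring)
    refine ⟨ofKlein _ hn, (ofKlein_mem_polygon hn).2 fun j => ?_, rfl⟩
    rw [edgeKside, kside_combo _ _ _ _ (by ring)]
    have a := side_nonneg_iff_kside.1 (h j)
    have b := h2 j
    rw [edgeKside] at b
    have := mul_nonneg (by linarith [ht.2] : 0 ≤ 1 - t) a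
    have := mul_pos ht.1 b
    linarith

/-- An edge is determined by its endpoints. -/
lemma pt_eq_of_edge_eq (hk : 3 ≤ k) {i j : ℤ} (h1 : pt θ i = pt θ j ∨ pt θ i = pt θ (j + 1))
    (h2 : pt θ (i + 1) = pt θ j ∨ pt θ (i + 1) = pt θ (j + 1)) : pt θ i = pt θ j := by
  rcases h1 with h1 | h1
  · exact h1
  · exfalso
    rcases h2 with h2 | h2
    · have := m.pt_congr h1 (i' := i + 1) (j' := j + 2) (by ring)
      exact m.pt_add_two_ne hk j (h2.symm.trans this)
    · exact m.pt_succ_ne i (h1.trans h2.symm)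

/-- On an open edge, the functions of all other edges are positive. -/
lemma edgeKside_pos_of_edge (hk : 3 ≤ k) {i j : ℤ} (hij : pt θ j ≠ pt θ i) {w : ℂ} (hw : ‖w‖ < 1)
    (h : edgeKside θ i w = 0) : 0 < edgeKside θ j w := by
  obtain ⟨s, t, hs, ht, hst, rfl⟩ :=
    exists_combo_of_kside_eq_zero (m.lt_succ i) (m.succ_lt_two_pi i) hw.le h
  have hs' : 0 < s := by
    refine lt_of_le_of_ne hs ?_
    rintro rfl
    have : t = 1 := by linarith
    simp [this] at hw
  have ht' : 0 < t := by
    refine lt_of_le_of_ne ht ?_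
    rintro rfl
    have : s = 1 := by linarith
    simp [this] at hw
  rw [edgeKside, kside_combo _ _ _ _ hst]
  obtain ⟨a0, b0⟩ := m.edgeKside_pt i j
  obtain ⟨a1, b1⟩ := m.edgeKside_pt (i + 1) j
  rw [edgeKside] at a0 b0 a1 b1
  change 0 < s * kside _ _ (pt θ i) + t * kside _ _ (pt θ (i + 1))
  by_contra! hle
  have k0 := mul_nonneg hs a0
  have k1 := mul_nonneg ht a1
  have z0 : kside (θ j) (θ (j + 1)) (pt θ i) = 0 := by
    have : s * kside (θ j) (θ (j + 1)) (pt θ i) = 0 := by linarith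
    exact (mul_eq_zero.1 this).resolve_left hs'.ne'
  have z1 : kside (θ j) (θ (j + 1)) (pt θ (i + 1)) = 0 := by
    have : t * kside (θ j) (θ (j + 1)) (pt θ (i + 1)) = 0 := by linarith
    exact (mul_eq_zero.1 this).resolve_left ht'.ne'
  exact hij (m.pt_eq_of_edge_eq hk (b0 z0) (b1 z1)).symm

lemma edgeSide_pos_of_edge (hk : 3 ≤ k) {i j : ℤ} (hij : pt θ j ≠ pt θ i) {z : ℂ} (hz : ‖z‖ < 1)
    (h : edgeSide θ i z = 0) : 0 < edgeSide θ j z :=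
  side_pos_iff_kside.2 (m.edgeKside_pos_of_edge hk hij (norm_klein_lt hz)
    (side_eq_zero_iff_kside.1 h))

/-- Near a point of an edge, the polygon is the half-plane bounded by that edge. -/
lemma eventually_mem_polygon (hk : 3 ≤ k) {i : ℤ} {u : UnitDisc} (hu : edgeSide θ i u = 0) :
    ∀ᶠ z : UnitDisc in 𝓝 u, ∀ j, pt θ j ≠ pt θ i → 0 < edgeSide θ j z := by
  have : ∀ j : Fin k, ∀ᶠ z : UnitDisc in 𝓝 u, pt θ j ≠ pt θ i → 0 < edgeSide θ j z := by
    intro j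
    by_cases hj : pt θ j = pt θ i
    · exact Eventually.of_forall fun z h => absurd hj h
    · have h1 := m.edgeSide_pos_of_edge hk hj u.norm_lt_one hu
      have h2 : Continuous fun z : UnitDisc => edgeSide θ j z :=
        (continuous_side _ _).comp UnitDisc.continuous_coe
      filter_upwards [h2.continuousAt.eventually (lt_mem_nhds h1)] with z hz _ using hz
  filter_upwards [eventually_all.2 this] with z hz
  refine (m.forall_iff ?_).2 hz
  intro i' j' h h' h''
  rw [← m.edgeSide_congr h]
  exact h' (by rwa [h])

lemma mem_closure_of_edge (hk : 3 ≤ k) {i : ℤ} {u : UnitDisc} (hu : edgeSide θ i u = 0) :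
    u ∈ closure (polygon θ) := by
  rw [m.mem_closure_polygon hk]
  intro j
  by_cases hj : pt θ j = pt θ i
  · rw [m.edgeSide_congr hj, hu]
  · exact (m.edgeSide_pos_of_edge hk hj u.norm_lt_one hu).le

/-- Each edge contains the points that divide, in the Klein model, the chord between its endpoints. -/
lemma exists_mem_edge (i : ℤ) {s t : ℝ} (hs : 0 < s) (ht : 0 < t) (hst : s + t = 1) :
    ∃ u : UnitDisc, klein u = s * pt θ i + t * pt θ (i + 1) ∧ edgeSide θ i u = 0 := by
  have hn : ‖(s * pt θ i + t * pt θ (i + 1) : ℂ)‖ < 1 :=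
    norm_combo_unit_lt (pt θ i).norm_coe (pt θ (i + 1)).norm_coe
      (fun h => m.pt_succ_ne i (Circle.ext h)) hs ht hst
  refine ⟨ofKlein _ hn, klein_ofKlein hn, ?_⟩
  rw [edgeSide, side_eq_zero_iff_kside, klein_ofKlein hn, kside_combo _ _ _ _ hst]
  have e1 : kside (θ i) (θ (i + 1)) (pt θ i) = 0 := by
    have := side_left (θ i) (θ (i + 1))
    rw [side_eq_two_mul_kside _ _ (Circle.norm_coe _)] at this
    have h2 : kside (θ i) (θ (i + 1)) (Circle.exp (θ i)) = 0 := by linarith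
    exact h2
  have e2 : kside (θ i) (θ (i + 1)) (pt θ (i + 1)) = 0 := by
    have := side_right (θ i) (θ (i + 1))
    rw [side_eq_two_mul_kside _ _ (Circle.norm_coe _)] at this
    have h2 : kside (θ i) (θ (i + 1)) (Circle.exp (θ (i + 1))) = 0 := by linarith
    exact h2
  rw [e1, e2]; ring

end IsMarking

/-! ### Folded polygons -/

/-- An ideal polygon with side pairings `g i` in a discrete group `Γ` that act on the vertices by
the reflection `i ↦ c - i`; the `Γ`-orbits of the edges do not cross the edges, and `Γ` identifies
only those edges that are paired. -/
structure IsFoldedPolygon (Γ : Subgroup DiscAut) (k : ℕ) (c : ℤ) (θ : ℤ → ℝ) (g : ℤ → DiscAut) :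
    Prop extends IsMarking k θ where
  three_le : 3 ≤ k
  fuchsian : IsFuchsian Γ
  piece_mem : ∀ j, g j ∈ Γ
  piece_add : ∀ j, g (j + k) = g j
  left : ∀ j, g j • pt θ j = pt θ (c - j)
  right : ∀ j, g j • pt θ (j + 1) = pt θ (c - 1 - j)
  exists_arc : ∀ γ ∈ Γ, ∀ j, ∃ i, γ • pt θ j ∈ markedArc θ i ∧ γ • pt θ (j + 1) ∈ markedArc θ i
  orbit_eq : ∀ γ ∈ Γ, ∀ i j, γ • pt θ j = pt θ i → γ • pt θ (j + 1) = pt θ (i + 1) →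
    pt θ i = pt θ j ∨ pt θ i = pt θ (c - 1 - j)
  piece_ne : ∀ j, g j ≠ g (j + 1)

namespace IsFoldedPolygon

variable {Γ : Subgroup DiscAut} {k : ℕ} {c : ℤ} {θ : ℤ → ℝ} {g : ℤ → DiscAut}

/-! ### Disjointness of the translates -/

section disjointness

variable (m : IsFoldedPolygon Γ k c θ g)
include m

lemma piece_congr {i j : ℤ} (h : pt θ i = pt θ j) : g i = g j := by
  obtain ⟨n, hn⟩ := m.pt_eq_iff.1 h
  have hp : Function.Periodic g (k : ℤ) := m.piece_add
  have h1 := hp.int_mul n j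
  rw [← h1, Int.cast_id, mul_comm]
  congr 1
  omega

/-- If an element of the group maps some point of the polygon into the polygon, then the polygon
lies on the same side of all images of edges. -/
lemma side_image_pos {γ : DiscAut} (hγ : γ ∈ Γ) {z : UnitDisc} (hz : z ∈ polygon θ)
    (hγz : γ • z ∈ polygon θ) {j : ℤ} {a b : ℝ} (hm : MapsArc γ (θ j) (θ (j + 1)) a b)
    {w : UnitDisc} (hw : w ∈ polygon θ) : 0 < side a b w := by
  -- Both ends of the image edge lie in one arc, so its chord stays in the half-plane that edge `i`
  -- removes from the polygon. The function has no zero on the connected polygon, hence constant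
  -- sign.
  have hne : ∀ v ∈ polygon θ, side a b (v : ℂ) ≠ 0 := by
    intro v hv h0
    obtain ⟨s, t, hs, ht, hst, hv'⟩ := exists_combo_of_kside_eq_zero hm.lt' hm.lt_two_pi'
      (norm_klein_lt v.norm_lt_one).le (side_eq_zero_iff_kside.1 h0)
    obtain ⟨i, h1, h2⟩ := m.exists_arc γ hγ j
    rw [m.mem_markedArc, side_eq_two_mul_kside _ _ (Circle.norm_coe _)] at h1 h2
    rw [show γ • pt θ j = Circle.exp a from hm.left] at h1
    rw [show γ • pt θ (j + 1) = Circle.exp b from hm.right] at h2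
    have h3 := side_pos_iff_kside.1 (mem_polygon.1 hv i)
    rw [hv', kside_combo _ _ _ _ hst] at h3
    nlinarith [mul_nonneg hs (by linarith : 0 ≤ -kside (θ i) (θ (i + 1)) (Circle.exp a)),
      mul_nonneg ht (by linarith : 0 ≤ -kside (θ i) (θ (i + 1)) (Circle.exp b))]
  have h1 : 0 < side a b (γ • z : UnitDisc) := by
    rw [coe_smul_disc, hm.side_pos_iff z.norm_lt_one.le]
    exact mem_polygon.1 hz j
  by_contra! hle
  have hcont : ContinuousOn (fun v : UnitDisc => side a b v) (polygon θ) :=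
    ((continuous_side a b).comp UnitDisc.continuous_coe).continuousOn
  obtain ⟨v, hv, hv0⟩ := (m.isConnected_polygon m.three_le).isPreconnected.intermediate_value
    hw hγz hcont ⟨hle, h1.le⟩
  exact hne v hv hv0

/-- If the preimage of vertex `n` were not a vertex, it would lie strictly beyond some edge `j`, and
the vertex strictly beyond the image of that edge. The segment from the vertex to an interior point
would then meet the image edge inside the polygon, against `side_image_pos`. -/
lemma exists_inv_smul_pt_eq {γ : DiscAut} (hγ : γ ∈ Γ) {z : UnitDisc} (hz : z ∈ polygon θ)
    (hγz : γ • z ∈ polygon θ) (n : ℤ) : ∃ l, γ⁻¹ • pt θ n = pt θ l := by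
  apply m.exists_eq_pt
  intro j
  obtain ⟨a, b, hm⟩ := m.exists_mapsArc γ j
  rw [edgeSide, ← hm.side_nonneg_iff (Circle.norm_coe _).le, coe_smul_circle,
    act_act_inv _ (Circle.norm_coe _).le, side_eq_two_mul_kside _ _ (Circle.norm_coe _)]
  by_contra! hneg
  obtain ⟨o, ho, ho'⟩ := m.exists_klein_center m.three_le
  have hB : 0 < kside a b o := by
    have := m.side_image_pos hγ hz hγz hm ((IsMarking.ofKlein_mem_polygon ho).2 ho')
    rwa [side_pos_iff_kside, klein_ofKlein] at this
  set x := kside a b (pt θ n) with hx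
  set y := kside a b o with hy
  have hx0 : x < 0 := by linarith
  have hd : 0 < y - x := by linarith
  -- These weights give the zero of the affine function on the segment, where it runs from `x < 0`
  -- to `y > 0`.
  have hst : y / (y - x) + -x / (y - x) = 1 := by field_simp; ring
  have ht : 0 < -x / (y - x) := div_pos (by linarith) hd
  have hs : 0 < y / (y - x) := div_pos hB hd
  have hn : ‖((y / (y - x) : ℝ) * pt θ n + (-x / (y - x) : ℝ) * o : ℂ)‖ < 1 :=
    norm_combo_lt (Circle.norm_coe _).le ho hs.le ht hst
  have hmem : ofKlein _ hn ∈ polygon θ := by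
    refine (IsMarking.ofKlein_mem_polygon hn).2 fun i => ?_
    rw [edgeKside, kside_combo _ _ _ _ hst]
    have h1 := (m.edgeKside_pt n i).1
    have h2 := ho' i
    rw [edgeKside] at h1 h2
    have := mul_nonneg hs.le h1
    have := mul_pos ht h2
    linarith
  have h := m.side_image_pos hγ hz hγz hm hmem
  rw [side_pos_iff_kside, klein_ofKlein, kside_combo _ _ _ _ hst, ← hx, ← hy] at h
  have : y / (y - x) * x + -x / (y - x) * y = 0 := by field_simp; ring
  linarith

lemma exists_smul_pt_eq {γ : DiscAut} (hγ : γ ∈ Γ) {z : UnitDisc} (hz : z ∈ polygon θ)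
    (hγz : γ • z ∈ polygon θ) (n : ℤ) : ∃ l, γ • pt θ n = pt θ l := by
  have := m.exists_inv_smul_pt_eq (Γ.inv_mem hγ) hγz (by rwa [inv_smul_smul]) n
  rwa [inv_inv] at this

lemma mapsArc_of_swap {γ : DiscAut} {i j : ℤ} (h1 : γ • pt θ j = pt θ (i + 1))
    (h2 : γ • pt θ (j + 1) = pt θ i) :
    MapsArc γ (θ j) (θ (j + 1)) (θ (i + 1)) (θ i + 2 * π) :=
  ⟨m.lt_succ j, m.succ_lt_two_pi j, m.succ_lt_two_pi i, by linarith [m.lt_succ i], h1,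
    by rw [Circle.exp_add_two_pi]; exact h2⟩

/-- Reversing the ends of an edge interchanges its two sides, because automorphisms preserve
orientation. -/
lemma edgeSide_act_of_swap {γ : DiscAut} {i j : ℤ} (h1 : γ • pt θ j = pt θ (i + 1))
    (h2 : γ • pt θ (j + 1) = pt θ i) {z : ℂ} (hz : ‖z‖ ≤ 1) :
    (edgeSide θ i (act γ z) ≤ 0 ↔ 0 ≤ edgeSide θ j z) ∧
    (0 ≤ edgeSide θ i (act γ z) ↔ edgeSide θ j z ≤ 0) := by
  have hm := m.mapsArc_of_swap h1 h2
  have a := hm.side_nonneg_iff hz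
  have b := hm.side_nonpos_iff hz
  rw [side_swap] at a b
  rw [edgeSide, edgeSide]
  constructor
  · rw [← a]; constructor <;> intro h <;> linarith
  · rw [← b]; constructor <;> intro h <;> linarith

lemma smul_edge_of_mem {γ : DiscAut} (hγ : γ ∈ Γ) {z : UnitDisc} (hz : z ∈ polygon θ)
    (hγz : γ • z ∈ polygon θ) (j : ℤ) :
    ∃ i, γ • pt θ j = pt θ i ∧ γ • pt θ (j + 1) = pt θ (i + 1) := by
  obtain ⟨i, h1, h2⟩ := m.exists_arc γ hγ j
  obtain ⟨l, hl⟩ := m.exists_smul_pt_eq hγ hz hγz j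
  obtain ⟨l', hl'⟩ := m.exists_smul_pt_eq hγ hz hγz (j + 1)
  have hne : γ • pt θ j ≠ γ • pt θ (j + 1) := fun h => m.pt_succ_ne j (smul_circle_injective _ h)
  rw [hl] at h1
  rw [hl'] at h2
  rw [hl, hl'] at hne ⊢
  rcases m.eq_of_pt_mem h1 with e1 | e1 <;> rcases m.eq_of_pt_mem h2 with e2 | e2
  · exact absurd (e1.trans e2.symm) hne
  · exact ⟨i, e1, e2⟩
  -- A reversed edge would throw `z` to the outer side of edge `i`, though its image lies in the
  -- polygon.
  · exfalso
    have h3 := (m.edgeSide_act_of_swap (hl.trans e1) (hl'.trans e2) z.norm_lt_one.le).1.2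
      (mem_polygon.1 hz j).le
    rw [← coe_smul_disc] at h3
    linarith [mem_polygon.1 hγz i]
  · exact absurd (e1.trans e2.symm) hne

/-- Translates of the polygon are disjoint. -/
lemma eq_one_of_mem {γ : DiscAut} (hγ : γ ∈ Γ) {z : UnitDisc} (hz : z ∈ polygon θ)
    (hγz : γ • z ∈ polygon θ) : γ = 1 := by
  obtain ⟨i, h1, h2⟩ := m.smul_edge_of_mem hγ hz hγz 0
  obtain ⟨j, h3, h4⟩ := m.smul_edge_of_mem hγ hz hγz (0 + 1)
  have hij : pt θ (i + 1) = pt θ j := h2.symm.trans h3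
  have hk := m.three_le
  have hfix : pt θ i = pt θ 0 := by
    rcases m.orbit_eq γ hγ i 0 h1 h2 with e | e
    · exact e
    · rcases m.orbit_eq γ hγ j (0 + 1) h3 h4 with e' | e'
      · exact m.pt_congr (hij.trans e') (by ring)
      -- Here edges 0 and 1 would go to their partners c - 1 and c - 2. The end of the first image
      -- is the start of the second, which would identify vertices c and c - 2.
      · exfalso
        have e1 : pt θ (i + 1) = pt θ c := m.pt_congr e (by ring)
        have e2 : pt θ c = pt θ (c - 1 - (0 + 1)) := e1.symm.trans (hij.trans e')
        apply m.pt_add_two_ne hk (c - 2)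
        rw [show c - 2 + 2 = c by ring, e2]
        congr 1
        ring
  have f0 : γ • pt θ 0 = pt θ 0 := h1.trans hfix
  have f1 : γ • pt θ (0 + 1) = pt θ (0 + 1) := h2.trans (m.pt_congr hfix (by ring))
  have f2 : γ • pt θ (0 + 1 + 1) = pt θ (0 + 1 + 1) :=
    h4.trans (m.pt_congr (h3.symm.trans f1) (by ring))
  exact eq_one_of_three_fixed (m.pt_succ_ne 0) (by simpa using m.pt_add_two_ne hk 0)
    (m.pt_succ_ne _) f0 f1 f2

lemma disjoint_smul {γ : DiscAut} (hγ : γ ∈ Γ) (h1 : γ ≠ 1) :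
    Disjoint ((fun z => γ • z) '' polygon θ) (polygon θ) := by
  rw [Set.disjoint_left]
  rintro _ ⟨z, hz, rfl⟩ hz'
  exact h1 (m.eq_one_of_mem hγ hz hz')

end disjointness

/-! ### Side pairings -/

section pairing

variable (m : IsFoldedPolygon Γ k c θ g)
include m

lemma edgeSide_piece {i : ℤ} {z : ℂ} (hz : ‖z‖ ≤ 1) :
    (edgeSide θ (c - 1 - i) (act (g i) z) ≤ 0 ↔ 0 ≤ edgeSide θ i z) ∧
    (0 ≤ edgeSide θ (c - 1 - i) (act (g i) z) ↔ edgeSide θ i z ≤ 0) :=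
  m.edgeSide_act_of_swap (by rw [m.left]; congr 1; ring) (m.right i) hz

lemma edgeSide_piece_eq_zero {i : ℤ} {z : ℂ} (hz : ‖z‖ ≤ 1) :
    edgeSide θ (c - 1 - i) (act (g i) z) = 0 ↔ edgeSide θ i z = 0 := by
  obtain ⟨a, b⟩ := m.edgeSide_piece (i := i) hz
  rw [le_antisymm_iff, a, b, le_antisymm_iff, and_comm]

lemma edgeSide_piece_pos {i : ℤ} {z : ℂ} (hz : ‖z‖ ≤ 1) :
    0 < edgeSide θ (c - 1 - i) (act (g i) z) ↔ edgeSide θ i z < 0 := by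
  rw [← not_le, (m.edgeSide_piece hz).1, not_le]

/-- The composition preserves edge `i` and, having reversed its sides twice, also each side. A point
of the polygon close to the edge is thus sent into the polygon, and disjointness of the translates
applies. -/
lemma piece_mul_piece (i : ℤ) : g (c - 1 - i) * g i = 1 := by
  have hk := m.three_le
  obtain ⟨u, -, hu⟩ := m.exists_mem_edge i (s := 1 / 2) (t := 1 / 2) (by norm_num) (by norm_num)
    (by norm_num)
  have hfu : edgeSide θ i (g (c - 1 - i) • g i • u : UnitDisc) = 0 := by
    rw [coe_smul_disc, coe_smul_disc]
    have h1 := (m.edgeSide_piece_eq_zero (i := i) u.norm_lt_one.le).2 hu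
    have h2 := (m.edgeSide_piece_eq_zero (i := c - 1 - i) (norm_act_le (g i) u.norm_lt_one.le)).2 h1
    rwa [show c - 1 - (c - 1 - i) = i by ring] at h2
  have hcont : Continuous fun z : UnitDisc => g (c - 1 - i) • g i • z :=
    (continuous_smul_disc _).comp (continuous_smul_disc _)
  have ev := hcont.continuousAt.eventually (m.eventually_mem_polygon hk hfu)
  have hcl := m.mem_closure_of_edge hk hu
  obtain ⟨z, hz, hzR⟩ := (mem_closure_iff_frequently.1 hcl).and_eventually ev |>.exists
  refine m.eq_one_of_mem (Γ.mul_mem (m.piece_mem _) (m.piece_mem _)) hz ?_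
  rw [mul_smul, mem_polygon]
  intro j
  by_cases hj : pt θ j = pt θ i
  · rw [m.edgeSide_congr hj, coe_smul_disc, coe_smul_disc]
    have h0 := mem_polygon.1 hz i
    have h1 : edgeSide θ (c - 1 - i) (act (g i) z) < 0 := by
      rw [← not_le, (m.edgeSide_piece z.norm_lt_one.le).2, not_le]; exact h0
    have h2 := (m.edgeSide_piece_pos (i := c - 1 - i) (norm_act_le (g i) z.norm_lt_one.le)).2 h1
    rwa [show c - 1 - (c - 1 - i) = i by ring] at h2
  · exact hzR j hj

lemma piece_pair (i : ℤ) : g (c - 1 - i) = (g i)⁻¹ := eq_inv_of_mul_eq_one_left (m.piece_mul_piece i)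

end pairing

end IsFoldedPolygon

/-! ### Parabolicity of the vertex cycles -/

/-- Two branches of an expansive map that interchange the germs of arcs `D` at `x` and `E` at `y`
cannot have a non-expanding composition. -/
lemma not_expansive_of_germs {A : PiecewiseMobiusMap} (hexp : A.IsExpansive) {D E : Set Circle}
    {x y : Circle} {g h : DiscAut} (hD : ∀ z ∈ D, A.toFun z = g • z)
    (hE : ∀ z ∈ E, A.toFun z = h • z) (hxy : g • x = y) (hyx : h • y = x)
    (hDE : ∀ᶠ z in 𝓝 x, z ∈ D → g • z ∈ E) (hED : ∀ᶠ z in 𝓝 y, z ∈ E → h • z ∈ D)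
    (hacc : ∀ U ∈ 𝓝 x, ∃ a ∈ U ∩ D, ∃ b ∈ U ∩ D, a ≠ b) :
    scale (h * g) x ≤ 1 := by
  by_contra! hs
  have hfx : (h * g) • x = x := by rw [mul_smul, hxy, hyx]
  obtain ⟨δ, hδ, hsep⟩ := hexp
  have cont : Tendsto (fun z : Circle => g • z) (𝓝 x) (𝓝 y) := by
    rw [← hxy]; exact (continuous_smul_circle g).tendsto x
  -- By `norm_act_sub`, a product of scales above one means that the distance to the fixed point `x`
  -- decreases.
  have ev1 : ∀ᶠ z : Circle in 𝓝 x, 1 < scale (h * g) z * scale (h * g) x := by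
    have hc : Continuous fun z : Circle => scale (h * g) z * scale (h * g) x :=
      ((continuous_scale _).comp (by fun_prop)).mul continuous_const
    exact (hc.tendsto x).eventually (lt_mem_nhds (by nlinarith))
  have ev2 : ∀ᶠ z in 𝓝 x, g • z ∈ E → (h * g) • z ∈ D := by
    filter_upwards [cont.eventually hED] with z hz h'
    rw [mul_smul]; exact hz h'
  have ev3 : ∀ᶠ z in 𝓝 x, dist (g • z) y < δ / 2 :=
    cont.eventually (Metric.ball_mem_nhds y (by positivity))
  obtain ⟨ε, hε, hball⟩ := Metric.eventually_nhds_iff.1 ((((ev1.and ev2).and ev3).and hDE).and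
    (Metric.ball_mem_nhds x (by positivity : 0 < δ / 2)))
  have dist_eq : ∀ z w : Circle, dist z w = ‖(z : ℂ) - w‖ := fun z w =>
    _root_.dist_eq_norm (z : ℂ) w
  have key : ∀ z, z ∈ D → dist z x < ε → ∀ n : ℕ, (A.toFun^[2 * n] z ∈ D ∧
      dist (A.toFun^[2 * n] z) x < ε) := by
    intro z hz hzx n
    induction n with
    | zero => exact ⟨hz, hzx⟩
    | succ n ih =>
      obtain ⟨i1, i2⟩ := ih
      set w := A.toFun^[2 * n] z
      obtain ⟨⟨⟨⟨b1, b2⟩, b3⟩, b4⟩, b5⟩ := hball i2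
      have e1 : A.toFun^[2 * (n + 1)] z = (h * g) • w := by
        rw [show 2 * (n + 1) = 2 * n + 1 + 1 by ring, Function.iterate_succ_apply',
          Function.iterate_succ_apply']
        change A.toFun (A.toFun w) = _
        rw [hD w i1, hE _ (b4 i1), mul_smul]
      rw [e1]
      refine ⟨b2 (b4 i1), ?_⟩
      conv_lhs => rw [← hfx]
      rw [dist_eq, coe_smul_circle, coe_smul_circle,
        norm_act_sub _ (Circle.norm_coe _).le (Circle.norm_coe _).le, ← dist_eq]
      exact (div_le_self dist_nonneg b1.le).trans_lt i2
  obtain ⟨a, ⟨ha1, ha2⟩, b, ⟨hb1, hb2⟩, hab⟩ := hacc _ (Metric.ball_mem_nhds x hε)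
  obtain ⟨n, hn⟩ := hsep a b hab
  -- Orbits started in `D` near `x` alternate between neighbourhoods of `x` and `y` in step with
  -- each other, so two of them never separate by `δ`.
  have near : ∀ z, z ∈ D → dist z x < ε → ∃ p : Circle, (p = if Even n then x else y) ∧
      dist (A.toFun^[n] z) p < δ / 2 := by
    intro z hz hzx
    rcases Nat.even_or_odd' n with ⟨r, hr | hr⟩
    · obtain ⟨k1, k2⟩ := key z hz hzx r
      refine ⟨x, by rw [if_pos (by rw [hr]; exact even_two_mul r)], ?_⟩
      rw [hr]
      exact (hball k2).2
    · obtain ⟨k1, k2⟩ := key z hz hzx r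
      refine ⟨y, by rw [if_neg (by rw [hr]; simp)], ?_⟩
      rw [hr, Function.iterate_succ_apply', hD _ k1]
      exact (hball k2).1.1.2
  obtain ⟨p, hp, hp'⟩ := near a ha2 ha1
  obtain ⟨q, hq, hq'⟩ := near b hb2 hb1
  rw [← hp] at hq
  rw [hq] at hq'
  have := dist_triangle_right (A.toFun^[n] a) (A.toFun^[n] b) p
  linarith

lemma exists_mapsArc_left {g : DiscAut} {a b a' : ℝ} (hab : a < b) (hb : b < a + 2 * π)
    (h : g • Circle.exp a = Circle.exp a') : ∃ b', MapsArc g a b a' b' := by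
  obtain ⟨b', h1, h2, h3⟩ := exists_exp_eq a' (g • Circle.exp b)
  refine ⟨b', hab, hb, lt_of_le_of_ne h1 ?_, h2, h, h3.symm⟩
  rintro rfl
  exact exp_ne_of_lt hab hb (smul_circle_injective g (h.trans h3))

lemma exists_mapsArc_right {g : DiscAut} {a b b' : ℝ} (hab : a < b) (hb : b < a + 2 * π)
    (h : g • Circle.exp b = Circle.exp b') : ∃ a', MapsArc g a b a' b' := by
  obtain ⟨a', h1, h2, h3⟩ := exists_exp_eq (b' - 2 * π) (g • Circle.exp a)
  refine ⟨a', hab, hb, by linarith, ?_, h3.symm, h⟩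
  refine lt_of_le_of_ne (by linarith) ?_
  intro he
  rw [he, Circle.exp_add_two_pi] at h
  exact exp_ne_of_lt hab hb (smul_circle_injective g (h.trans h3)).symm

lemma isClosed_circleArc (a b : ℝ) : IsClosed (circleArc a b) :=
  (isCompact_Icc.image (by fun_prop)).isClosed

lemma eventually_mem_circleArc_left {a b b' : ℝ} (hb : a < b) (hb' : b' < a + 2 * π) :
    ∀ᶠ w in 𝓝 (Circle.exp a), w ∈ circleArc a b' → w ∈ circleArc a b := by
  have hnot : Circle.exp a ∉ circleArc b b' := by
    rintro ⟨t, ⟨h1, h2⟩, h3⟩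
    exact exp_ne_of_lt (by linarith) (by linarith) h3.symm
  filter_upwards [(isClosed_circleArc b b').isOpen_compl.mem_nhds hnot] with w hw
  rintro ⟨t, ⟨h1, h2⟩, rfl⟩
  refine ⟨t, ⟨h1, ?_⟩, rfl⟩
  by_contra! h
  exact hw ⟨t, ⟨h.le, h2⟩, rfl⟩

lemma eventually_mem_circleArc_right {a a' b : ℝ} (ha : a < b) (ha' : b < a' + 2 * π) :
    ∀ᶠ w in 𝓝 (Circle.exp b), w ∈ circleArc a' b → w ∈ circleArc a b := by
  have hnot : Circle.exp b ∉ circleArc a' a := by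
    rintro ⟨t, ⟨h1, h2⟩, h3⟩
    exact exp_ne_of_lt (by linarith) (by linarith) h3
  filter_upwards [(isClosed_circleArc a' a).isOpen_compl.mem_nhds hnot] with w hw
  rintro ⟨t, ⟨h1, h2⟩, rfl⟩
  refine ⟨t, ⟨?_, h2⟩, rfl⟩
  by_contra! h
  exact hw ⟨t, ⟨h1, h.le⟩, rfl⟩

lemma exists_ne_mem_circleArc_left {a b : ℝ} (hab : a < b) {U : Set Circle}
    (hU : U ∈ 𝓝 (Circle.exp a)) :
    ∃ p ∈ U ∩ circleArc a b, ∃ q ∈ U ∩ circleArc a b, p ≠ q := by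
  have hc : ∀ᶠ t in 𝓝 a, Circle.exp t ∈ U := (Circle.exp.continuous.tendsto a).eventually hU
  have h2 : ∀ᶠ t in 𝓝[>] a, Circle.exp t ∈ U ∧ t ∈ Ioo a (min b (a + 2 * π)) :=
    (hc.filter_mono nhdsWithin_le_nhds).and
      (Ioo_mem_nhdsGT (lt_min hab (by linarith [Real.pi_pos])))
  obtain ⟨t, h3, h4, h5⟩ := h2.exists
  exact ⟨Circle.exp a, ⟨mem_of_mem_nhds hU, a, ⟨le_rfl, hab.le⟩, rfl⟩, Circle.exp t,
    ⟨h3, t, ⟨h4.le, (h5.trans_le (min_le_left _ _)).le⟩, rfl⟩,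
    exp_ne_of_lt h4 (h5.trans_le (min_le_right _ _))⟩

lemma exists_ne_mem_circleArc_right {a b : ℝ} (hab : a < b) {U : Set Circle}
    (hU : U ∈ 𝓝 (Circle.exp b)) :
    ∃ p ∈ U ∩ circleArc a b, ∃ q ∈ U ∩ circleArc a b, p ≠ q := by
  have hc : ∀ᶠ t in 𝓝 b, Circle.exp t ∈ U := (Circle.exp.continuous.tendsto b).eventually hU
  have h2 : ∀ᶠ t in 𝓝[<] b, Circle.exp t ∈ U ∧ t ∈ Ioo (max a (b - 2 * π)) b :=
    (hc.filter_mono nhdsWithin_le_nhds).and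
      (Ioo_mem_nhdsLT (max_lt hab (by linarith [Real.pi_pos])))
  obtain ⟨t, h3, h4, h5⟩ := h2.exists
  have h6 := (le_max_right a (b - 2 * π)).trans_lt h4
  exact ⟨Circle.exp t, ⟨h3, t, ⟨((le_max_left _ _).trans_lt h4).le, h5.le⟩, rfl⟩, Circle.exp b,
    ⟨mem_of_mem_nhds hU, b, ⟨hab.le, le_rfl⟩, rfl⟩, exp_ne_of_lt h5 (by linarith)⟩

/-! ### Germs of arcs at the break-points -/

namespace IsMarking

variable {k : ℕ} {θ : ℤ → ℝ} (m : IsMarking k θ)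
include m

lemma eventually_smul_mem_right_germ {g : DiscAut} {i j : ℤ} (h : g • pt θ i = pt θ j) :
    ∀ᶠ z in 𝓝 (pt θ i), z ∈ markedArc θ i → g • z ∈ markedArc θ j := by
  obtain ⟨b', hm⟩ := exists_mapsArc_left (m.lt_succ i) (m.succ_lt_two_pi i) h
  have ev := eventually_mem_circleArc_left (m.lt_succ j) hm.lt_two_pi'
  have ct : Tendsto (fun z : Circle => g • z) (𝓝 (pt θ i)) (𝓝 (pt θ j)) := by
    rw [← h]; exact (continuous_smul_circle g).tendsto _
  filter_upwards [ct.eventually ev] with z hz hz'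
  exact hz (hm.smul_mem_circleArc_iff.2 hz')

lemma eventually_smul_mem_left_germ {g : DiscAut} {i j : ℤ}
    (h : g • pt θ (i + 1) = pt θ (j + 1)) :
    ∀ᶠ z in 𝓝 (pt θ (i + 1)), z ∈ markedArc θ i → g • z ∈ markedArc θ j := by
  obtain ⟨a', hm⟩ := exists_mapsArc_right (m.lt_succ i) (m.succ_lt_two_pi i) h
  have ev := eventually_mem_circleArc_right (m.lt_succ j) hm.lt_two_pi'
  have ct : Tendsto (fun z : Circle => g • z) (𝓝 (pt θ (i + 1))) (𝓝 (pt θ (j + 1))) := by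
    rw [← h]; exact (continuous_smul_circle g).tendsto _
  filter_upwards [ct.eventually ev] with z hz hz'
  exact hz (hm.smul_mem_circleArc_iff.2 hz')

end IsMarking

/-! ### Return maps at the vertices -/

namespace IsFoldedPolygon

variable {Γ : Subgroup DiscAut} {k : ℕ} {c : ℤ} {θ : ℤ → ℝ} {g : ℤ → DiscAut}
  (m : IsFoldedPolygon Γ k c θ g)
include m

lemma vertexMap_fixes (i : ℤ) : (g (c - i) * g i) • pt θ i = pt θ i := by
  rw [mul_smul, m.left, m.left, sub_sub_cancel]

/-- Otherwise the adjacent pieces with indices c - 1 - i and c - i would both be the inverse of `g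
i`. -/
lemma vertexMap_ne_one (i : ℤ) : g (c - i) * g i ≠ 1 := by
  intro h
  apply m.piece_ne (c - 1 - i)
  rw [show c - 1 - i + 1 = c - i by ring, m.piece_pair i, eq_inv_of_mul_eq_one_left h]

/-- The return map formed by the pieces on the clockwise side of the vertex is the inverse of the
one on the other side. One-sided estimates on both sides therefore bound the derivative both ways.
-/
lemma vertexMap_inv (i : ℤ) : g (c - 1 - i) * g (i - 1) = (g (c - i) * g i)⁻¹ := by
  rw [mul_inv_rev, m.piece_pair i, ← m.piece_pair (c - i)]
  congr 2; ring

/-- Expansiveness on the counter-clockwise side of the vertex gives scale at most one; on the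
clockwise side it gives the same for the inverse. -/
lemma scale_vertexMap {A : PiecewiseMobiusMap} (hexp : A.IsExpansive)
    (hA : ∀ j, ∀ z ∈ markedArc θ j, A.toFun z = g j • z) (i : ℤ) :
    scale (g (c - i) * g i) (pt θ i) = 1 := by
  apply le_antisymm
  · have hb : g (c - i) • pt θ (c - i) = pt θ i := by rw [m.left, sub_sub_cancel]
    exact not_expansive_of_germs hexp (hA i) (hA (c - i)) (m.left i) hb
      (m.eventually_smul_mem_right_germ (m.left i)) (m.eventually_smul_mem_right_germ hb)
      fun U hU => exists_ne_mem_circleArc_left (m.lt_succ i) hU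
  · obtain ⟨l, rfl⟩ : ∃ l, i = l + 1 := ⟨i - 1, by ring⟩
    have h1 : g l • pt θ (l + 1) = pt θ (c - 1 - (l + 1) + 1) := by
      rw [m.right]; congr 1; ring
    have h2 : g (c - 1 - (l + 1)) • pt θ (c - 1 - (l + 1) + 1) = pt θ (l + 1) := by
      rw [m.right]; congr 1; ring
    have key := not_expansive_of_germs hexp (hA l) (hA (c - 1 - (l + 1))) h1 h2
      (m.eventually_smul_mem_left_germ h1) (m.eventually_smul_mem_left_germ h2)
      fun U hU => exists_ne_mem_circleArc_right (m.lt_succ l) hU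
    have h3 := m.vertexMap_inv (l + 1)
    rw [show l + 1 - 1 = l by ring] at h3
    rw [h3] at key
    have h4 := scale_inv_act (g (c - (l + 1)) * g (l + 1)) (Circle.norm_coe (pt θ (l + 1))).le
    rw [← coe_smul_circle, m.vertexMap_fixes] at h4
    rw [h4] at key
    have h5 := scale_pos (g (c - (l + 1)) * g (l + 1)) (Circle.norm_coe (pt θ (l + 1))).le
    rwa [inv_le_one₀ h5] at key

end IsFoldedPolygon

/-! ### From the Markov map to a folded polygon -/

namespace PiecewiseMobiusMap

variable {A : PiecewiseMobiusMap} {Γ : Subgroup DiscAut}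

lemma edge_eq_iff (m : IsMarking A.numPieces A.angle) (hk : 3 ≤ A.numPieces) {i j : ℤ}
    (h : A.edge i = A.edge j) : pt A.angle i = pt A.angle j := by
  rw [edge, edge, Sym2.eq_iff] at h
  rcases h with h | h
  · exact h.1
  · exact m.pt_eq_of_edge_eq hk (Or.inr h.1) (Or.inl h.2)

lemma edge_eq_of_reflection {c : ℤ}
    (hc : ∀ i, A.toFun (pt A.angle i) = pt A.angle (c - i)) (i : ℤ) :
    (A.edge i).map A.toFun = A.edge (c - 1 - i) := by
  rw [map_edge_eq, hc, hc, Sym2.eq_swap, show c - (i + 1) = c - 1 - i by ring,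
    show c - i = c - 1 - i + 1 by ring]
  rfl

lemma iterate_edge {c : ℤ} (hc : ∀ i, A.toFun (pt A.angle i) = pt A.angle (c - i)) (i : ℤ) (r : ℕ) :
    (Sym2.map A.toFun)^[r] (A.edge i) = A.edge i ∨
      (Sym2.map A.toFun)^[r] (A.edge i) = A.edge (c - 1 - i) := by
  induction r with
  | zero => exact Or.inl rfl
  | succ r ih =>
    rw [Function.iterate_succ_apply']
    rcases ih with h | h <;> rw [h, edge_eq_of_reflection hc]
    · exact Or.inr rfl
    · left; congr 1; ring

/-- The fundamental domain of the map is a folded polygon. -/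
lemma exists_isFoldedPolygon (hΓ : IsFuchsian Γ) (hA : A.IsPiecewiseFuchsianMarkov)
    (hmin : A.IsMinimal) (hpiece : ∀ j, A.piece j ∈ Γ)
    (hedge : A.IsBackwardEdgeOrbitEquivalent Γ) :
    ∃ c, IsFoldedPolygon Γ A.numPieces c A.angle A.piece := by
  obtain ⟨d, hd, hcov⟩ := hA.covering
  obtain ⟨m, hk, c, hc⟩ := exists_reflection hmin hA.markov (not_injective_of_covering hd hcov)
    hedge hpiece
  refine ⟨c, m, hk, hΓ, hpiece, A.piece_add, ?_, ?_, ?_, ?_, piece_ne hmin⟩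
  · intro j
    rw [← toFun_eq_left m, hc]
  · intro j
    rw [← toFun_eq_right m, hc]
    congr 1; ring
  · exact fun γ hγ j => exists_arc_smul_edge m hmin hedge hγ j
  -- If edge `i` is a translate of edge `j`, some iterate of A takes it to edge `j`; but A only
  -- exchanges edge `i` with its partner c - 1 - i.
  · intro γ hγ i j h1 h2
    have h3 : (A.edge j).map (fun z => γ • z) = A.edge i := by
      rw [edge, Sym2.map_mk]
      exact congrArg₂ (fun x y => s(x, y)) h1 h2
    have h4 := inBackwardOrbit_smul hedge hγ j
    rw [h3] at h4
    obtain ⟨r, hr⟩ := exists_iterate_of_inBackwardOrbit h4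
    rcases iterate_edge hc i r with h | h
    · left; exact edge_eq_iff m hk (h.symm.trans hr)
    · right
      exact m.pt_congr_neg (edge_eq_iff m hk (h.symm.trans hr)) (by ring)

end PiecewiseMobiusMap

/-! ### The polygon near its ideal vertices -/

lemma exp_neg_half (a b : ℝ) : (Circle.exp (-((a + b) / 2)) : ℂ) =
    conj (Circle.exp a : ℂ) * (Circle.exp (-((b - a) / 2)) : ℂ) := by
  rw [← Circle.coe_inv_eq_conj, ← Circle.exp_neg, ← Circle.coe_mul, ← Circle.exp_add]
  congr 2; ring

lemma norm_sub_circle_sq (z : ℂ) (p : Circle) :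
    ‖z - p‖ ^ 2 = 1 + ‖z‖ ^ 2 - 2 * (z * conj (p : ℂ)).re := by
  have h : ‖(p : ℂ)‖ ^ 2 = 1 := by rw [Circle.norm_coe]; norm_num
  rw [Complex.sq_norm] at h
  rw [Complex.sq_norm, Complex.sq_norm, normSq_sub, h]
  ring

lemma side_eq_left (a b : ℝ) (z : ℂ) : side a b z =
    Real.cos ((b - a) / 2) * ‖z - Circle.exp a‖ ^ 2
      - 2 * Real.sin ((b - a) / 2) * (z * conj (Circle.exp a : ℂ)).im := by
  rw [side, exp_neg_half, ← mul_assoc, norm_sub_circle_sq, Circle.coe_exp (-((b - a) / 2)),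
    Complex.exp_mul_I, ← ofReal_cos, ← ofReal_sin, Real.cos_neg, Real.sin_neg]
  generalize z * conj (Circle.exp a : ℂ) = v
  simp only [mul_re, add_re, ofReal_re, I_re, ofReal_im, I_im, add_im, mul_im, ofReal_neg, neg_re,
    neg_im]
  ring

lemma side_eq_right (a b : ℝ) (z : ℂ) : side a b z =
    Real.cos ((b - a) / 2) * ‖z - Circle.exp b‖ ^ 2
      + 2 * Real.sin ((b - a) / 2) * (z * conj (Circle.exp b : ℂ)).im := by
  have h := side_eq_left b a z
  have e1 : side b a z = side a b z := by
    rw [side, side, add_comm b a, show (a - b) / 2 = -((b - a) / 2) by ring, Real.cos_neg]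
  rw [e1, show (a - b) / 2 = -((b - a) / 2) by ring, Real.cos_neg, Real.sin_neg] at h
  rw [h]; ring

namespace IsMarking

variable {k : ℕ} {θ : ℤ → ℝ} (m : IsMarking k θ)
include m

/-- The imaginary part is the coordinate tangent to the circle at the vertex. The two edges meeting
there bound it from both sides by a multiple of the squared distance: the polygon has a cusp. -/
lemma exists_abs_im_le (i : ℤ) : ∃ C : ℝ, ∀ z : ℂ, 0 ≤ edgeSide θ i z →
    0 ≤ edgeSide θ (i - 1) z → |(z * conj (pt θ i : ℂ)).im| ≤ C * ‖z - pt θ i‖ ^ 2 := by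
  have l1 := m.lt_succ i
  have l2 := m.succ_lt_two_pi i
  have l3 := m.lt_succ (i - 1)
  have l4 := m.succ_lt_two_pi (i - 1)
  rw [sub_add_cancel] at l3 l4
  set a1 := (θ (i + 1) - θ i) / 2 with ha1
  set a2 := (θ i - θ (i - 1)) / 2 with ha2
  have s1 : 0 < Real.sin a1 := Real.sin_pos_of_pos_of_lt_pi (by linarith) (by linarith)
  have s2 : 0 < Real.sin a2 := Real.sin_pos_of_pos_of_lt_pi (by linarith) (by linarith)
  refine ⟨max (Real.cos a1 / (2 * Real.sin a1)) (Real.cos a2 / (2 * Real.sin a2)), ?_⟩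
  intro z h1 h2
  rw [edgeSide, side_eq_left, ← ha1] at h1
  rw [edgeSide, sub_add_cancel, side_eq_right, ← ha2] at h2
  change 0 ≤ _ * ‖z - pt θ i‖ ^ 2 - _ * (z * conj (pt θ i : ℂ)).im at h1
  change 0 ≤ _ * ‖z - pt θ i‖ ^ 2 + _ * (z * conj (pt θ i : ℂ)).im at h2
  set U := ‖z - pt θ i‖ ^ 2
  set Y := (z * conj (pt θ i : ℂ)).im
  have hU : 0 ≤ U := sq_nonneg _
  rw [abs_le]
  constructor
  · have h3 : -Y ≤ Real.cos a2 / (2 * Real.sin a2) * U := by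
      rw [div_mul_eq_mul_div, le_div_iff₀ (by positivity)]; linarith
    have := mul_le_mul_of_nonneg_right
      (le_max_right (Real.cos a1 / (2 * Real.sin a1)) (Real.cos a2 / (2 * Real.sin a2))) hU
    linarith
  · have h3 : Y ≤ Real.cos a1 / (2 * Real.sin a1) * U := by
      rw [div_mul_eq_mul_div, le_div_iff₀ (by positivity)]; linarith
    have := mul_le_mul_of_nonneg_right
      (le_max_left (Real.cos a1 / (2 * Real.sin a1)) (Real.cos a2 / (2 * Real.sin a2))) hU
    linarith

/-- Points of the polygon near a vertex lie deep inside horoballs. -/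
lemma exists_horo_lt (i : ℤ) {η : ℝ} (hη : 0 < η) : ∃ r > 0, ∀ z : ℂ, ‖z‖ < 1 →
    (∀ j, 0 ≤ edgeSide θ j z) → ‖z - pt θ i‖ < r → ‖z - pt θ i‖ ^ 2 / (1 - ‖z‖ ^ 2) < η := by
  obtain ⟨C, hC⟩ := m.exists_abs_im_le i
  refine ⟨min (min (1 / 2) (η / 2)) (1 / (2 * (|C| + 1))), by positivity, ?_⟩
  intro z hz hP hr
  have r1 : ‖z - pt θ i‖ < 1 / 2 := hr.trans_le ((min_le_left _ _).trans (min_le_left _ _))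
  have r2 : ‖z - pt θ i‖ < η / 2 := hr.trans_le ((min_le_left _ _).trans (min_le_right _ _))
  have r3 : ‖z - pt θ i‖ < 1 / (2 * (|C| + 1)) := hr.trans_le (min_le_right _ _)
  have hY := hC z (hP i) (hP (i - 1))
  have hU := norm_sub_circle_sq z (pt θ i)
  have hv : ‖z * conj (pt θ i : ℂ)‖ = ‖z‖ := by
    rw [norm_mul, Complex.norm_conj, Circle.norm_coe, mul_one]
  have hv2 : ‖z‖ ^ 2 = (z * conj (pt θ i : ℂ)).re ^ 2 + (z * conj (pt θ i : ℂ)).im ^ 2 := by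
    rw [← hv, Complex.sq_norm, normSq_apply]; ring
  have hX : (z * conj (pt θ i : ℂ)).re ≤ ‖z‖ := by rw [← hv]; exact Complex.re_le_norm _
  have hpos : 0 < ‖z - pt θ i‖ := by
    rw [norm_pos_iff, sub_ne_zero]
    rintro rfl
    rw [Circle.norm_coe] at hz
    exact lt_irrefl _ hz
  set r := ‖z - pt θ i‖
  set X := (z * conj (pt θ i : ℂ)).re
  set Y := (z * conj (pt θ i : ℂ)).im
  have hCr : |C| * r ≤ 1 / 2 := by
    rw [lt_div_iff₀ (by positivity)] at r3
    nlinarith [abs_nonneg C]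
  have hY2 : |Y| ≤ r / 2 := by
    calc |Y| ≤ C * r ^ 2 := hY
      _ ≤ |C| * r ^ 2 := mul_le_mul_of_nonneg_right (le_abs_self C) (sq_nonneg r)
      _ = |C| * r * r := by ring
      _ ≤ 1 / 2 * r := mul_le_mul_of_nonneg_right hCr hpos.le
      _ = r / 2 := by ring
  have hYsq : Y ^ 2 ≤ (r / 2) ^ 2 := by rw [← sq_abs]; exact pow_le_pow_left₀ (abs_nonneg _) hY2 2
  have h1X : (r / 2) ^ 2 ≤ (1 - X) ^ 2 := by nlinarith
  have h1X' : r / 2 ≤ 1 - X := abs_le_of_sq_le_sq' h1X (by linarith) |>.2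
  -- In the cusp the approach is nearly radial, so 1 - ‖z‖² is at least r/2 and the quotient at most
  -- 2r; this is why r was taken below η/2.
  have hlow : r / 2 ≤ 1 - ‖z‖ ^ 2 := by nlinarith
  rw [div_lt_iff₀ (by linarith)]
  nlinarith

end IsMarking

namespace IsFoldedPolygon

variable {Γ : Subgroup DiscAut} {k : ℕ} {c : ℤ} {θ : ℤ → ℝ} {g : ℤ → DiscAut}
  (m : IsFoldedPolygon Γ k c θ g)

/-! ### Local finiteness of the translates -/

section tessellation

variable (hpar : ∀ i, scale (g (c - i) * g i) (pt θ i) = 1)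
include m hpar

lemma act_vertexMap_ne (i : ℤ) {z : ℂ} (hz : ‖z‖ < 1) : act (g (c - i) * g i) z ≠ z :=
  act_ne_self_of_parabolic (Circle.norm_coe (pt θ i))
    (by rw [← coe_smul_circle, m.vertexMap_fixes]) (hpar i) (m.vertexMap_ne_one i) hz

lemma exists_disp_vertexMap_lt (i : ℤ) {ε : ℝ} (hε : 0 < ε) : ∃ r > 0, ∀ z : ℂ, ‖z‖ < 1 →
    (∀ j, 0 ≤ edgeSide θ j z) → ‖z - pt θ i‖ < r → disp (g (c - i) * g i) z < ε := by
  obtain ⟨B, hB, H⟩ := exists_disp_eq_of_parabolic (Circle.norm_coe (pt θ i))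
    (by rw [← coe_smul_circle, m.vertexMap_fixes]) (hpar i) (m.vertexMap_ne_one i)
  -- The displacement is `B` times the square of the horocyclic quantity, hence this threshold.
  obtain ⟨r, hr, hr'⟩ := m.exists_horo_lt i (η := √(ε / B)) (by positivity)
  refine ⟨r, hr, fun z hz hP hzr => ?_⟩
  have h := hr' z hz hP hzr
  have h0 : 0 ≤ ‖z - pt θ i‖ ^ 2 / (1 - ‖z‖ ^ 2) := div_nonneg (sq_nonneg _) (one_sub_sq_pos hz).le
  rw [H z hz]
  have h2 : (‖z - pt θ i‖ ^ 2 / (1 - ‖z‖ ^ 2)) ^ 2 < ε / B := by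
    have := pow_lt_pow_left₀ h h0 two_ne_zero
    rwa [Real.sq_sqrt (by positivity)] at this
  rw [lt_div_iff₀ hB] at h2
  linarith

/-- The part of the polygon on which no vertex map displaces little is relatively compact. -/
lemma exists_norm_le_of_disp {ε : ℝ} (hε : 0 < ε) : ∃ ρ < 1, ∀ z : ℂ, ‖z‖ < 1 →
    (∀ j, 0 ≤ edgeSide θ j z) → (∀ i, ε ≤ disp (g (c - i) * g i) z) → ‖z‖ ≤ ρ := by
  choose r hr0 hr using fun i : ℤ => m.exists_disp_vertexMap_lt hpar i hε
  set K : Set ℂ := Metric.closedBall 0 1 ∩ ((⋂ j : Fin k, {z | 0 ≤ edgeSide θ j z}) ∩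
    ⋂ j : Fin k, {z | r j ≤ ‖z - pt θ j‖}) with hK
  have hKc : IsCompact K := by
    refine (isCompact_closedBall 0 1).inter_right (IsClosed.inter ?_ ?_)
    · exact isClosed_iInter fun j => isClosed_le continuous_const (continuous_side _ _)
    · exact isClosed_iInter fun j => isClosed_le continuous_const (by fun_prop)
  have hmemK : ∀ z : ℂ, ‖z‖ < 1 → (∀ j, 0 ≤ edgeSide θ j z) →
      (∀ i, ε ≤ disp (g (c - i) * g i) z) → z ∈ K := by
    intro z hz hP hd
    refine ⟨by simpa using hz.le, mem_iInter.2 fun j => hP j, mem_iInter.2 fun j => ?_⟩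
    by_contra! hlt
    have hlt' : ‖z - pt θ j‖ < r j := by simpa using hlt
    have := hr j z hz hP hlt'
    linarith [hd j]
  -- The closed polygon reaches the circle only at its vertices, whose neighbourhoods have been
  -- removed from `K`.
  have hKlt : ∀ z ∈ K, ‖z‖ < 1 := by
    rintro z ⟨h1, h2, h3⟩
    rw [mem_closedBall_zero_iff] at h1
    refine lt_of_le_of_ne h1 fun h => ?_
    have hP : ∀ j, 0 ≤ edgeSide θ j z := by
      refine (m.forall_iff (P := fun j => 0 ≤ edgeSide θ j z)
        fun i j h => by rw [m.edgeSide_congr h]; exact id).2 fun j => ?_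
      exact mem_iInter.1 h2 j
    obtain ⟨i, hi⟩ := m.exists_eq_pt (p := ⟨z, mem_sphere_zero_iff_norm.2 h⟩) hP
    have hi' : z = pt θ i := congrArg Subtype.val hi
    have : ∀ j, pt θ j ≠ pt θ i := by
      refine (m.forall_iff (P := fun j => pt θ j ≠ pt θ i)
        fun i j h => by rw [h]; exact id).2 fun j hj => ?_
      have h4 := mem_iInter.1 h3 j
      have h5 : r j ≤ ‖z - pt θ j‖ := h4
      rw [hi', hj, sub_self, norm_zero] at h5
      linarith [hr0 j]
    exact this i rfl
  rcases K.eq_empty_or_nonempty with he | hne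
  · refine ⟨0, one_pos, fun z hz hP hd => ?_⟩
    have := hmemK z hz hP hd
    rw [he] at this
    exact absurd this (notMem_empty z)
  · obtain ⟨z0, hz0, hmax⟩ := hKc.exists_isMaxOn hne continuous_norm.continuousOn
    exact ⟨‖z0‖, hKlt z0 hz0, fun z hz hP hd => hmax (hmemK z hz hP hd)⟩

/-- If γz lies in the ρ-ball, the γ-conjugates of all vertex maps move it by at least ε. By
conjugation invariance the vertex maps themselves move z by at least ε, so z avoids the cusps and
lies in a fixed compact part of the disc; then proper discontinuity applies. -/
lemma finite_setOf_closure_mem {ρ : ℝ} (hρ : ρ < 1) :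
    {γ : DiscAut | γ ∈ Γ ∧ ∃ z ∈ closure (polygon θ), ‖act γ z‖ ≤ ρ}.Finite := by
  obtain ⟨ε, hε, H⟩ := exists_le_disp m.fuchsian hρ
  obtain ⟨ρ', hρ', H'⟩ := m.exists_norm_le_of_disp hpar hε
  refine (finite_setOf_act_mem m.fuchsian (max_lt hρ hρ')).subset ?_
  rintro γ ⟨hγ, z, hz, hz'⟩
  refine ⟨hγ, z, (H' z z.norm_lt_one ((m.mem_closure_polygon m.three_le).1 hz) fun i => ?_).trans
    (le_max_right _ _), hz'.trans (le_max_left _ _)⟩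
  rw [← disp_conj (g (c - i) * g i) γ z.norm_lt_one]
  refine H _ (Γ.mul_mem (Γ.mul_mem hγ (Γ.mul_mem (m.piece_mem _) (m.piece_mem _)))
    (Γ.inv_mem hγ)) (fun w hw hfix => ?_) _ hz'
  have hw' := norm_act_lt γ⁻¹ hw
  apply m.act_vertexMap_ne hpar i hw'
  have h1 := congrArg (act γ⁻¹) hfix
  rw [← act_mul _ _ hw.le] at h1
  rw [← act_mul _ _ hw.le, ← h1]
  congr 1
  group

lemma locallyFinite_translates :
    LocallyFinite fun γ : Γ => smulHomeo (γ : DiscAut) '' closure (polygon θ) := by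
  intro z
  set ρ := (1 + ‖(z : ℂ)‖) / 2
  have h1 := z.norm_lt_one
  refine ⟨{w : UnitDisc | ‖(w : ℂ)‖ < ρ}, ?_, ?_⟩
  · refine (isOpen_lt ?_ continuous_const).mem_nhds ?_
    · exact UnitDisc.continuous_coe.norm
    · change ‖(z : ℂ)‖ < ρ
      simp only [ρ]; linarith
  · have hfin := m.finite_setOf_closure_mem hpar (ρ := ρ) (by simp only [ρ]; linarith)
    refine (hfin.preimage Subtype.val_injective.injOn).subset ?_
    rintro γ ⟨_, ⟨w, hw, rfl⟩, hw'⟩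
    refine ⟨γ.2, w, hw, ?_⟩
    rw [← coe_smul_disc]
    exact le_of_lt hw'

end tessellation

/-! ### Identifications on the closed polygon -/

include m

/-- Near a point of an edge, one side belongs to the polygon and the other to its translate by the
inverse of the side pairing. -/
lemma eventually_mem_closure_or {i : ℤ} {u : UnitDisc} (hu : edgeSide θ i u = 0) :
    ∀ᶠ z in 𝓝 u, z ∈ closure (polygon θ) ∨ g i • z ∈ polygon θ := by
  have hgu : edgeSide θ (c - 1 - i) (g i • u : UnitDisc) = 0 := by
    rw [coe_smul_disc]; exact (m.edgeSide_piece_eq_zero u.norm_lt_one.le).2 hu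
  filter_upwards [m.eventually_mem_polygon m.three_le hu,
    (continuous_smul_disc (g i)).continuousAt.eventually
      (m.eventually_mem_polygon m.three_le hgu)] with z h1 h2
  rcases le_or_gt 0 (edgeSide θ i z) with h | h
  · left
    rw [m.mem_closure_polygon m.three_le]
    intro j
    by_cases hj : pt θ j = pt θ i
    · rwa [m.edgeSide_congr hj]
    · exact (h1 j hj).le
  · right
    rw [mem_polygon]
    intro j
    by_cases hj : pt θ j = pt θ (c - 1 - i)
    · rw [m.edgeSide_congr hj, coe_smul_disc]
      exact (m.edgeSide_piece_pos z.norm_lt_one.le).2 h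
    · exact h2 j hj

lemma exists_edge_of_mem_closure {u : UnitDisc} (hu : u ∈ closure (polygon θ))
    (hu' : u ∉ polygon θ) : ∃ i, edgeSide θ i u = 0 := by
  rw [mem_polygon] at hu'
  push Not at hu'
  obtain ⟨i, hi⟩ := hu'
  exact ⟨i, le_antisymm hi ((m.mem_closure_polygon m.three_le).1 hu i)⟩

lemma eq_one_of_mem_closure {γ : DiscAut} (hγ : γ ∈ Γ) {z : UnitDisc}
    (hz : z ∈ closure (polygon θ)) (hγz : γ • z ∈ polygon θ) : γ = 1 := by
  have hopen : IsOpen ((fun w : UnitDisc => γ • w) ⁻¹' polygon θ) :=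
    m.isOpen_polygon.preimage (continuous_smul_disc γ)
  obtain ⟨w, hw1, hw2⟩ := mem_closure_iff.1 hz _ hopen hγz
  exact m.eq_one_of_mem hγ hw2 hw1

/-- Two points of the closed polygon are identified only by the side pairings. -/
lemma exists_piece_eq {γ : DiscAut} (hγ : γ ∈ Γ) (hγ1 : γ ≠ 1) {z : UnitDisc}
    (hz : z ∈ closure (polygon θ)) (hγz : γ • z ∈ closure (polygon θ)) :
    ∃ i, edgeSide θ i z = 0 ∧ γ = g i := by
  have hzR : z ∉ polygon θ := by
    intro h
    have := m.eq_one_of_mem_closure (Γ.inv_mem hγ) hγz (by rwa [inv_smul_smul])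
    exact hγ1 (inv_eq_one.1 this)
  obtain ⟨i, hi⟩ := m.exists_edge_of_mem_closure hz hzR
  refine ⟨i, hi, ?_⟩
  have hev := m.eventually_mem_closure_or hi
  have ct : Tendsto (fun w : UnitDisc => γ⁻¹ • w) (𝓝 (γ • z)) (𝓝 z) := by
    have := (continuous_smul_disc γ⁻¹).tendsto (γ • z)
    rwa [inv_smul_smul] at this
  -- Pulling a nearby point of the polygon back by γ puts it in the closed polygon or just across
  -- edge `i`; disjointness of the translates then identifies γ.
  obtain ⟨w, hwR, hw⟩ := (mem_closure_iff_frequently.1 hγz).and_eventually (ct.eventually hev)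
    |>.exists
  rcases hw with hw | hw
  · exact absurd (m.eq_one_of_mem_closure hγ hw (by rwa [smul_inv_smul])) hγ1
  · have := m.eq_one_of_mem (γ := γ * (g i)⁻¹) (Γ.mul_mem hγ (Γ.inv_mem (m.piece_mem i))) hw
      (by rwa [smul_smul, inv_mul_cancel_right, smul_inv_smul])
    exact mul_inv_eq_one.1 this

/-! ### Covering of the disc and generation of the group -/

section covering

variable (hpar : ∀ i, scale (g (c - i) * g i) (pt θ i) = 1)
include hpar

/-- The translates of the closed polygon by the side pairings cover the disc. -/
lemma exists_smul_mem_closure {Δ : Subgroup DiscAut} (hΔ : Δ ≤ Γ) (hg : ∀ i, g i ∈ Δ)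
    (z : UnitDisc) : ∃ γ ∈ Δ, γ • z ∈ closure (polygon θ) := by
  -- The union is closed by local finiteness and open by `eventually_mem_closure_or`. The subgroup
  -- is left general so that the subgroup generated by the side pairings can be used too.
  set U : Set UnitDisc := ⋃ γ : Δ, smulHomeo (γ : DiscAut) '' closure (polygon θ) with hU
  have hmemU : ∀ w, w ∈ U ↔ ∃ γ ∈ Δ, γ • w ∈ closure (polygon θ) := by
    intro w
    rw [hU, mem_iUnion]
    constructor
    · rintro ⟨γ, v, hv, rfl⟩
      exact ⟨_, Δ.inv_mem γ.2, by rwa [smulHomeo_apply, inv_smul_smul]⟩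
    · rintro ⟨γ, hγ, hw⟩
      exact ⟨⟨_, Δ.inv_mem hγ⟩, _, hw, by rw [smulHomeo_apply, inv_smul_smul]⟩
  have hclosed : IsClosed U := by
    have hlf := (m.locallyFinite_translates hpar).comp_injective
      (Subgroup.inclusion_injective hΔ)
    refine LocallyFinite.isClosed_iUnion (f := fun γ : Δ => _) hlf fun γ => ?_
    exact (smulHomeo (γ : DiscAut)).isClosed_image.2 isClosed_closure
  have hopen : IsOpen U := by
    rw [isOpen_iff_mem_nhds]
    intro w hw
    obtain ⟨γ, hγ, hw'⟩ := (hmemU w).1 hw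
    have hnear : ∀ᶠ v in 𝓝 (γ • w), v ∈ U := by
      by_cases hR : γ • w ∈ polygon θ
      · filter_upwards [m.isOpen_polygon.mem_nhds hR] with v hv
        exact (hmemU v).2 ⟨1, Δ.one_mem, by rw [one_smul]; exact subset_closure hv⟩
      · obtain ⟨i, hi⟩ := m.exists_edge_of_mem_closure hw' hR
        filter_upwards [m.eventually_mem_closure_or hi] with v hv
        rcases hv with hv | hv
        · exact (hmemU v).2 ⟨1, Δ.one_mem, by rwa [one_smul]⟩
        · exact (hmemU v).2 ⟨g i, hg i, subset_closure hv⟩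
    filter_upwards [(continuous_smul_disc γ).continuousAt.eventually hnear] with v hv
    obtain ⟨β, hβ, hβv⟩ := (hmemU _).1 hv
    exact (hmemU v).2 ⟨β * γ, Δ.mul_mem hβ hγ, by rwa [mul_smul]⟩
  have hconn : IsPreconnected (univ : Set UnitDisc) := by
    rw [← UnitDisc.isEmbedding_coe.isInducing.isPreconnected_image]
    have : UnitDisc.coe '' univ = Metric.ball (0 : ℂ) 1 := by
      ext w
      rw [mem_ball_zero_iff, image_univ]
      constructor
      · rintro ⟨v, rfl⟩
        exact v.norm_lt_one
      · intro h
        exact ⟨UnitDisc.mk w h, rfl⟩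
    rw [this]
    exact (convex_ball 0 1).isPreconnected
  have hUniv : U = univ := by
    have := preconnectedSpace_iff_univ.2 hconn
    refine (isClopen_iff.1 ⟨hclosed, hopen⟩).resolve_left ?_
    obtain ⟨o, ho⟩ := m.polygon_nonempty m.three_le
    exact Nonempty.ne_empty ⟨o, (hmemU o).2 ⟨1, Δ.one_mem, by
      rw [one_smul]; exact subset_closure ho⟩⟩
  exact (hmemU z).1 (hUniv ▸ mem_univ z)

/-- Translates by the generated subgroup already cover the disc; a further translate by Γ would
overlap one of them, hence coincide with it. -/
lemma closure_range_eq : Subgroup.closure (range g) = Γ := by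
  have hle : Subgroup.closure (range g) ≤ Γ := by
    rw [Subgroup.closure_le]
    rintro _ ⟨i, rfl⟩
    exact m.piece_mem i
  refine le_antisymm hle fun γ hγ => ?_
  obtain ⟨o, ho⟩ := m.polygon_nonempty m.three_le
  obtain ⟨δ, hδ, h⟩ := m.exists_smul_mem_closure hpar hle
    (fun i => Subgroup.subset_closure ⟨i, rfl⟩) (γ⁻¹ • o)
  have := m.eq_one_of_mem_closure (γ := (δ * γ⁻¹)⁻¹)
    (Γ.inv_mem (Γ.mul_mem (hle hδ) (Γ.inv_mem hγ))) h (by rw [← mul_smul δ, inv_smul_smul]; exact ho)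
  rw [inv_eq_one, mul_inv_eq_one] at this
  rwa [← this]

lemma isFundamentalDomain : IsFundamentalDomain Γ (polygon θ) where
  isOpen := m.isOpen_polygon
  isConnected := m.isConnected_polygon m.three_le
  disjoint _ hγ h1 := m.disjoint_smul hγ h1
  covers := m.exists_smul_mem_closure hpar le_rfl m.piece_mem

end covering

end IsFoldedPolygon

/-! ### The Bowen–Series structure -/

namespace IsFoldedPolygon

variable {Γ : Subgroup DiscAut} {k : ℕ} {c : ℤ} {θ : ℤ → ℝ} {g : ℤ → DiscAut}
  (m : IsFoldedPolygon Γ k c θ g)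
include m

lemma piece_ne_one (i : ℤ) : g i ≠ 1 := by
  intro h
  have h1 := m.left i
  have h2 := m.right i
  rw [h, one_smul] at h1 h2
  have := (m.pt_congr (h1.symm) (i' := c - i + 1) (j' := i + 1) (by ring)).trans h2
  exact m.pt_add_two_ne m.three_le (c - 1 - i) (by rw [← this]; congr 1; ring)

lemma geodesic_inter_closure (i : ℤ) :
    geodesic (θ i) (θ (i + 1)) ∩ closure (polygon θ) = geodesic (θ i) (θ (i + 1)) :=
  inter_eq_left.2 fun _ hz => m.mem_closure_of_edge m.three_le (mem_geodesic.1 hz)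

lemma nontrivial_geodesic (i : ℤ) : (geodesic (θ i) (θ (i + 1))).Nontrivial := by
  obtain ⟨u, hu, hu'⟩ := m.exists_mem_edge i (s := 1 / 2) (t := 1 / 2)
    (by norm_num) (by norm_num) (by norm_num)
  obtain ⟨v, hv, hv'⟩ := m.exists_mem_edge i (s := 1 / 3) (t := 2 / 3)
    (by norm_num) (by norm_num) (by norm_num)
  refine ⟨u, mem_geodesic.2 hu', v, mem_geodesic.2 hv', fun h => ?_⟩
  rw [h, hv] at hu
  apply m.pt_succ_ne i
  apply Circle.ext
  push_cast at hu
  linear_combination (-6) * hu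

lemma image_geodesic (i : ℤ) : (fun z => g i • z) '' geodesic (θ i) (θ (i + 1)) =
    geodesic (θ (c - 1 - i)) (θ (c - 1 - i + 1)) := by
  have key : ∀ i, ∀ z ∈ geodesic (θ i) (θ (i + 1)),
      g i • z ∈ geodesic (θ (c - 1 - i)) (θ (c - 1 - i + 1)) := fun i z hz => by
    rw [mem_geodesic, coe_smul_disc]
    exact (m.edgeSide_piece_eq_zero z.norm_lt_one.le).2 (mem_geodesic.1 hz)
  refine Subset.antisymm ?_ fun z hz => ⟨(g i)⁻¹ • z, ?_, smul_inv_smul _ _⟩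
  · rintro _ ⟨z, hz, rfl⟩
    exact key i z hz
  · have := key _ z hz
    rwa [m.piece_pair, sub_sub_cancel] at this

/-- All sides are complete geodesics, so both sequences of endpoints are the break-points themselves
and the condition on extended sides is trivial. -/
lemma isBowenSeriesMap (hpar : ∀ i, scale (g (c - i) * g i) (pt θ i) = 1) {f : Circle → Circle}
    (hf : ∀ j, ∀ z ∈ markedArc θ j, f z = g j • z) : IsBowenSeriesMap Γ (polygon θ) f := by
  refine ⟨m.isFundamentalDomain hpar, k, θ, θ, g, fun i => geodesic (θ i) (θ (i + 1)),
    fun i => geodesic (θ i) (θ (i + 1)), fun i => ⟨m.add i, m.add i, m.piece_add i⟩,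
    fun i => ⟨m.lt_succ i, le_rfl, (m.lt_succ i).le⟩, fun _ => rfl, rfl,
    fun i => ⟨(m.geodesic_inter_closure i).symm, m.nontrivial_geodesic i⟩,
    fun i => ⟨m.piece_mem i, m.piece_ne_one i, c - 1 - i, m.image_geodesic i, m.piece_pair i⟩,
    m.closure_range_eq hpar, fun i z hz => ?_,
    fun i t ht => hf i _ ⟨t, ⟨ht.1, ht.2.le⟩, rfl⟩⟩
  refine mem_iUnion₂.2 ⟨1, Γ.one_mem, mem_iUnion.2 ⟨i, z, hz, one_smul _ _⟩⟩

end IsFoldedPolygon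

/-! ### A parametrization of the boundary of the polygon -/

/-- The parameter on an edge that takes the weights of its endpoints into account. -/
def chordParam (μ : ℤ → ℝ) (i : ℤ) (s : ℝ) : ℝ :=
  s * μ (i + 1) / ((1 - s) * μ i + s * μ (i + 1))

/-- The parametrization of the `i`-th edge in the Klein model with weights `μ`. -/
def chord (θ : ℤ → ℝ) (μ : ℤ → ℝ) (i : ℤ) (s : ℝ) : ℂ :=
  ((1 - chordParam μ i s : ℝ) : ℂ) * pt θ i + (chordParam μ i s : ℂ) * pt θ (i + 1)

/-- The parametrization of the boundary of the polygon in the Klein model with weights `μ`. -/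
def perimeter (θ : ℤ → ℝ) (μ : ℤ → ℝ) (x : ℝ) : ℂ := chord θ μ ⌊x⌋ (Int.fract x)

section weights

variable {θ μ : ℤ → ℝ}

lemma chord_zero (i : ℤ) : chord θ μ i 0 = pt θ i := by
  simp [chord, chordParam]

lemma perimeter_intCast (i : ℤ) : perimeter θ μ i = pt θ i := by
  simp [perimeter, chord_zero]

variable (hμ : ∀ i, 0 < μ i)
include hμ

lemma weight_pos (i : ℤ) {s : ℝ} (h0 : 0 ≤ s) (h1 : s ≤ 1) :
    0 < (1 - s) * μ i + s * μ (i + 1) := by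
  have a := hμ i
  have b := hμ (i + 1)
  rcases h0.eq_or_lt with h | h
  · rw [← h]; simpa using a
  · have := mul_pos h b
    have := mul_nonneg (sub_nonneg.2 h1) a.le
    linarith

lemma chord_one (i : ℤ) : chord θ μ i 1 = pt θ (i + 1) := by
  simp [chord, chordParam, (hμ (i + 1)).ne']

lemma chordParam_nonneg (i : ℤ) {s : ℝ} (h0 : 0 ≤ s) (h1 : s ≤ 1) : 0 ≤ chordParam μ i s :=
  div_nonneg (mul_nonneg h0 (hμ _).le) (weight_pos hμ i h0 h1).le

lemma one_sub_chordParam (i : ℤ) {s : ℝ} (h0 : 0 ≤ s) (h1 : s ≤ 1) :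
    1 - chordParam μ i s = (1 - s) * μ i / ((1 - s) * μ i + s * μ (i + 1)) := by
  have := (weight_pos hμ i h0 h1).ne'
  rw [chordParam, eq_div_iff this, sub_mul, div_mul_cancel₀ _ this]
  ring

lemma chordParam_le_one (i : ℤ) {s : ℝ} (h0 : 0 ≤ s) (h1 : s ≤ 1) : chordParam μ i s ≤ 1 := by
  have : 0 ≤ 1 - chordParam μ i s := by
    rw [one_sub_chordParam hμ i h0 h1]
    exact div_nonneg (mul_nonneg (sub_nonneg.2 h1) (hμ _).le) (weight_pos hμ i h0 h1).le
  linarith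

lemma continuousOn_chord (i : ℤ) : ContinuousOn (chord θ μ i) (Icc 0 1) := by
  have h : ContinuousOn (chordParam μ i) (Icc 0 1) := by
    unfold chordParam
    refine ContinuousOn.div (by fun_prop) (by fun_prop) fun s hs => ?_
    exact (weight_pos hμ i hs.1 hs.2).ne'
  unfold chord
  exact ((continuous_ofReal.comp_continuousOn (continuousOn_const.sub h)).mul continuousOn_const).add
    ((continuous_ofReal.comp_continuousOn h).mul continuousOn_const)

lemma perimeter_eq {i : ℤ} {x : ℝ} (h0 : (i : ℝ) ≤ x) (h1 : x ≤ i + 1) :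
    perimeter θ μ x = chord θ μ i (x - i) := by
  rcases h1.eq_or_lt with h | h
  · have : x = ((i + 1 : ℤ) : ℝ) := by rw [h]; push_cast; ring
    rw [this, perimeter_intCast]
    push_cast
    rw [add_sub_cancel_left, chord_one hμ]
  · have : ⌊x⌋ = i := Int.floor_eq_iff.2 ⟨h0, h⟩
    rw [perimeter, Int.fract, this]

lemma perimeter_add {i : ℤ} {s : ℝ} (h0 : 0 ≤ s) (h1 : s ≤ 1) :
    perimeter θ μ (i + s) = chord θ μ i s := by
  rw [perimeter_eq hμ (i := i) (by linarith) (by linarith), add_sub_cancel_left]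

lemma continuous_perimeter : Continuous (perimeter θ μ) := by
  have hlf : LocallyFinite fun i : ℤ => Icc (i : ℝ) (i + 1) := by
    intro x
    refine ⟨Ioo (x - 1) (x + 1), Ioo_mem_nhds (by linarith) (by linarith), ?_⟩
    refine (finite_Icc (⌊x⌋ - 3) (⌊x⌋ + 3)).subset ?_
    rintro i ⟨y, ⟨h1, h2⟩, h3, h4⟩
    have a := Int.floor_le x
    have b := Int.lt_floor_add_one x
    constructor
    · have : ((⌊x⌋ - 3 : ℤ) : ℝ) ≤ i := by push_cast; linarith
      exact_mod_cast this
    · have : (i : ℝ) ≤ ((⌊x⌋ + 3 : ℤ) : ℝ) := by push_cast; linarith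
      exact_mod_cast this
  refine hlf.continuous ?_ (fun _ => isClosed_Icc) fun i => ?_
  · exact eq_univ_of_forall fun x => mem_iUnion.2
      ⟨⌊x⌋, Int.floor_le x, (Int.lt_floor_add_one x).le⟩
  · refine ((continuousOn_chord (θ := θ) hμ i).comp (f := fun x : ℝ => x - i)
      (by fun_prop) fun x hx => ?_).congr fun x hx => perimeter_eq hμ hx.1 hx.2
    exact ⟨by linarith [hx.1], by linarith [hx.2]⟩

end weights

lemma norm_sub_circle_sq_eq_klein (z : ℂ) (p : Circle) :
    ‖z - p‖ ^ 2 = (1 + ‖z‖ ^ 2) * (1 - (klein z * conj (p : ℂ)).re) := by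
  have h : (0 : ℝ) < 1 + ‖z‖ ^ 2 := by positivity
  rw [norm_sub_circle_sq, klein, mul_assoc, Complex.re_ofReal_mul]
  field_simp

namespace IsMarking

variable {k : ℕ} {θ μ : ℤ → ℝ} (m : IsMarking k θ) (hμ : ∀ i, 0 < μ i)
include m

omit m in
lemma edgeKside_pt_left (i : ℤ) : edgeKside θ i (pt θ i) = 0 := by
  have := side_left (θ i) (θ (i + 1))
  rw [side_eq_two_mul_kside _ _ (Circle.norm_coe _)] at this
  have h2 : kside (θ i) (θ (i + 1)) (Circle.exp (θ i)) = 0 := by linarith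
  exact h2

omit m in
lemma edgeKside_pt_right (i : ℤ) : edgeKside θ i (pt θ (i + 1)) = 0 := by
  have := side_right (θ i) (θ (i + 1))
  rw [side_eq_two_mul_kside _ _ (Circle.norm_coe _)] at this
  have h2 : kside (θ i) (θ (i + 1)) (Circle.exp (θ (i + 1))) = 0 := by linarith
  exact h2

omit m in
lemma edgeKside_chord (i : ℤ) (s : ℝ) : edgeKside θ i (chord θ μ i s) = 0 := by
  rw [edgeKside, chord, kside_combo _ _ _ _ (by ring)]
  have e1 := edgeKside_pt_left (θ := θ) i
  have e2 := edgeKside_pt_right (θ := θ) i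
  rw [edgeKside] at e1 e2
  rw [e1, e2]; ring

/-- The position of a point of an edge in terms of its distances to the endpoints. -/
lemma norm_sub_sq_of_klein_eq {i : ℤ} {t : ℝ} {z : ℂ}
    (h : klein z = ((1 - t : ℝ) : ℂ) * pt θ i + (t : ℂ) * pt θ (i + 1)) :
    ∃ D > 0, ‖z - pt θ i‖ ^ 2 = D * t ∧ ‖z - pt θ (i + 1)‖ ^ 2 = D * (1 - t) := by
  set p := pt θ i
  set q := pt θ (i + 1)
  have hp : (p : ℂ) * conj (p : ℂ) = 1 := by rw [mul_conj, normSq_eq_norm_sq, p.norm_coe]; simp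
  have hq : (q : ℂ) * conj (q : ℂ) = 1 := by rw [mul_conj, normSq_eq_norm_sq, q.norm_coe]; simp
  have hD : 0 < 1 - ((p : ℂ) * conj (q : ℂ)).re := by
    have h1 := norm_sub_circle_sq (p : ℂ) q
    rw [p.norm_coe] at h1
    have h2 : 0 < ‖(p : ℂ) - q‖ ^ 2 := by
      have : (p : ℂ) - q ≠ 0 := sub_ne_zero.2 fun h => m.pt_succ_ne i (Circle.ext h)
      positivity
    linarith
  have hs : ((q : ℂ) * conj (p : ℂ)).re = ((p : ℂ) * conj (q : ℂ)).re := by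
    rw [← conj_re, map_mul, conj_conj, mul_comm]
  have hz : (0 : ℝ) < 1 + ‖z‖ ^ 2 := by positivity
  refine ⟨(1 + ‖z‖ ^ 2) * (1 - ((p : ℂ) * conj (q : ℂ)).re), mul_pos hz hD, ?_, ?_⟩
  · have e : (((1 - t : ℝ) : ℂ) * p + (t : ℂ) * q) * conj (p : ℂ) =
        ((1 - t : ℝ) : ℂ) * 1 + (t : ℂ) * (q * conj (p : ℂ)) := by rw [← hp]; ring
    rw [norm_sub_circle_sq_eq_klein, h, e, add_re, re_ofReal_mul, re_ofReal_mul, hs, one_re]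
    ring
  · have e : (((1 - t : ℝ) : ℂ) * p + (t : ℂ) * q) * conj (q : ℂ) =
        ((1 - t : ℝ) : ℂ) * (p * conj (q : ℂ)) + (t : ℂ) * 1 := by rw [← hq]; ring
    rw [norm_sub_circle_sq_eq_klein, h, e, add_re, re_ofReal_mul, re_ofReal_mul, one_re]
    ring

lemma exists_klein_eq {i : ℤ} {z : ℂ} (hz : ‖z‖ < 1) (h : edgeSide θ i z = 0) :
    ∃ t : ℝ, klein z = ((1 - t : ℝ) : ℂ) * pt θ i + (t : ℂ) * pt θ (i + 1) := by
  obtain ⟨s, t, -, -, hst, h⟩ := exists_combo_of_kside_eq_zero (m.lt_succ i) (m.succ_lt_two_pi i)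
    (norm_klein_lt hz).le (side_eq_zero_iff_kside.1 h)
  exact ⟨t, by rw [h, ← hst, add_sub_cancel_right]; rfl⟩

include hμ

/-- A characterization of the points on an edge with a given parameter. -/
lemma klein_eq_chord_iff {i : ℤ} {z : ℂ} (hz : ‖z‖ < 1) (h : edgeSide θ i z = 0) {s : ℝ}
    (h0 : 0 ≤ s) (h1 : s ≤ 1) : klein z = chord θ μ i s ↔
      μ i * ‖z - pt θ i‖ ^ 2 * (1 - s) = μ (i + 1) * ‖z - pt θ (i + 1)‖ ^ 2 * s := by
  have hw := weight_pos hμ i h0 h1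
  constructor
  · intro he
    obtain ⟨D, hD, e1, e2⟩ := m.norm_sub_sq_of_klein_eq he
    rw [e1, e2, one_sub_chordParam hμ i h0 h1, chordParam]
    field_simp
  · intro he
    obtain ⟨t, ht⟩ := m.exists_klein_eq hz h
    obtain ⟨D, hD, e1, e2⟩ := m.norm_sub_sq_of_klein_eq ht
    have : t = chordParam μ i s := by
      rw [chordParam, eq_div_iff hw.ne']
      rw [e1, e2] at he
      have := mul_left_cancel₀ hD.ne' (show D * (μ i * t * (1 - s)) =
        D * (μ (i + 1) * (1 - t) * s) by linear_combination he)
      linear_combination this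
    rw [ht, this, chord]

lemma norm_chord_lt (i : ℤ) {s : ℝ} (h0 : 0 < s) (h1 : s < 1) : ‖chord θ μ i s‖ < 1 := by
  have hw := weight_pos hμ i h0.le h1.le
  refine norm_combo_unit_lt (pt θ i).norm_coe (pt θ (i + 1)).norm_coe
      (fun h => m.pt_succ_ne i (Circle.ext h)) ?_ ?_ (by ring)
  · rw [one_sub_chordParam hμ i h0.le h1.le]
    exact div_pos (mul_pos (sub_pos.2 h1) (hμ _)) hw
  · exact div_pos (mul_pos h0 (hμ _)) hw

lemma norm_perimeter_lt_iff {x : ℝ} : ‖perimeter θ μ x‖ < 1 ↔ ∀ i : ℤ, x ≠ i := by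
  constructor
  · rintro h i rfl
    rw [perimeter_intCast, Circle.norm_coe] at h
    exact h.false
  · intro h
    refine m.norm_chord_lt hμ _ (lt_of_le_of_ne (Int.fract_nonneg x) fun h0 => ?_)
      (Int.fract_lt_one x)
    exact h ⌊x⌋ (by rw [Int.fract] at h0; linarith)

lemma exists_perimeter_eq {i : ℤ} {z : ℂ} (hz : ‖z‖ < 1) (h : edgeSide θ i z = 0) :
    ∃ s : ℝ, 0 ≤ s ∧ s ≤ 1 ∧ klein z = chord θ μ i s := by
  have hne : ∀ p : Circle, 0 < ‖z - p‖ ^ 2 := fun p => by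
    have : z - p ≠ 0 := fun h => by
      rw [sub_eq_zero.1 h, p.norm_coe] at hz
      exact hz.false
    positivity
  have a := mul_pos (hμ i) (hne (pt θ i))
  have b := mul_pos (hμ (i + 1)) (hne (pt θ (i + 1)))
  have h0 : 0 ≤ μ i * ‖z - pt θ i‖ ^ 2 /
    (μ i * ‖z - pt θ i‖ ^ 2 + μ (i + 1) * ‖z - pt θ (i + 1)‖ ^ 2) := by positivity
  have h1 : μ i * ‖z - pt θ i‖ ^ 2 /
    (μ i * ‖z - pt θ i‖ ^ 2 + μ (i + 1) * ‖z - pt θ (i + 1)‖ ^ 2) ≤ 1 :=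
    (div_le_one (by positivity)).2 (by linarith)
  refine ⟨_, h0, h1, (m.klein_eq_chord_iff hμ hz h h0 h1).2 ?_⟩
  field_simp
  ring

lemma chord_injective (i : ℤ) {s s' : ℝ} (h0 : 0 < s) (h1 : s < 1) (h0' : 0 < s')
    (h1' : s' < 1) (h : chord θ μ i s = chord θ μ i s') : s = s' := by
  have hw := m.norm_chord_lt hμ i h0 h1
  have hz := norm_kleinInv_lt hw
  have hk := klein_kleinInv hw.le
  have he : edgeSide θ i (kleinInv (chord θ μ i s)) = 0 := by
    rw [edgeSide, side_eq_zero_iff_kside, hk]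
    exact edgeKside_chord i s
  have e1 := (m.klein_eq_chord_iff hμ hz he h0.le h1.le).1 hk
  have e2 := (m.klein_eq_chord_iff hμ hz he h0'.le h1'.le).1 (hk.trans h)
  have hne : 0 < μ i * ‖kleinInv (chord θ μ i s) - pt θ i‖ ^ 2 := by
    refine mul_pos (hμ i) ?_
    have : kleinInv (chord θ μ i s) - pt θ i ≠ 0 := fun h => by
      rw [sub_eq_zero.1 h, Circle.norm_coe] at hz
      exact hz.false
    positivity
  refine mul_left_cancel₀ hne.ne' ?_
  linear_combination -s' * e1 + s * e2

omit hμ in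
lemma perimeter_add_mul (hk : ∀ i, μ (i + k) = μ i) (x : ℝ) (n : ℤ) :
    perimeter θ μ (x + n * k) = perimeter θ μ x := by
  have hp : Function.Periodic μ (k : ℤ) := hk
  have e : x + n * k = x + ((n * k : ℤ) : ℝ) := by push_cast; ring
  have e1 : ∀ j : ℤ, μ (j + n * k) = μ j := fun j => by
    simpa using hp.int_mul n j
  have e2 : ∀ j : ℤ, pt θ (j + n * k) = pt θ j := fun j =>
    m.pt_eq_iff.2 ⟨n, by ring⟩
  rw [e, perimeter, perimeter, Int.floor_add_intCast, Int.fract_add_intCast, chord, chord, chordParam,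
    chordParam, add_right_comm, e1, e1, e2, e2]

/-- The parametrization of the boundary is injective modulo its period. -/
lemma perimeter_eq_iff (hk3 : 3 ≤ k) (hk : ∀ i, μ (i + k) = μ i) {x y : ℝ} :
    perimeter θ μ x = perimeter θ μ y ↔ ∃ n : ℤ, x = y + n * k := by
  constructor
  swap
  · rintro ⟨n, rfl⟩
    exact m.perimeter_add_mul hk y n
  intro h
  by_cases hx : ∀ i : ℤ, x ≠ i
  · have hlt := (m.norm_perimeter_lt_iff hμ).2 hx
    have hlt' := hlt
    rw [h] at hlt'
    have hy := (m.norm_perimeter_lt_iff hμ).1 hlt'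
    have fr : ∀ x : ℝ, (∀ i : ℤ, x ≠ i) → 0 < Int.fract x := fun x hx =>
      lt_of_le_of_ne (Int.fract_nonneg x) fun h0 => hx ⌊x⌋ (by rw [Int.fract] at h0; linarith)
    have hij : pt θ ⌊x⌋ = pt θ ⌊y⌋ := by
      by_contra hne
      have h1 := m.edgeKside_pos_of_edge hk3 hne hlt'
        (edgeKside_chord (μ := μ) ⌊y⌋ (Int.fract y))
      rw [← h] at h1
      exact h1.ne' (edgeKside_chord (μ := μ) ⌊x⌋ (Int.fract x))
    obtain ⟨n, hn⟩ := m.pt_eq_iff.1 hij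
    refine ⟨n, ?_⟩
    have hfl : ⌊y + n * k⌋ = ⌊x⌋ := by
      have e : y + n * k = y + ((n * k : ℤ) : ℝ) := by push_cast; ring
      rw [e, Int.floor_add_intCast]
      linear_combination -hn
    have hfr : Int.fract (y + n * k) = Int.fract y := by
      have e : y + n * k = y + ((n * k : ℤ) : ℝ) := by push_cast; ring
      rw [e, Int.fract_add_intCast]
    have h2 := h.trans (m.perimeter_add_mul hk y n).symm
    rw [perimeter, perimeter, hfl] at h2
    have h3 := m.chord_injective hμ _ (fr x hx) (Int.fract_lt_one x) (by rw [hfr]; exact fr y hy)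
      (Int.fract_lt_one _) h2
    rw [← Int.floor_add_fract x, ← Int.floor_add_fract (y + n * k), hfl, h3]
  · push Not at hx
    obtain ⟨i, rfl⟩ := hx
    have hy : ¬ ∀ j : ℤ, y ≠ j := by
      rw [← m.norm_perimeter_lt_iff hμ, ← h, m.norm_perimeter_lt_iff hμ]
      exact fun h => h i rfl
    push Not at hy
    obtain ⟨j, rfl⟩ := hy
    rw [perimeter_intCast, perimeter_intCast] at h
    obtain ⟨n, hn⟩ := m.pt_eq_iff.1 (Circle.ext h)
    refine ⟨n, ?_⟩
    have : (i : ℝ) = ((j + n * k : ℤ) : ℝ) := by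
      rw [show i = j + n * k by linear_combination hn]
    rw [this]; push_cast; ring

end IsMarking

/-! ### Equivariance of the boundary parametrization -/

namespace IsFoldedPolygon

variable {Γ : Subgroup DiscAut} {k : ℕ} {c : ℤ} {θ : ℤ → ℝ} {g : ℤ → DiscAut}

/-- Weights at the ideal vertices that make the parametrization of the boundary equivariant. -/
def _root_.FuchsianMarkov.vertexWeight (θ : ℤ → ℝ) (g : ℤ → DiscAut) (i : ℤ) : ℝ :=
  (scale (g i) (pt θ i))⁻¹

omit Γ k c in
lemma _root_.FuchsianMarkov.vertexWeight_pos (i : ℤ) : 0 < vertexWeight θ g i :=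
  inv_pos.2 (scale_pos _ (pt θ i).norm_coe.le)

variable (m : IsFoldedPolygon Γ k c θ g)
include m

lemma vertexWeight_add (i : ℤ) : vertexWeight θ g (i + k) = vertexWeight θ g i := by
  rw [vertexWeight, m.piece_add, m.pt_eq_iff.2 (show (k : ℤ) ∣ i + k - i by simp), vertexWeight]

section

variable (hpar : ∀ i, scale (g (c - i) * g i) (pt θ i) = 1)
include hpar

/-- This is parabolicity of the vertex map, written with the chain rule for `scale`. -/
lemma vertexWeight_mul (i : ℤ) : vertexWeight θ g (c - i) * vertexWeight θ g i = 1 := by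
  have h := hpar i
  rw [scale_mul _ _ (pt θ i).norm_coe.le, ← coe_smul_circle, m.left] at h
  rw [vertexWeight, vertexWeight, ← mul_inv, h, inv_one]

/-- The pairing of edge c - 1 - i starts at the vertex to which `g i` sends its right end, and it is
the inverse of `g i`. So a single weight per vertex serves both adjacent edges. -/
lemma scale_piece_right (i : ℤ) : scale (g i) (pt θ (i + 1)) = (vertexWeight θ g (i + 1))⁻¹ := by
  have h := scale_inv_act (g (c - 1 - i)) (pt θ (c - 1 - i)).norm_coe.le
  rw [← coe_smul_circle, m.left, ← m.piece_pair, sub_sub_cancel,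
    show c - (c - 1 - i) = i + 1 by ring] at h
  rw [h]
  refine eq_inv_of_mul_eq_one_left ?_
  have := m.vertexWeight_mul hpar (i + 1)
  rwa [show c - (i + 1) = c - 1 - i by ring] at this

/-- The side pairings reflect the parametrization of the boundary. -/
lemma klein_act_piece {i : ℤ} {z : ℂ} (hz : ‖z‖ < 1) (h : edgeSide θ i z = 0) {s : ℝ}
    (h0 : 0 ≤ s) (h1 : s ≤ 1) (hs : klein z = chord θ (vertexWeight θ g) i s) :
    klein (act (g i) z) = chord θ (vertexWeight θ g) (c - 1 - i) (1 - s) := by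
  have hμ : ∀ i, 0 < vertexWeight θ g i := vertexWeight_pos
  -- The parameter is encoded by the ratio of weighted squared distances to the two ends. The
  -- pairing divides these distances by its scales there, which the weights compensate.
  rw [m.klein_eq_chord_iff hμ hz h h0 h1] at hs
  rw [m.klein_eq_chord_iff hμ (norm_act_lt _ hz) ((m.edgeSide_piece_eq_zero hz.le).2 h)
    (by linarith) (by linarith)]
  have l1 := m.left i
  have l2 := m.right i
  have w1 := m.vertexWeight_mul hpar i
  have w2 := m.vertexWeight_mul hpar (i + 1)
  rw [show c - (i + 1) = c - 1 - i by ring] at w2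
  rw [show c - 1 - i + 1 = c - i by ring, ← l1, ← l2, coe_smul_circle, coe_smul_circle,
    norm_act_sub _ hz.le (Circle.norm_coe _).le, norm_act_sub _ hz.le (Circle.norm_coe _).le,
    m.scale_piece_right hpar]
  have e1 : scale (g i) (pt θ i) = (vertexWeight θ g i)⁻¹ := by rw [vertexWeight, inv_inv]
  rw [e1, eq_inv_of_mul_eq_one_left w1, eq_inv_of_mul_eq_one_left w2]
  have p1 := hμ i
  have p2 := hμ (i + 1)
  have p3 := scale_pos (g i) hz.le
  field_simp
  linear_combination -hs

lemma klein_act_piece_eq_perimeter {i : ℤ} {z : ℂ} (hz : ‖z‖ < 1) (h : edgeSide θ i z = 0) {x : ℝ}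
    (hx : klein z = perimeter θ (vertexWeight θ g) x) :
    klein (act (g i) z) = perimeter θ (vertexWeight θ g) (c - x) := by
  have hμ : ∀ i, 0 < vertexWeight θ g i := vertexWeight_pos
  obtain ⟨s, h0, h1, hs⟩ := m.exists_perimeter_eq hμ hz h
  rw [m.klein_act_piece hpar hz h h0 h1 hs]
  rw [hs, ← perimeter_add hμ h0 h1, m.perimeter_eq_iff hμ m.three_le m.vertexWeight_add] at hx
  obtain ⟨n, hn⟩ := hx
  rw [← perimeter_add hμ (by linarith) (by linarith),
    m.perimeter_eq_iff hμ m.three_le m.vertexWeight_add]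
  refine ⟨-n, ?_⟩
  push_cast
  linear_combination -hn

end

end IsFoldedPolygon

/-! ### Polar coordinates on the polygon -/

/-- The polygon in the Klein model. -/
def kleinPolygon (θ : ℤ → ℝ) : Set ℂ := {w : ℂ | ‖w‖ < 1 ∧ ∀ j, 0 < edgeKside θ j w}

/-- Polar coordinates on the closed polygon in the Klein model. -/
structure IsPolarChart (k : ℕ) (θ μ : ℤ → ℝ) (ψ : ℝ × ℝ → ℂ) : Prop where
  continuous : Continuous ψ
  one : ∀ x, ψ (1, x) = perimeter θ μ x
  mem : ∀ {r x}, 0 ≤ r → r ≤ 1 → ψ (r, x) ∈ closure (kleinPolygon θ)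
  exists_eq : ∀ w ∈ closure (kleinPolygon θ), ∃ r x, 0 ≤ r ∧ r ≤ 1 ∧ ψ (r, x) = w
  eq_iff : ∀ {r x s y}, 0 ≤ r → 0 ≤ s →
    (ψ (r, x) = ψ (s, y) ↔ r = s ∧ (r = 0 ∨ ∃ n : ℤ, x = y + n * k))

lemma mul_eq_mul_iff_of_norm_eq_one {a b : ℂ} (ha : ‖a‖ = 1) (hb : ‖b‖ = 1) {r s : ℝ}
    (hr : 0 ≤ r) (hs : 0 ≤ s) : (r : ℂ) * a = s * b ↔ r = s ∧ (r = 0 ∨ a = b) := by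
  constructor
  · intro h
    have h1 := congrArg norm h
    rw [norm_mul, norm_mul, ha, hb, norm_real, norm_real, Real.norm_of_nonneg hr,
      Real.norm_of_nonneg hs, mul_one, mul_one] at h1
    refine ⟨h1, or_iff_not_imp_left.2 fun h0 => ?_⟩
    rw [← h1] at h
    exact mul_left_cancel₀ (ofReal_ne_zero.2 h0) h
  · rintro ⟨rfl, rfl | rfl⟩
    · simp
    · rfl

namespace IsMarking

variable {k : ℕ} {θ μ : ℤ → ℝ} (m : IsMarking k θ)
include m

lemma isOpen_kleinPolygon : IsOpen (kleinPolygon θ) := by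
  have : kleinPolygon θ = {w | ‖w‖ < 1} ∩ ⋂ j : Fin k, {w | 0 < edgeKside θ j w} := by
    ext w
    rw [mem_inter_iff, mem_iInter]
    exact and_congr_right fun hw => m.forall_iff (P := fun j => 0 < edgeKside θ j w)
      fun i j h => by rw [m.edgeKside_congr h (le_of_lt hw)]; exact id
  rw [this]
  exact (isOpen_lt continuous_norm continuous_const).inter
    (isOpen_iInter_of_finite fun j => isOpen_lt continuous_const (continuous_kside _ _))

lemma closure_kleinPolygon (hk : 3 ≤ k) :
    closure (kleinPolygon θ) = {w | ‖w‖ ≤ 1 ∧ ∀ j, 0 ≤ edgeKside θ j w} := by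
  refine Subset.antisymm (closure_minimal (fun w hw => ⟨hw.1.le, fun j => (hw.2 j).le⟩) ?_) ?_
  · rw [ofPred_and, ofPred_forall]
    exact (isClosed_le continuous_norm continuous_const).inter
      (isClosed_iInter fun j => isClosed_le continuous_const (continuous_kside _ _))
  · rintro w ⟨hw, h⟩
    obtain ⟨o, h1, h2⟩ := m.exists_klein_center hk
    have hlim : Tendsto (fun t : ℝ => ((1 - t : ℝ) : ℂ) * w + (t : ℂ) * o) (𝓝[>] 0) (𝓝 w) := by
      have hc : Continuous fun t : ℝ => ((1 - t : ℝ) : ℂ) * w + (t : ℂ) * o := by fun_prop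
      have := hc.tendsto 0
      simp only [sub_zero, ofReal_one, one_mul, ofReal_zero, zero_mul, add_zero] at this
      exact this.mono_left nhdsWithin_le_nhds
    refine mem_closure_of_tendsto hlim ?_
    filter_upwards [Ioo_mem_nhdsGT (zero_lt_one' ℝ)] with t ht
    refine ⟨norm_combo_lt hw h1 (by linarith [ht.2]) ht.1 (by ring), fun j => ?_⟩
    rw [edgeKside, kside_combo _ _ _ _ (by ring)]
    have a := h j
    have b := h2 j
    rw [edgeKside] at a b
    have := mul_nonneg (by linarith [ht.2] : 0 ≤ 1 - t) a
    have := mul_pos ht.1 b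
    linarith

lemma perimeter_mem_closure (hk : 3 ≤ k) (hμ : ∀ i, 0 < μ i) (x : ℝ) :
    perimeter θ μ x ∈ closure (kleinPolygon θ) := by
  have h0 := chordParam_nonneg hμ ⌊x⌋ (Int.fract_nonneg x) (Int.fract_lt_one x).le
  have h1 := chordParam_le_one hμ ⌊x⌋ (Int.fract_nonneg x) (Int.fract_lt_one x).le
  rw [m.closure_kleinPolygon hk]
  constructor
  · by_cases h : ∀ i : ℤ, x ≠ i
    · exact ((m.norm_perimeter_lt_iff hμ).2 h).le
    · push Not at h
      obtain ⟨i, rfl⟩ := h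
      rw [perimeter_intCast, Circle.norm_coe]
  · intro j
    rw [edgeKside, perimeter, chord, kside_combo _ _ _ _ (by ring)]
    exact add_nonneg (mul_nonneg (by linarith) (m.edgeKside_pt _ j).1)
      (mul_nonneg h0 (m.edgeKside_pt _ j).1)

lemma frontier_kleinPolygon (hk : 3 ≤ k) (hμ : ∀ i, 0 < μ i) :
    frontier (kleinPolygon θ) = range (perimeter θ μ) := by
  rw [m.isOpen_kleinPolygon.frontier_eq]
  apply Subset.antisymm
  · rintro w ⟨hw, hw'⟩
    rw [m.closure_kleinPolygon hk] at hw
    rcases hw.1.lt_or_eq with hn | hn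
    · have : ∃ j, edgeKside θ j w = 0 := by
        by_contra! h
        exact hw' ⟨hn, fun j => lt_of_le_of_ne (hw.2 j) (h j).symm⟩
      obtain ⟨j, hj⟩ := this
      have hz := norm_kleinInv_lt hn
      have hk := klein_kleinInv hn.le
      obtain ⟨s, h0, h1, hs⟩ := m.exists_perimeter_eq hμ (i := j) hz (by
        rw [edgeSide, side_eq_zero_iff_kside, hk]; exact hj)
      exact ⟨j + s, by rw [perimeter_add hμ h0 h1, ← hs, hk]⟩
    · obtain ⟨i, hi⟩ := m.exists_eq_pt (p := ⟨w, mem_sphere_zero_iff_norm.2 hn⟩) fun j => by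
        change 0 ≤ side _ _ w
        rw [side_eq_two_mul_kside _ _ hn]
        exact mul_nonneg zero_le_two (hw.2 j)
      exact ⟨i, by rw [perimeter_intCast, ← hi]⟩
  · rintro _ ⟨x, rfl⟩
    refine ⟨m.perimeter_mem_closure hk hμ x, fun h => ?_⟩
    exact (h.2 ⌊x⌋).ne' (edgeKside_chord _ _)

/-- A homeomorphism of the plane carries the bounded convex polygon and its frontier to the unit
disc and circle; there the boundary curve is coned from the origin and pulled back. -/
lemma exists_isPolarChart (hk3 : 3 ≤ k) (hμ : ∀ i, 0 < μ i) (hk : ∀ i, μ (i + k) = μ i) :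
    ∃ ψ : ℝ × ℝ → ℂ, IsPolarChart k θ μ ψ := by
  have hconv : Convex ℝ (kleinPolygon θ) := convex_klein_polygon
  have hne : (interior (kleinPolygon θ)).Nonempty := by
    rw [m.isOpen_kleinPolygon.interior_eq]
    obtain ⟨o, h1, h2⟩ := m.exists_klein_center hk3
    exact ⟨o, h1, h2⟩
  have hbd : Bornology.IsBounded (kleinPolygon θ) :=
    Metric.isBounded_ball.subset fun w hw => mem_ball_zero_iff.2 hw.1
  obtain ⟨h, -, hcl, hfr⟩ :=
    exists_homeomorph_image_interior_closure_frontier_eq_unitBall hconv hne hbd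
  have hmem : ∀ w, w ∈ closure (kleinPolygon θ) ↔ ‖h w‖ ≤ 1 := fun w => by
    rw [← mem_closedBall_zero_iff, ← hcl, h.injective.mem_set_image]
  rw [m.frontier_kleinPolygon hk3 hμ] at hfr
  have hT : ∀ x, ‖h (perimeter θ μ x)‖ = 1 := fun x => by
    rw [← mem_sphere_zero_iff_norm, ← hfr]
    exact mem_image_of_mem _ (mem_range_self x)
  refine ⟨fun q => h.symm ((q.1 : ℂ) * h (perimeter θ μ q.2)), ?_, ?_, ?_, ?_, ?_⟩
  · exact h.symm.continuous.comp ((continuous_ofReal.comp continuous_fst).mul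
      (h.continuous.comp ((continuous_perimeter hμ).comp continuous_snd)))
  · intro x
    simp
  · intro r x h0 h1
    rw [hmem, h.apply_symm_apply, norm_mul, hT, norm_real, Real.norm_of_nonneg h0, mul_one]
    exact h1
  · intro w hw
    rw [hmem] at hw
    rcases eq_or_ne (h w) 0 with h0 | h0
    · refine ⟨0, 0, le_rfl, zero_le_one, ?_⟩
      simp only [ofReal_zero, zero_mul]
      rw [← h0, h.symm_apply_apply]
    · have hn : ‖h w‖ ≠ 0 := norm_ne_zero_iff.2 h0
      have : h w / ‖h w‖ ∈ Metric.sphere (0 : ℂ) 1 := by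
        rw [mem_sphere_zero_iff_norm, norm_div, norm_real, norm_norm, div_self hn]
      rw [← hfr] at this
      obtain ⟨_, ⟨x, rfl⟩, hx⟩ := this
      refine ⟨‖h w‖, x, norm_nonneg _, hw, ?_⟩
      simp only [hx]
      rw [mul_div_cancel₀ _ (ofReal_ne_zero.2 hn), h.symm_apply_apply]
  · intro r x s y hr hs
    rw [h.symm.injective.eq_iff, mul_eq_mul_iff_of_norm_eq_one (hT x) (hT y) hr hs,
      h.injective.eq_iff, m.perimeter_eq_iff hμ hk3 hk]

end IsMarking

/-! ### Folding the closed disc along the real axis -/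

/-- The Joukowski map from the closed disc onto the sphere; it identifies conjugate points of the
unit circle. -/
def joukowski : ℂ → OnePoint ℂ := Function.update (fun w => ((w + w⁻¹ : ℂ) : OnePoint ℂ)) 0 OnePoint.infty

lemma joukowski_zero : joukowski 0 = OnePoint.infty := Function.update_self ..

lemma joukowski_of_ne {w : ℂ} (hw : w ≠ 0) : joukowski w = ((w + w⁻¹ : ℂ) : OnePoint ℂ) :=
  Function.update_of_ne hw ..

lemma continuous_joukowski : Continuous joukowski := by
  rw [continuous_iff_continuousAt]
  intro w
  rcases eq_or_ne w 0 with rfl | hw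
  · rw [joukowski, continuousAt_update_same]
    refine OnePoint.tendsto_coe_infty.comp ?_
    rw [coclosedCompact_eq_cocompact, ← Metric.cobounded_eq_cocompact,
      ← tendsto_norm_atTop_iff_cobounded]
    have h1 : Tendsto (fun w : ℂ => ‖w⁻¹‖) (𝓝[≠] 0) atTop :=
      tendsto_norm_atTop_iff_cobounded.2 tendsto_inv₀_nhdsNE_zero
    have h2 : Tendsto (fun w : ℂ => -‖w‖) (𝓝[≠] 0) (𝓝 0) := by
      have : Continuous fun w : ℂ => -‖w‖ := by fun_prop
      have := this.tendsto 0
      simp only [norm_zero, neg_zero] at this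
      exact this.mono_left nhdsWithin_le_nhds
    refine tendsto_atTop_mono (fun w => ?_) (h1.atTop_add h2)
    have := norm_sub_le_norm_add w⁻¹ w
    rw [add_comm w]
    linarith
  · rw [joukowski, continuousAt_update_of_ne hw]
    exact OnePoint.continuous_coe.continuousAt.comp
      (continuousAt_id.add (continuousAt_inv₀ hw))

/-- A finite value ζ is attained at the two roots of w² - ζw + 1, which are mutually inverse, so one
of them lies in the closed disc. -/
lemma exists_joukowski_eq (ζ : OnePoint ℂ) : ∃ w : ℂ, ‖w‖ ≤ 1 ∧ joukowski w = ζ := by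
  induction ζ using OnePoint.rec with
  | infty => exact ⟨0, by simp, joukowski_zero⟩
  | coe ζ =>
    obtain ⟨s, hs⟩ := IsAlgClosed.exists_pow_nat_eq (ζ ^ 2 - 4) (n := 2) (by norm_num)
    set w := (ζ + s) / 2 with hw
    have hwq : w * (ζ - w) = 1 := by rw [hw]; linear_combination (-1 / 4) * hs
    have h0 : w ≠ 0 := left_ne_zero_of_mul_eq_one hwq
    have hinv : w⁻¹ = ζ - w := inv_eq_of_mul_eq_one_right hwq
    rcases le_total ‖w‖ 1 with h | h
    · exact ⟨w, h, by rw [joukowski_of_ne h0, hinv, add_sub_cancel]⟩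
    · refine ⟨w⁻¹, by rw [norm_inv]; exact inv_le_one_of_one_le₀ h, ?_⟩
      rw [joukowski_of_ne (inv_ne_zero h0), inv_inv, hinv, sub_add_cancel]

lemma joukowski_conj {w : ℂ} (hw : ‖w‖ = 1) : joukowski (conj w) = joukowski w := by
  have h0 : w ≠ 0 := norm_ne_zero_iff.1 (by rw [hw]; exact one_ne_zero)
  have h1 : conj w = w⁻¹ := (inv_eq_conj hw).symm
  rw [h1, joukowski_of_ne h0, joukowski_of_ne (inv_ne_zero h0), inv_inv, add_comm]

/-- For non-zero points, equality of values means (w - v)(wv - 1) = 0, and in the closed disc wv = 1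
forces both points onto the circle. -/
lemma joukowski_eq_iff {w v : ℂ} (hw : ‖w‖ ≤ 1) (hv : ‖v‖ ≤ 1) :
    joukowski w = joukowski v ↔ w = v ∨ ‖w‖ = 1 ∧ v = conj w := by
  constructor
  · intro h
    rcases eq_or_ne w 0 with rfl | hw0
    · rcases eq_or_ne v 0 with rfl | hv0
      · exact Or.inl rfl
      · rw [joukowski_zero, joukowski_of_ne hv0] at h
        exact absurd h (OnePoint.infty_ne_coe _)
    · rcases eq_or_ne v 0 with rfl | hv0
      · rw [joukowski_zero, joukowski_of_ne hw0] at h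
        exact absurd h (OnePoint.coe_ne_infty _)
      · rw [joukowski_of_ne hw0, joukowski_of_ne hv0, OnePoint.coe_eq_coe] at h
        have : (w - v) * (w * v - 1) = 0 := by
          field_simp at h
          linear_combination h
        rcases mul_eq_zero.1 this with h1 | h1
        · exact Or.inl (sub_eq_zero.1 h1)
        · right
          rw [sub_eq_zero] at h1
          have hn := congrArg norm h1
          rw [norm_mul, norm_one] at hn
          have : ‖w‖ = 1 := by nlinarith [norm_nonneg w, norm_nonneg v]
          exact ⟨this, by rw [← inv_eq_conj this]; exact eq_inv_of_mul_eq_one_right h1⟩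
  · rintro (rfl | ⟨h1, rfl⟩)
    · rfl
    · exact (joukowski_conj h1).symm

/-- The Klein model as a homeomorphism of discs. -/
def kleinHomeo : Metric.ball (0 : ℂ) 1 ≃ₜ UnitDisc where
  toFun w := ofKlein w (mem_ball_zero_iff.1 w.2)
  invFun z := ⟨klein z, mem_ball_zero_iff.2 (norm_klein_lt z.norm_lt_one)⟩
  left_inv w := Subtype.ext (klein_kleinInv (mem_ball_zero_iff.1 w.2).le)
  right_inv z := UnitDisc.coe_injective (kleinInv_klein z.norm_lt_one)
  continuous_toFun := UnitDisc.isEmbedding_coe.continuous_iff.2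
    (continuous_kleinInv.comp continuous_subtype_val)
  continuous_invFun := (continuous_klein.comp UnitDisc.continuous_coe).subtype_mk _

/-- The points of the unit circle that correspond to the boundary points of the polygon. -/
def anglePoint (k : ℕ) (c : ℤ) (x : ℝ) : ℂ := Circle.exp (2 * π * (x - c / 2) / k)

section anglePoint

variable {k : ℕ} {c : ℤ}

lemma continuous_anglePoint : Continuous (anglePoint k c) := by
  unfold anglePoint; fun_prop

lemma norm_anglePoint (x : ℝ) : ‖anglePoint k c x‖ = 1 := Circle.norm_coe _

/-- The shift by c/2 in `anglePoint` is chosen to turn the boundary reflection into complex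
conjugation. -/
lemma anglePoint_sub (x : ℝ) : anglePoint k c (c - x) = conj (anglePoint k c x) := by
  rw [anglePoint, anglePoint, ← Circle.coe_inv_eq_conj, ← Circle.exp_neg]
  congr 2; ring

lemma anglePoint_eq_iff (hk : 3 ≤ k) {x y : ℝ} :
    anglePoint k c x = anglePoint k c y ↔ ∃ n : ℤ, x = y + n * k := by
  have hk0 : (k : ℝ) ≠ 0 := by
    have : k ≠ 0 := by omega
    exact_mod_cast this
  have hpi := Real.pi_ne_zero
  rw [anglePoint, anglePoint, Circle.coe_inj, Circle.exp_eq_exp]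
  refine exists_congr fun n => ?_
  field_simp
  constructor <;> intro h <;> linarith

lemma exists_anglePoint_eq (hk : 3 ≤ k) {w : ℂ} (hw : ‖w‖ = 1) : ∃ x, anglePoint k c x = w := by
  have hk0 : (k : ℝ) ≠ 0 := by
    have : k ≠ 0 := by omega
    exact_mod_cast this
  have hpi := Real.pi_ne_zero
  obtain ⟨t, ht⟩ := Circle.exp_surjective ⟨w, mem_sphere_zero_iff_norm.2 hw⟩
  refine ⟨k * t / (2 * π) + c / 2, ?_⟩
  rw [anglePoint, show 2 * π * (k * t / (2 * π) + c / 2 - c / 2) / k = t by field_simp; ring, ht]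

lemma exists_mem_Icc_eq_add (hk : 3 ≤ k) (x : ℝ) : ∃ y ∈ Icc (0 : ℝ) k, ∃ n : ℤ, x = y + n * k := by
  have hk0 : (0 : ℝ) < k := by
    have : 0 < k := by omega
    exact_mod_cast this
  have h := toIcoMod_mem_Ico hk0 0 x
  refine ⟨toIcoMod hk0 0 x, ⟨h.1, by linarith [h.2]⟩, toIcoDiv hk0 0 x, ?_⟩
  have := toIcoMod_add_toIcoDiv_zsmul hk0 0 x
  rw [zsmul_eq_mul] at this
  exact this.symm

end anglePoint

lemma _root_.Topology.IsQuotientMap.nonempty_homeomorph {X Y Z : Type*} [TopologicalSpace X]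
    [TopologicalSpace Y] [TopologicalSpace Z] {f : X → Y} {g : X → Z}
    (hf : Topology.IsQuotientMap f) (hg : Topology.IsQuotientMap g)
    (h : ∀ a b, f a = f b ↔ g a = g b) : Nonempty (Y ≃ₜ Z) := by
  have hf' : Topology.IsQuotientMap (⟨f, hf.continuous⟩ : C(X, Y)) := hf
  have hg' : Topology.IsQuotientMap (⟨g, hg.continuous⟩ : C(X, Z)) := hg
  have e : Setoid.ker (⟨f, hf.continuous⟩ : C(X, Y)) =
    Setoid.ker (⟨g, hg.continuous⟩ : C(X, Z)) := Setoid.ext h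
  have e1 := hf'.homeomorph
  rw [e] at e1
  exact ⟨e1.symm.trans hg'.homeomorph⟩

/-! ### The orbit space as a punctured sphere -/

namespace IsFoldedPolygon

variable {Γ : Subgroup DiscAut} {k : ℕ} {c : ℤ} {θ : ℤ → ℝ} {g : ℤ → DiscAut}
  (m : IsFoldedPolygon Γ k c θ g)
include m

lemma mem_closure_polygon_iff_klein {z : UnitDisc} :
    z ∈ closure (polygon θ) ↔ klein z ∈ closure (kleinPolygon θ) := by
  rw [m.mem_closure_polygon m.three_le, m.closure_kleinPolygon m.three_le]
  exact ⟨fun h => ⟨(norm_klein_lt z.norm_lt_one).le, fun j => side_nonneg_iff_kside.1 (h j)⟩,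
    fun h j => side_nonneg_iff_kside.2 (h.2 j)⟩

lemma ofKlein_mem_closure {w : ℂ} (hw : ‖w‖ < 1) (h : w ∈ closure (kleinPolygon θ)) :
    ofKlein w hw ∈ closure (polygon θ) := by
  rw [m.mem_closure_polygon_iff_klein, klein_ofKlein]
  exact h

lemma norm_polarChart_lt_iff {μ : ℤ → ℝ} {ψ : ℝ × ℝ → ℂ} (hψ : IsPolarChart k θ μ ψ) {r x : ℝ}
    (h0 : 0 ≤ r) (h1 : r ≤ 1) : ‖ψ (r, x)‖ < 1 ↔ ¬ (r = 1 ∧ ∃ i : ℤ, x = i) := by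
  have hmem := hψ.mem (x := x) h0 h1
  rw [m.closure_kleinPolygon m.three_le] at hmem
  constructor
  · rintro h ⟨rfl, i, rfl⟩
    rw [hψ.one, perimeter_intCast, Circle.norm_coe] at h
    exact h.false
  · refine fun h => lt_of_le_of_ne hmem.1 fun hn => h ?_
    obtain ⟨i, hi⟩ := m.exists_eq_pt (p := ⟨ψ (r, x), mem_sphere_zero_iff_norm.2 hn⟩) fun j => by
      change 0 ≤ side _ _ (ψ (r, x))
      rw [side_eq_two_mul_kside _ _ hn]
      exact mul_nonneg zero_le_two (hmem.2 j)
    have h2 : ψ (r, x) = ψ (1, i) := by rw [hψ.one, perimeter_intCast, ← hi]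
    obtain ⟨rfl, h3 | ⟨n, hn⟩⟩ := (hψ.eq_iff h0 zero_le_one).1 h2
    · exact absurd h3 one_ne_zero
    · exact ⟨rfl, i + n * k, by rw [hn]; push_cast; ring⟩

section

variable (hpar : ∀ i, scale (g (c - i) * g i) (pt θ i) = 1)
include hpar

/-- Points of the closed polygon are equivalent if and only if the folded disc identifies them. -/
lemma joukowski_eq_iff_exists_smul {ψ : ℝ × ℝ → ℂ} (hψ : IsPolarChart k θ (vertexWeight θ g) ψ)
    {r x s y : ℝ} (hr0 : 0 ≤ r) (hr1 : r ≤ 1) (hs0 : 0 ≤ s) (hs1 : s ≤ 1) (hr : ‖ψ (r, x)‖ < 1)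
    (hs : ‖ψ (s, y)‖ < 1) :
    joukowski (r * anglePoint k c x) = joukowski (s * anglePoint k c y) ↔
      ∃ γ : Γ, γ • ofKlein (ψ (r, x)) hr = ofKlein (ψ (s, y)) hs := by
  have hμ : ∀ i, 0 < vertexWeight θ g i := vertexWeight_pos
  have hk := m.three_le
  have hnorm : ∀ {r : ℝ} (x : ℝ), 0 ≤ r → ‖(r : ℂ) * anglePoint k c x‖ = r := fun x h => by
    rw [norm_mul, norm_anglePoint, norm_real, Real.norm_of_nonneg h, mul_one]
  have hsame : (r : ℂ) * anglePoint k c x = s * anglePoint k c y ↔ ψ (r, x) = ψ (s, y) := by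
    rw [mul_eq_mul_iff_of_norm_eq_one (norm_anglePoint x) (norm_anglePoint y) hr0 hs0,
      hψ.eq_iff hr0 hs0, anglePoint_eq_iff hk]
  have hper : ∀ x y, perimeter θ (vertexWeight θ g) x = perimeter θ (vertexWeight θ g) y ↔
      anglePoint k c x = anglePoint k c y := fun x y => by
    rw [m.perimeter_eq_iff hμ hk m.vertexWeight_add, anglePoint_eq_iff hk]
  rw [joukowski_eq_iff (by rw [hnorm x hr0]; exact hr1) (by rw [hnorm y hs0]; exact hs1), hsame,
    hnorm x hr0]
  constructor
  · rintro (h | ⟨rfl, h⟩)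
    · refine ⟨1, ?_⟩
      rw [one_smul]
      congr 1
    · rw [ofReal_one, one_mul, ← anglePoint_sub] at h
      obtain ⟨rfl, h | h⟩ := (mul_eq_mul_iff_of_norm_eq_one (norm_anglePoint y)
        (norm_anglePoint (k := k) (c := c) (c - x)) hs0 zero_le_one).1 (by rw [h]; simp)
      · exact absurd h one_ne_zero
      have hx : klein (ofKlein (ψ (1, x)) hr) = perimeter θ (vertexWeight θ g) x := by
        rw [klein_ofKlein, hψ.one]
      have he : edgeSide θ ⌊x⌋ (ofKlein (ψ (1, x)) hr) = 0 := by
        rw [edgeSide, side_eq_zero_iff_kside, hx]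
        exact IsMarking.edgeKside_chord _ _
      -- The conjugate boundary point is reached by the pairing of the edge on which the parameter
      -- `x` lies.
      refine ⟨⟨g ⌊x⌋, m.piece_mem _⟩, ?_⟩
      have h2 := m.klein_act_piece_eq_perimeter hpar (UnitDisc.norm_lt_one _) he hx
      apply kleinHomeo.symm.injective
      apply Subtype.ext
      change klein (g ⌊x⌋ • ofKlein (ψ (1, x)) hr : UnitDisc) = klein (ofKlein (ψ (1, y)) hs)
      rw [coe_smul_disc, h2, klein_ofKlein, hψ.one, hper, h]
  · rintro ⟨⟨γ, hγ⟩, h⟩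
    change γ • ofKlein (ψ (r, x)) hr = ofKlein (ψ (s, y)) hs at h
    by_cases h1 : γ = 1
    · left
      rw [h1, one_smul] at h
      rw [← klein_ofKlein hr, h, klein_ofKlein]
    · right
      obtain ⟨i, hi, rfl⟩ := m.exists_piece_eq hγ h1 (m.ofKlein_mem_closure hr (hψ.mem hr0 hr1))
        (by rw [h]; exact m.ofKlein_mem_closure hs (hψ.mem hs0 hs1))
      obtain ⟨t, h0, h1, ht⟩ := m.exists_perimeter_eq hμ (UnitDisc.norm_lt_one _) hi
      rw [← perimeter_add hμ h0 h1] at ht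
      have h2 := m.klein_act_piece_eq_perimeter hpar (UnitDisc.norm_lt_one _) hi ht
      rw [← coe_smul_disc, h, klein_ofKlein, ← hψ.one, hψ.eq_iff hs0 zero_le_one] at h2
      rw [klein_ofKlein, ← hψ.one, hψ.eq_iff hr0 zero_le_one] at ht
      obtain ⟨rfl, h3⟩ := ht
      obtain ⟨rfl, h4⟩ := h2
      have h3 := h3.resolve_left one_ne_zero
      have h4 := h4.resolve_left one_ne_zero
      rw [← anglePoint_eq_iff (c := c) hk] at h3 h4
      refine ⟨rfl, ?_⟩
      rw [ofReal_one, one_mul, one_mul, h4, h3, anglePoint_sub]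

/-- The saturation is a locally finite union of closed translates. -/
lemma isClosed_image_mk {F : Set UnitDisc} (hF : IsClosed F) (hFR : F ⊆ closure (polygon θ)) :
    IsClosed ((Quotient.mk (MulAction.orbitRel Γ UnitDisc)) '' F) := by
  have hq : Topology.IsQuotientMap (Quotient.mk (MulAction.orbitRel Γ UnitDisc)) := isQuotientMap_quot_mk
  rw [← hq.isClosed_preimage]
  have : Quotient.mk (MulAction.orbitRel Γ UnitDisc) ⁻¹'
      (Quotient.mk (MulAction.orbitRel Γ UnitDisc) '' F) =
      ⋃ γ : Γ, smulHomeo (γ : DiscAut) '' F := by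
    ext z
    rw [mem_preimage, mem_image, mem_iUnion]
    constructor
    · rintro ⟨w, hw, h⟩
      obtain ⟨γ, hγ⟩ := Quotient.exact h.symm
      exact ⟨γ, w, hw, hγ⟩
    · rintro ⟨γ, w, hw, h⟩
      exact ⟨w, hw, (Quotient.sound ⟨γ, h⟩ : Quotient.mk (MulAction.orbitRel Γ UnitDisc) z = _).symm⟩
  rw [this]
  refine LocallyFinite.isClosed_iUnion
    ((m.locallyFinite_translates hpar).subset fun γ => image_mono hFR) fun γ => ?_
  exact (smulHomeo (γ : DiscAut)).isClosedMap _ hF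

/-- Both spaces are quotients of one subset of the rectangle of polar coordinates, with the same
fibres by `joukowski_eq_iff_exists_smul`. -/
lemma exists_homeomorph_punctured_sphere : ∃ P : Set (OnePoint ℂ), P.Finite ∧ P.Nonempty ∧
    Nonempty (MulAction.orbitRel.Quotient Γ UnitDisc ≃ₜ (Pᶜ : Set (OnePoint ℂ))) := by
  have hμ : ∀ i, 0 < vertexWeight θ g i := vertexWeight_pos
  have hk := m.three_le
  obtain ⟨ψ, hψ⟩ := m.exists_isPolarChart hk hμ m.vertexWeight_add
  set P : Set (OnePoint ℂ) := (fun i : ℤ => joukowski (anglePoint k c i)) '' Ico 0 k with hPdef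
  refine ⟨P, (finite_Ico _ _).image _, ⟨_, mem_image_of_mem _ ⟨le_rfl, by omega⟩⟩, ?_⟩
  -- Compactness of the full rectangle makes both maps on it closed, a property that survives
  -- restriction to the preimages left after deleting the vertices.
  let Q : Set (ℝ × ℝ) := Icc 0 1 ×ˢ Icc 0 (k : ℝ)
  have : CompactSpace Q := isCompact_iff_compactSpace.1 (isCompact_Icc.prod isCompact_Icc)
  let ψQ : Q → ℂ := fun q => ψ q
  let E : Q → OnePoint ℂ := fun q => joukowski (q.1.1 * anglePoint k c q.1.2)
  have cψ : Continuous ψQ := hψ.continuous.comp continuous_subtype_val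
  have cE : Continuous E := continuous_joukowski.comp (by
    have := continuous_anglePoint (k := k) (c := c)
    fun_prop)
  have hPE : E ⁻¹' Pᶜ = ψQ ⁻¹' Metric.ball 0 1 := by
    ext ⟨⟨r, x⟩, ⟨hr0, hr1⟩, hx⟩
    rw [mem_preimage, mem_preimage, mem_ball_zero_iff]
    change _ ↔ ‖ψ (r, x)‖ < 1
    rw [m.norm_polarChart_lt_iff hψ hr0 hr1, mem_compl_iff, not_iff_not]
    change joukowski (r * anglePoint k c x) ∈ P ↔ _
    constructor
    · rintro ⟨i, -, hi⟩
      have h1 : ‖(r : ℂ) * anglePoint k c x‖ ≤ 1 := by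
        rw [norm_mul, norm_anglePoint, norm_real, Real.norm_of_nonneg hr0, mul_one]; exact hr1
      have key : ∀ j : ℤ, (r : ℂ) * anglePoint k c x = anglePoint k c j → r = 1 ∧ ∃ i : ℤ, x = i := by
        intro j hj
        obtain ⟨rfl, h⟩ := (mul_eq_mul_iff_of_norm_eq_one (norm_anglePoint x)
          (norm_anglePoint (k := k) (c := c) j) hr0 zero_le_one).1 (by rw [hj]; simp)
        obtain ⟨n, hn⟩ := (anglePoint_eq_iff hk).1 (h.resolve_left one_ne_zero)
        exact ⟨rfl, j + n * k, by rw [hn]; push_cast; ring⟩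
      rcases (joukowski_eq_iff (norm_anglePoint _).le h1).1 hi with h | ⟨-, h⟩
      · exact key i h.symm
      · rw [← anglePoint_sub] at h
        exact key (c - i) (by rw [h]; push_cast; rfl)
    · rintro ⟨rfl, i, rfl⟩
      refine ⟨i % k, ⟨Int.emod_nonneg _ (by omega), Int.emod_lt_of_pos _ (by omega)⟩, ?_⟩
      rw [ofReal_one, one_mul]
      change joukowski _ = _
      congr 1
      rw [anglePoint_eq_iff hk]
      refine ⟨-(i / k), ?_⟩
      have : (i : ℝ) = ((i % k + k * (i / k) : ℤ) : ℝ) := by rw [Int.emod_add_mul_ediv]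
      rw [this]; push_cast; ring
  have sE : Function.Surjective E := by
    intro ζ
    obtain ⟨w, hw, rfl⟩ := exists_joukowski_eq ζ
    have : ∃ x, (‖w‖ : ℂ) * anglePoint k c x = w := by
      rcases eq_or_ne w 0 with rfl | h0
      · exact ⟨0, by simp⟩
      · have hn : ‖w‖ ≠ 0 := norm_ne_zero_iff.2 h0
        obtain ⟨x, hx⟩ := exists_anglePoint_eq (k := k) (c := c) hk (w := w / ‖w‖) (by
          rw [norm_div, norm_real, norm_norm, div_self hn])
        exact ⟨x, by rw [hx, mul_div_cancel₀ _ (ofReal_ne_zero.2 hn)]⟩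
    obtain ⟨x, hx⟩ := this
    obtain ⟨y, hy, n, hn⟩ := exists_mem_Icc_eq_add hk x
    refine ⟨⟨(‖w‖, y), ⟨norm_nonneg _, hw⟩, hy⟩, ?_⟩
    change joukowski (‖w‖ * anglePoint k c y) = _
    rw [← (anglePoint_eq_iff hk).2 ⟨n, hn⟩, hx]
  let b : ψQ ⁻¹' Metric.ball 0 1 → MulAction.orbitRel.Quotient Γ UnitDisc := fun q =>
    Quotient.mk _ (kleinHomeo ((Metric.ball 0 1).restrictPreimage ψQ q))
  have qb : Topology.IsQuotientMap b := by
    have cb : Continuous b := continuous_quot_mk.comp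
      (kleinHomeo.continuous.comp (cψ.restrictPreimage))
    refine IsClosedMap.isQuotientMap (fun F hF => ?_) cb ?_
    · have h1 := kleinHomeo.isClosedMap _ ((cψ.isClosedMap.restrictPreimage _) F hF)
      have h2 := m.isClosed_image_mk hpar h1 ?_
      · rw [image_image, image_image] at h2
        exact h2
      · rintro _ ⟨_, ⟨⟨⟨⟨r, x⟩, hr, hx⟩, hlt⟩, -, rfl⟩, rfl⟩
        exact m.ofKlein_mem_closure (mem_ball_zero_iff.1 hlt) (hψ.mem hr.1 hr.2)
    · intro q
      induction q using Quotient.inductionOn with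
      | h z =>
        obtain ⟨γ, hγ, hz⟩ := m.exists_smul_mem_closure hpar le_rfl m.piece_mem z
        obtain ⟨r, x, h0, h1, hrx⟩ := hψ.exists_eq _ (m.mem_closure_polygon_iff_klein.1 hz)
        obtain ⟨y, hy, hn⟩ := exists_mem_Icc_eq_add hk x
        have hxy : ψ (r, y) = klein (γ • z : UnitDisc) := by
          rw [← hrx, eq_comm, hψ.eq_iff h0 h0]
          exact ⟨rfl, Or.inr hn⟩
        refine ⟨⟨⟨(r, y), ⟨h0, h1⟩, hy⟩, ?_⟩, ?_⟩
        · change ψ (r, y) ∈ Metric.ball (0 : ℂ) 1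
          rw [hxy, mem_ball_zero_iff]
          exact norm_klein_lt (UnitDisc.norm_lt_one _)
        · refine Quotient.sound ⟨⟨γ, hγ⟩, ?_⟩
          apply kleinHomeo.symm.injective
          rw [kleinHomeo.symm_apply_apply]
          exact Subtype.ext hxy.symm
  have qf : Topology.IsQuotientMap ((Pᶜ).restrictPreimage E ∘ Homeomorph.setCongr hPE.symm) :=
    (IsClosedMap.isQuotientMap (cE.isClosedMap.restrictPreimage _) cE.restrictPreimage
      (sE.restrictPreimage _)).comp (Homeomorph.isQuotientMap _)
  refine qb.nonempty_homeomorph qf ?_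
  rintro ⟨⟨⟨r, x⟩, hr, hx⟩, hlt⟩ ⟨⟨⟨s, y⟩, hs, hy⟩, hlt'⟩
  have key := m.joukowski_eq_iff_exists_smul hpar hψ hr.1 hr.2 hs.1 hs.2
    (mem_ball_zero_iff.1 hlt) (mem_ball_zero_iff.1 hlt')
  rw [Function.comp_apply, Function.comp_apply, Subtype.ext_iff]
  refine Iff.trans ?_ key.symm
  rw [eq_comm]
  exact Quotient.eq

end

end IsFoldedPolygon

/-! ### Orbifold points -/

namespace IsFoldedPolygon

variable {Γ : Subgroup DiscAut} {k : ℕ} {c : ℤ} {θ : ℤ → ℝ} {g : ℤ → DiscAut}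
  (m : IsFoldedPolygon Γ k c θ g)
include m

/-- The points of the closed polygon with non-trivial stabilizer are the midpoints of the edges that
are paired with themselves. -/
lemma exists_edge_of_smul_eq {z : UnitDisc} (hz : z ∈ closure (polygon θ)) {γ : Γ} (h1 : γ ≠ 1)
    (h : γ • z = z) : ∃ i, edgeSide θ i z = 0 ∧ (γ : DiscAut) = g i :=
  m.exists_piece_eq γ.2 (fun h => h1 (Subtype.ext h)) hz
    (by rw [show (γ : DiscAut) • z = z from h]; exact hz)

/-- A point of the disc lies on at most one edge, which determines the element. -/
lemma eq_of_smul_eq {z : UnitDisc} (hz : z ∈ closure (polygon θ)) {γ δ : Γ} (h1 : γ ≠ 1)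
    (h : γ • z = z) (h1' : δ ≠ 1) (h' : δ • z = z) : γ = δ := by
  obtain ⟨i, hi, e⟩ := m.exists_edge_of_smul_eq hz h1 h
  obtain ⟨j, hj, e'⟩ := m.exists_edge_of_smul_eq hz h1' h'
  have : pt θ i = pt θ j := by
    by_contra hne
    exact (m.edgeSide_pos_of_edge m.three_le hne z.norm_lt_one hj).ne' hi
  exact Subtype.ext (by rw [e, e', m.piece_congr this])

variable (hpar : ∀ i, scale (g (c - i) * g i) (pt θ i) = 1)
include hpar

/-- A fixed point has parameter with 2x = c + nk; the parity of n selects one of the two classes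
modulo k. -/
lemma klein_eq_of_smul_eq {z : UnitDisc} (hz : z ∈ closure (polygon θ)) {γ : Γ} (h1 : γ ≠ 1)
    (h : γ • z = z) : klein z = perimeter θ (vertexWeight θ g) (c / 2) ∨
      klein z = perimeter θ (vertexWeight θ g) ((c + k) / 2) := by
  have hμ : ∀ i, 0 < vertexWeight θ g i := vertexWeight_pos
  obtain ⟨i, hi, e⟩ := m.exists_edge_of_smul_eq hz h1 h
  obtain ⟨s, h0, h1, hs⟩ := m.exists_perimeter_eq hμ z.norm_lt_one hi
  rw [← perimeter_add hμ h0 h1] at hs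
  have h2 := m.klein_act_piece_eq_perimeter hpar z.norm_lt_one hi hs
  rw [← e, ← coe_smul_disc, show (γ : DiscAut) • z = z from h, hs,
    m.perimeter_eq_iff hμ m.three_le m.vertexWeight_add] at h2
  obtain ⟨n, hn⟩ := h2
  rw [hs, m.perimeter_eq_iff hμ m.three_le m.vertexWeight_add,
    m.perimeter_eq_iff hμ m.three_le m.vertexWeight_add]
  obtain ⟨l, hl | hl⟩ := n.even_or_odd'
  · left
    refine ⟨l, ?_⟩
    rw [hl] at hn
    push_cast at hn
    linarith
  · right
    refine ⟨l, ?_⟩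
    rw [hl] at hn
    push_cast at hn
    linarith

lemma encard_nontrivial_stabilizer_le :
    {q : MulAction.orbitRel.Quotient Γ UnitDisc |
      ∃ z : UnitDisc, q = Quotient.mk _ z ∧ MulAction.stabilizer Γ z ≠ ⊥}.encard ≤ 2 := by
  classical
  let f : ℂ → MulAction.orbitRel.Quotient Γ UnitDisc := fun w =>
    -- The value 0 outside the disc is a filler: `f` is only evaluated at Klein coordinates of
    -- points of the disc or merely counted.
    Quotient.mk _ (if h : ‖w‖ < 1 then ofKlein w h else 0)
  refine (encard_le_encard (t := f '' {perimeter θ (vertexWeight θ g) (c / 2),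
    perimeter θ (vertexWeight θ g) ((c + k) / 2)}) ?_).trans
    ((encard_image_le _ _).trans ((encard_insert_le _ _).trans (by
      rw [encard_singleton]; exact one_add_one_eq_two.le)))
  rintro _ ⟨z, rfl, hz⟩
  obtain ⟨γ, hγ, hcl⟩ := m.exists_smul_mem_closure hpar le_rfl m.piece_mem z
  obtain ⟨⟨δ, hδ⟩, hδ'⟩ := Subgroup.ne_bot_iff_exists_ne_one.1 hz
  have hδ1 : δ ≠ 1 := fun h => hδ' (Subtype.ext h)
  let γ' : Γ := ⟨γ, hγ⟩
  have h1 : γ' * δ * γ'⁻¹ ≠ 1 := fun h => hδ1 (by simpa using h)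
  have h2 : (γ' * δ * γ'⁻¹) • (γ' • z) = γ' • z := by
    rw [mul_smul, inv_smul_smul, mul_smul, MulAction.mem_stabilizer_iff.1 hδ]
  have h3 := m.klein_eq_of_smul_eq hpar (z := γ' • z) hcl h1 h2
  refine ⟨klein (γ' • z : UnitDisc), h3, ?_⟩
  have hn := norm_klein_lt (γ' • z : UnitDisc).norm_lt_one
  have h4 : f (klein (γ' • z : UnitDisc)) = Quotient.mk _ (γ' • z) := by
    simp only [f, dif_pos hn]
    congr 1
    exact UnitDisc.coe_injective (kleinInv_klein (UnitDisc.norm_lt_one _))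
  rw [h4]
  exact Quotient.sound ⟨γ', rfl⟩

lemma card_stabilizer_eq_two (z : UnitDisc) (hz : MulAction.stabilizer Γ z ≠ ⊥) :
    Nat.card (MulAction.stabilizer Γ z) = 2 := by
  obtain ⟨γ, hγ, hcl⟩ := m.exists_smul_mem_closure hpar le_rfl m.piece_mem z
  let γ' : Γ := ⟨γ, hγ⟩
  obtain ⟨δ, hδ⟩ := Subgroup.ne_bot_iff_exists_ne_one.1 hz
  rw [Nat.card_eq_two_iff' (1 : MulAction.stabilizer Γ z)]
  refine ⟨δ, hδ, fun ε hε => ?_⟩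
  have h1 : ∀ a : MulAction.stabilizer Γ z, a ≠ 1 → γ' * a.1 * γ'⁻¹ ≠ 1 := fun a ha h =>
    ha (Subtype.ext (by simpa using h))
  have h2 : ∀ a : MulAction.stabilizer Γ z, (γ' * a.1 * γ'⁻¹) • (γ' • z) = γ' • z := fun a => by
    rw [mul_smul, inv_smul_smul, mul_smul, MulAction.mem_stabilizer_iff.1 a.2]
  have := m.eq_of_smul_eq (z := γ' • z) hcl (h1 ε hε) (h2 ε) (h1 δ hδ) (h2 δ)
  exact Subtype.ext (mul_left_cancel (mul_right_cancel this))

lemma isPuncturedSphereWithOrderTwoPoints : IsPuncturedSphereWithOrderTwoPoints Γ where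
  punctured_sphere := m.exists_homeomorph_punctured_sphere hpar
  at_most_two := m.encard_nontrivial_stabilizer_le hpar
  order_two := m.card_stabilizer_eq_two hpar

end IsFoldedPolygon

end FuchsianMarkov

end

theorem mainTheorem10 (Γ : Subgroup FuchsianMarkov.DiscAut)
    (hΓ : FuchsianMarkov.IsFuchsian Γ) (hcov : FuchsianMarkov.HasFiniteCovolume Γ)
    (A : FuchsianMarkov.PiecewiseMobiusMap)
    (hA : A.IsPiecewiseFuchsianMarkov) (hmin : A.IsMinimal)
    (hpiece : ∀ j, A.piece j ∈ Γ)
    (hedge : A.IsBackwardEdgeOrbitEquivalent Γ) :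
    FuchsianMarkov.IsBowenSeriesMap Γ A.fundamentalDomain A.toFun ∧
    FuchsianMarkov.IsFundamentalDomain Γ A.fundamentalDomain ∧
    FuchsianMarkov.IsPuncturedSphereWithOrderTwoPoints Γ := by
  obtain ⟨c, m⟩ := FuchsianMarkov.PiecewiseMobiusMap.exists_isFoldedPolygon hΓ hA hmin hpiece hedge
  have hpar := m.scale_vertexMap hA.expansive A.toFun_eq
  exact ⟨m.isBowenSeriesMap hpar A.toFun_eq, m.isFundamentalDomain hpar,
    m.isPuncturedSphereWithOrderTwoPoints hpar⟩
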